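/- Let $\mu_0>0$. A \emph{material} is given by a permittivity $\varepsilon(x,\omega)\in\mathbb R$, locally integrable in $x$, with $\varepsilon(x+1,\omega)=\varepsilon(x,\omega)$ and $\varepsilon(1-x,\omega)=\varepsilon(x,\omega)$ (periodic and mirror symmetric; for example piecewise constant in $x$). For such a profile put $$\mathcal L u=-\frac1{\mu_0}\frac{d}{dx}\Big(\frac1{\varepsilon(x,\omega)}\frac{du}{dx}\Big),$$ where $\mathcal Lu=\lambda u$ means that $u$ and its flux $v$ ($=\varepsilon^{-1}u'$) are locally absolutely continuous with $u'=\varepsilon v$ and $v'=-\mu_0\lambda u$ almost everywhere. For $\kappa\in[-\pi,\pi]$ let $\mathcal L(\kappa,\omega)$ be $\mathcal L$ acting on functions with $u(x+1)=e^{i\kappa}u(x)$, $v(x+1)=e^{i\kappa}v(x)$; its eigenfunctions are called Bloch modes. A frequency $\omega$ is in the Bloch spectrum if $\omega^2$ is an eigenvalue of $\mathcal L(\kappa,\omega)$ for some $\kappa\in[-\pi,\pi]$. For $0<a<b$ and an integer $n\ge 0$ we say that $[a,b]$ is an \emph{$n$-th band gap} if $a$ and $b$ are in the Bloch spectrum while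 every $\omega\in(a,b)$ is not, and, for every $\omega\in(a,b)$ and $\kappa\in(0,\pi)$, exactly $n$ positive eigenvalues of $\mathcal L(\kappa,\omega)$ are smaller than $\omega^2$. Its \emph{bulk index} $\mathcal J_n$ is $+1$ if the Bloch mode $u$ at the lower edge $\omega=a$ is symmetric, $u(1-x)=u(x)$, and $-1$ if it is antisymmetric, $u(1-x)=-u(x)$. Let $A$ and $B$ be two materials with permittivities $\varepsilon_A,\varepsilon_B$ and with $n$-th band gaps $\mathfrak A_n^A=[a_A,b_A]$, $\mathfrak A_n^B=[a_B,b_B]\subset(0,\infty)$ (same $n$) whose interiors intersect, and let $\mathfrak A_n=\mathfrak A_n^A\cap\mathfrak A_n^B$. Assume that for every $x$ the function $\omega\mapsto\varepsilon_A(x,\omega)$ is continuous and non-decreasing on $\mathfrak A_n^A$, and $\omega\mapsto\varepsilon_B(x,\omega)$ is continuous and non-decreasing on $\mathfrak A_n^B$. Glue the materials at $x=0$: $\varepsilon=\varepsilon_A$ for $x<0$ and $\varepsilon=\varepsilon_B$ for $x\ge 0$. An \emph{interface mode} at frequency $\omega$ is a solution $u\not\equiv0$ of $\mathcal Lu=\omega^2u$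 on $\mathbb R$ for the glued permittivity with $u(x)\to0$ as $|x|\to\infty$. Let $\mathcal J_{n,A},\mathcal J_{n,B}$ be the bulk indices of $\mathfrak A_n^A$ and $\mathfrak A_n^B$. Then: - if $\mathcal J_{n,A}+\mathcal J_{n,B}\neq0$, no interface mode exists at any frequency $\omega\in\mathfrak A_n$; - if $\mathcal J_{n,A}+\mathcal J_{n,B}=0$, there is a unique frequency $\omega_m\in\mathfrak A_n$ at which an interface mode exists. -/

import Mathlib

open MeasureTheory Set Filter Topology

/-- `u` is a solution, with flux `v`, of `-(1/μ₀) (d/dx) ((1/e) du/dx) = lam * u` on the whole line,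
where `e : ℝ → ℝ` is a (locally integrable) permittivity profile.
As usual for discontinuous coefficients the equation is read as the first order system
`u' = e v`, `v' = -μ₀ lam u` for locally absolutely continuous `u` and `v`, written in integral form;
so `v = (1/e) du/dx`, and `u` and `(1/e) du/dx` are continuous, also across material interfaces. -/
structure IsSolution (e : ℝ → ℝ) (μ₀ lam : ℝ) (u v : ℝ → ℂ) : Prop where
  continuous_field : Continuous u
  continuous_flux : Continuous v
  field_eq : ∀ x : ℝ, u x = u 0 + ∫ t in (0 : ℝ)..x, (e t : ℂ) * v t
  flux_eq : ∀ x : ℝ, v x = v 0 - ((μ₀ * lam : ℝ) : ℂ) * ∫ t in (0 : ℝ)..x, u t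

/-- `u` (with flux `v`) is a Floquet-Bloch mode with quasiperiodicity `κ` and eigenvalue `lam`. -/
structure IsBlochMode (e : ℝ → ℝ) (μ₀ κ lam : ℝ) (u v : ℝ → ℂ) : Prop where
  isSolution : IsSolution e μ₀ lam u v
  ne_zero : u ≠ 0
  field_quasiperiodic : ∀ x : ℝ, u (x + 1) = Complex.exp (Complex.I * (κ : ℂ)) * u x
  flux_quasiperiodic : ∀ x : ℝ, v (x + 1) = Complex.exp (Complex.I * (κ : ℂ)) * v x

/-- `lam` is an eigenvalue of the operator with profile `e` on `κ`-quasiperiodic functions. -/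
def IsBlochEigenvalue (e : ℝ → ℝ) (μ₀ κ lam : ℝ) : Prop :=
  ∃ u v : ℝ → ℂ, IsBlochMode e μ₀ κ lam u v

/-- `ω` belongs to the Floquet-Bloch spectrum of the dispersive material with permittivity
`ε x ω`: the number `ω ^ 2` is an eigenvalue of `𝓛(κ, ω)` for some `κ ∈ [-π, π]`. -/
def InBlochSpectrum (ε : ℝ → ℝ → ℝ) (μ₀ ω : ℝ) : Prop :=
  ∃ κ ∈ Icc (-Real.pi) Real.pi, IsBlochEigenvalue (fun x => ε x ω) μ₀ κ (ω ^ 2)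

/-- `ω` lies strictly between the `n`-th and the `(n+1)`-st band: it is not in the Floquet-Bloch
spectrum, and for every `κ ∈ (0, π)` exactly `n` positive eigenvalues of `𝓛(κ, ω)` are smaller than
`ω ^ 2` (all positive eigenvalues are simple for these `κ`). -/
def InGap (ε : ℝ → ℝ → ℝ) (μ₀ : ℝ) (n : ℕ) (ω : ℝ) : Prop :=
  ¬ InBlochSpectrum ε μ₀ ω ∧
    ∀ κ ∈ Ioo 0 Real.pi,
      {lam : ℝ | 0 < lam ∧ lam < ω ^ 2 ∧
        IsBlochEigenvalue (fun x => ε x ω) μ₀ κ lam}.encard = n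

/-- `[a, b]`, an interval of positive frequencies, is an `n`-th band gap: its interior lies between
the `n`-th and the `(n+1)`-st band, and its two end points are band edges. -/
structure IsBandGap (ε : ℝ → ℝ → ℝ) (μ₀ : ℝ) (n : ℕ) (a b : ℝ) : Prop where
  pos : 0 < a
  lt : a < b
  interior : ∀ ω ∈ Ioo a b, InGap ε μ₀ n ω
  left_edge : InBlochSpectrum ε μ₀ a
  right_edge : InBlochSpectrum ε μ₀ b

/-- There is a Floquet-Bloch mode `u` at frequency `ω` with `u (1 - x) = u x`. -/
def HasSymmetricMode (ε : ℝ → ℝ → ℝ) (μ₀ ω : ℝ) : Prop :=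
  ∃ κ ∈ Icc (-Real.pi) Real.pi, ∃ u v : ℝ → ℂ,
    IsBlochMode (fun x => ε x ω) μ₀ κ (ω ^ 2) u v ∧ ∀ x : ℝ, u (1 - x) = u x

/-- There is a Floquet-Bloch mode `u` at frequency `ω` with `u (1 - x) = -u x`. -/
def HasAntisymmetricMode (ε : ℝ → ℝ → ℝ) (μ₀ ω : ℝ) : Prop :=
  ∃ κ ∈ Icc (-Real.pi) Real.pi, ∃ u v : ℝ → ℂ,
    IsBlochMode (fun x => ε x ω) μ₀ κ (ω ^ 2) u v ∧ ∀ x : ℝ, u (1 - x) = -u x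

open Classical in
/-- The bulk index of a band gap with lower edge `a`: `+1` if the mode at `a` is symmetric, `-1` if
it is antisymmetric. (The value `0` is a filler; one of the two cases holds at the edge of a gap.) -/
noncomputable def bulkIndex (ε : ℝ → ℝ → ℝ) (μ₀ a : ℝ) : ℤ :=
  if HasSymmetricMode ε μ₀ a then 1 else if HasAntisymmetricMode ε μ₀ a then -1 else 0

/-- A periodic, mirror symmetric dispersive material whose permittivity `ε x ω` depends continuously
on the frequency and is non-decreasing in it, for frequencies `ω` in `S`. -/
structure IsMirrorMaterialOn (ε : ℝ → ℝ → ℝ) (S : Set ℝ) : Prop where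
  locallyIntegrable : ∀ ω ∈ S, LocallyIntegrable (fun x => ε x ω)
  periodic : ∀ ω ∈ S, ∀ x : ℝ, ε (x + 1) ω = ε x ω
  mirror : ∀ ω ∈ S, ∀ x : ℝ, ε (1 - x) ω = ε x ω
  continuousOn : ∀ x : ℝ, ContinuousOn (ε x) S
  monotoneOn : ∀ x : ℝ, MonotoneOn (ε x) S

/-- Material `A` on `x < 0` glued to material `B` on `x ≥ 0`, at frequency `ω`. -/
noncomputable def gluedProfile (εA εB : ℝ → ℝ → ℝ) (ω x : ℝ) : ℝ :=
  if x < 0 then εA x ω else εB x ω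

/-- An interface mode at frequency `ω`: a non-zero solution of `𝓛 u = ω ^ 2 u` for the glued
structure that decays as `|x| → ∞`. -/
def HasInterfaceMode (εA εB : ℝ → ℝ → ℝ) (μ₀ ω : ℝ) : Prop :=
  ∃ u v : ℝ → ℂ, IsSolution (gluedProfile εA εB ω) μ₀ (ω ^ 2) u v ∧ u ≠ 0 ∧
    Tendsto u (cocompact ℝ) (𝓝 0)

/-! An interface mode exists at `ω` exactly when one nonzero state at `0` decays to the left in `A`
and to the right in `B`. Mirror symmetry makes both decaying lines explicit. Let `(P Q; R S)` be the
transfer matrix from `1/2` to `1`, of determinant one; its columns come from the even and the odd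
solution about `1/2`. The monodromy matrix is `(A 2PQ; 2RS A)` with `A = PS + QR`, and `A² - 1 =
4PQRS`. So `ω` is off the spectrum iff `PQRS > 0` (`cell_nonpos_iff`), band edges of a gap are zeros
of `PQRS`, and a symmetric mode means `PR = 0`.

Monotonicity comes from Lagrange's identity: increasing the profile and the spectral parameter turns
the state at `1` clockwise (`exists_forall_wronskian_neg`). No sign of the permittivity is needed.
Hence `R/P` strictly decreases and `Q/S` strictly increases with `ω` across the gap.

The number `n` of bands enters through `τ = (-1)^n`, the sign of `A` in the gap. At frozen profile
the half trace starts from `1` at `λ = 0`, its zeros are the eigenvalues for `κ = π/2`, and it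
changes sign at each of them (`neg_one_pow_mul_cellA_pos`).

In a gap the quotients `R/P` and `Q/S` are both positive or both negative. In the positive type `PQ`
vanishes at the lower edge and `RS` at the upper one; the negative type is the reverse. Together
with `τ` the type determines the bulk index, which turns out to be minus the sign of `PQ` in the gap
(`index_cases`).

A solution in `B` decays to the right iff `τ √(PQRS) u(0) + PQ v(0) = 0`; reflection gives the line
for `A`. With primes for `B`, the two lines agree iff `√(P'Q'R'S') PQ + √(PQRS) P'Q' = 0`. For equal
indices both terms have the same sign, so there is no solution. For opposite indices the condition
becomes `PQ·R'S' = P'Q'·RS`. It says that a product of two positive strictly increasing functions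
equals one, and the edge values force exactly one solution (`existsUnique_matching`). At band edges
nothing decays (`state_eq_zero_of_tendsto_atTop`), so the closed gaps add no modes. -/

/-! ### The real first order system and Lagrange's identity -/

/-- Real solutions of the first order system `u' = e v`, `v' = -m u`. -/
structure RealSolution (e : ℝ → ℝ) (m : ℝ) (u v : ℝ → ℝ) : Prop where
  continuous_field : Continuous u
  continuous_flux : Continuous v
  field_sub : ∀ x y : ℝ, u y - u x = ∫ t in x..y, e t * v t
  flux_sub : ∀ x y : ℝ, v y - v x = -m * ∫ t in x..y, u t

theorem MeasureTheory.LocallyIntegrable.intervalIntegrable' {e : ℝ → ℝ} (he : LocallyIntegrable e)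
    (x y : ℝ) : IntervalIntegrable e volume x y :=
  intervalIntegrable_iff.mpr <|
    (he.integrableOn_isCompact isCompact_uIcc).mono_set uIoc_subset_uIcc

/-- Product rule for primitives of locally integrable functions. -/
theorem mul_sub_mul_eq_integral {f g f' g' : ℝ → ℝ} (hf' : LocallyIntegrable f')
    (hg' : LocallyIntegrable g') (hf : ∀ x y, f y - f x = ∫ t in x..y, f' t)
    (hg : ∀ x y, g y - g x = ∫ t in x..y, g' t) (x y : ℝ) :
    f y * g y - f x * g x = ∫ t in x..y, (f' t * g t + f t * g' t) := by
  have key : ∀ {h h' : ℝ → ℝ}, LocallyIntegrable h' → (∀ x y, h y - h x = ∫ t in x..y, h' t) →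
      AbsolutelyContinuousOnInterval h x y ∧ ∀ᵐ t, deriv h t = h' t := by
    intro h h' hh' hh
    have hform : h = fun t => (fun t => ∫ s in x..t, h' s) t - (fun _ => -h x) t := by
      funext t
      simp only [← hh]
      ring
    constructor
    · rw [hform]
      have h2 : AbsolutelyContinuousOnInterval (fun _ : ℝ => -h x) x y :=
        (LipschitzOnWith.of_dist_le_mul (K := 0)
          (by simp)).absolutelyContinuousOnInterval
      exact ((hh'.intervalIntegrable' x y).absolutelyContinuousOnInterval_intervalIntegral
        left_mem_uIcc).sub h2
    · filter_upwards [LocallyIntegrable.ae_hasDerivAt_integral hh'] with t ht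
      rw [hform]
      exact ((ht x).sub_const _).deriv
  obtain ⟨fa, fd⟩ := key hf' hf
  obtain ⟨ga, gd⟩ := key hg' hg
  rw [← fa.integral_deriv_mul_eq_sub ga]
  apply intervalIntegral.integral_congr_ae
  filter_upwards [fd, gd] with t h1 h2 _
  rw [h1, h2]

namespace RealSolution

variable {e e₁ e₂ : ℝ → ℝ} {m m₁ m₂ : ℝ} {u v u₁ v₁ u₂ v₂ : ℝ → ℝ}

theorem mul_flux_sub (he : LocallyIntegrable e₁)
    (h₁ : RealSolution e₁ m₁ u₁ v₁) (h₂ : RealSolution e₂ m₂ u₂ v₂) (x y : ℝ) :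
    u₁ y * v₂ y - u₁ x * v₂ x = ∫ t in x..y, (e₁ t * (v₁ t * v₂ t) - m₂ * (u₁ t * u₂ t)) := by
  rw [mul_sub_mul_eq_integral (f := u₁) (g := v₂) (f' := fun t => e₁ t * v₁ t)
    (g' := fun t => -m₂ * u₂ t) (he.mul_continuous h₁.continuous_flux)
    (continuous_const.mul h₂.continuous_field).locallyIntegrable h₁.field_sub
    (fun x y => by rw [h₂.flux_sub, intervalIntegral.integral_const_mul])]
  congr 1
  funext t
  ring

/-- Lagrange's identity. -/
theorem wronskian_sub (he₁ : LocallyIntegrable e₁) (he₂ : LocallyIntegrable e₂)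
    (h₁ : RealSolution e₁ m₁ u₁ v₁) (h₂ : RealSolution e₂ m₂ u₂ v₂) (x y : ℝ) :
    (u₁ y * v₂ y - v₁ y * u₂ y) - (u₁ x * v₂ x - v₁ x * u₂ x) =
      -∫ t in x..y, ((e₂ t - e₁ t) * (v₁ t * v₂ t) + (m₂ - m₁) * (u₁ t * u₂ t)) := by
  have a := mul_flux_sub he₁ h₁ h₂ x y
  have b := mul_flux_sub he₂ h₂ h₁ x y
  have c1 : Continuous fun t => v₁ t * v₂ t := h₁.continuous_flux.mul h₂.continuous_flux
  have c2 : Continuous fun t => u₁ t * u₂ t := h₁.continuous_field.mul h₂.continuous_field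
  have c3 : Continuous fun t => v₂ t * v₁ t := h₂.continuous_flux.mul h₁.continuous_flux
  have c4 : Continuous fun t => u₂ t * u₁ t := h₂.continuous_field.mul h₁.continuous_field
  have i1 : IntervalIntegrable (fun t => e₁ t * (v₁ t * v₂ t) - m₂ * (u₁ t * u₂ t)) volume x y :=
    ((he₁.mul_continuous c1).intervalIntegrable' x y).sub ((c2.intervalIntegrable x y).const_mul m₂)
  have i2 : IntervalIntegrable (fun t => e₂ t * (v₂ t * v₁ t) - m₁ * (u₂ t * u₁ t)) volume x y :=
    ((he₂.mul_continuous c3).intervalIntegrable' x y).sub ((c4.intervalIntegrable x y).const_mul m₁)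
  have : (u₁ y * v₂ y - v₁ y * u₂ y) - (u₁ x * v₂ x - v₁ x * u₂ x) =
    (u₁ y * v₂ y - u₁ x * v₂ x) - (u₂ y * v₁ y - u₂ x * v₁ x) := by ring
  rw [this, a, b, ← intervalIntegral.integral_sub i1 i2, ← intervalIntegral.integral_neg]
  congr 1
  funext t
  ring

theorem wronskian_eq (he : LocallyIntegrable e)
    (h₁ : RealSolution e m u₁ v₁) (h₂ : RealSolution e m u₂ v₂) (x y : ℝ) :
    u₁ y * v₂ y - v₁ y * u₂ y = u₁ x * v₂ x - v₁ x * u₂ x := by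
  have := wronskian_sub he he h₁ h₂ x y
  simp only [sub_self, zero_mul, add_zero, intervalIntegral.integral_zero, neg_zero] at this
  linarith

theorem linearCombination (he : LocallyIntegrable e) (h₁ : RealSolution e m u₁ v₁)
    (h₂ : RealSolution e m u₂ v₂) (a b : ℝ) :
    RealSolution e m (fun x => a * u₁ x + b * u₂ x) (fun x => a * v₁ x + b * v₂ x) where
  continuous_field := by have := h₁.continuous_field; have := h₂.continuous_field; fun_prop
  continuous_flux := by have := h₁.continuous_flux; have := h₂.continuous_flux; fun_prop
  field_sub x y := by
    have i1 := (he.mul_continuous h₁.continuous_flux).intervalIntegrable' x y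
    have i2 := (he.mul_continuous h₂.continuous_flux).intervalIntegrable' x y
    calc _ = a * (u₁ y - u₁ x) + b * (u₂ y - u₂ x) := by ring
      _ = _ := by
        rw [h₁.field_sub, h₂.field_sub, ← intervalIntegral.integral_const_mul,
          ← intervalIntegral.integral_const_mul,
          ← intervalIntegral.integral_add (i1.const_mul a) (i2.const_mul b)]
        congr 1
        funext t
        ring
  flux_sub x y := by
    have i1 := h₁.continuous_field.intervalIntegrable (μ := volume) x y
    have i2 := h₂.continuous_field.intervalIntegrable (μ := volume) x y
    calc _ = a * (v₁ y - v₁ x) + b * (v₂ y - v₂ x) := by ring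
      _ = _ := by
        rw [h₁.flux_sub, h₂.flux_sub, intervalIntegral.integral_add (i1.const_mul a) (i2.const_mul b),
          intervalIntegral.integral_const_mul, intervalIntegral.integral_const_mul]
        ring

end RealSolution

/-! ### Existence for locally integrable profiles by a Neumann series -/

section Existence

variable {e : ℝ → ℝ} (m c : ℝ)

/-- The terms of the Neumann series of the Volterra equation `v = g - m ∫∫ e v`. -/
noncomputable def volterraTerm (e : ℝ → ℝ) (m c : ℝ) (g : ℝ → ℝ) : ℕ → ℝ → ℝ
  | 0 => g
  | n + 1 => fun x => -m * ∫ t in c..x, ∫ s in c..t, e s * volterraTerm e m c g n s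

theorem continuous_primitive_of_locallyIntegrable {f : ℝ → ℝ} (hf : LocallyIntegrable f) :
    Continuous fun x => ∫ t in c..x, f t :=
  intervalIntegral.continuous_primitive (fun a b => hf.intervalIntegrable' a b) c

theorem continuous_volterraTerm (he : LocallyIntegrable e) {g : ℝ → ℝ} (hg : Continuous g) (n : ℕ) :
    Continuous (volterraTerm e m c g n) := by
  induction n with
  | zero => exact hg
  | succ n ih =>
    have h1 := continuous_primitive_of_locallyIntegrable c (he.mul_continuous ih)
    exact continuous_const.mul (continuous_primitive_of_locallyIntegrable c h1.locallyIntegrable)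

theorem abs_integral_mul_le (he : LocallyIntegrable e) {w : ℝ → ℝ} {B R t : ℝ}
    (hB : ∀ s ∈ uIoc c t, |w s| ≤ B) (ht : |t - c| ≤ R) (hB0 : 0 ≤ B) :
    |∫ s in c..t, e s * w s| ≤ (∫ s in (c - R)..(c + R), |e s|) * B := by
  have hR : 0 ≤ R := (abs_nonneg _).trans ht
  have hsub : uIoc c t ⊆ Ioc (c - R) (c + R) := by
    intro s hs
    rw [abs_le] at ht
    rcases le_total c t with h | h
    · rw [uIoc_of_le h] at hs
      exact ⟨by linarith [hs.1], by linarith [hs.2]⟩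
    · rw [uIoc_of_ge h] at hs
      exact ⟨by linarith [hs.1], by linarith [hs.2]⟩
  have hi : IntegrableOn (fun s => |e s| * B) (Ioc (c - R) (c + R)) := by
    have := ((he.intervalIntegrable' (c - R) (c + R)).abs).mul_const B
    rwa [intervalIntegrable_iff, uIoc_of_le (by linarith)] at this
  have h1 : |∫ s in c..t, e s * w s| ≤ ∫ s in uIoc c t, |e s| * B := by
    have := intervalIntegral.norm_integral_le_integral_norm_uIoc (f := fun s => e s * w s)
      (a := c) (b := t) (μ := volume)
    rw [Real.norm_eq_abs] at this
    refine this.trans ?_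
    refine integral_mono_of_nonneg (Eventually.of_forall fun s => norm_nonneg _)
      (hi.mono_set hsub) ?_
    refine (ae_restrict_iff' measurableSet_uIoc).mpr (Eventually.of_forall fun s hs => ?_)
    simp only [norm_mul, Real.norm_eq_abs]
    exact mul_le_mul_of_nonneg_left (hB s hs) (abs_nonneg _)
  refine h1.trans ?_
  rw [← intervalIntegral.integral_mul_const, intervalIntegral.integral_of_le (by linarith)]
  exact setIntegral_mono_set hi (Eventually.of_forall fun s => by positivity)
    (LE.le.eventuallyLE hsub)

theorem abs_integral_abs_pow_le (B x : ℝ) (n : ℕ) {f : ℝ → ℝ}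
    (hf : ∀ t ∈ uIoc c x, |f t| ≤ B * |t - c| ^ n) :
    |∫ t in c..x, f t| ≤ B * (|x - c| ^ (n + 1) / (n + 1)) := by
  have hi : ∀ a b : ℝ, IntervalIntegrable (fun t => B * |t - c| ^ n) volume a b := fun a b =>
    (by fun_prop : Continuous fun t => B * |t - c| ^ n).intervalIntegrable a b
  rcases le_total c x with h | h
  · have := intervalIntegral.norm_integral_le_of_norm_le (f := f) (g := fun t => B * |t - c| ^ n)
      (a := c) (b := x) (μ := volume) h
      (Eventually.of_forall fun t ht => hf t (by rwa [uIoc_of_le h])) (hi c x)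
    refine (Real.norm_eq_abs _ ▸ this).trans (le_of_eq ?_)
    rw [intervalIntegral.integral_const_mul]
    congr 1
    rw [abs_of_nonneg (by linarith : (0 : ℝ) ≤ x - c)]
    rw [intervalIntegral.integral_congr (g := fun t => (t - c) ^ n) (fun t ht => by
      rw [uIcc_of_le h] at ht
      simp only
      rw [abs_of_nonneg (by linarith [ht.1])])]
    rw [intervalIntegral.integral_comp_sub_right (fun t => t ^ n) c, integral_pow]
    simp
  · have := intervalIntegral.norm_integral_le_of_norm_le (f := f) (g := fun t => B * |t - c| ^ n)
      (a := x) (b := c) (μ := volume) h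
      (Eventually.of_forall fun t ht => hf t (by rwa [uIoc_of_ge h])) (hi x c)
    rw [intervalIntegral.integral_symm, abs_neg]
    refine (Real.norm_eq_abs _ ▸ this).trans (le_of_eq ?_)
    rw [intervalIntegral.integral_const_mul]
    congr 1
    rw [abs_of_nonpos (by linarith : x - c ≤ 0), neg_sub]
    rw [intervalIntegral.integral_congr (g := fun t => (c - t) ^ n) (fun t ht => by
      rw [uIcc_of_le h] at ht
      simp only
      rw [abs_of_nonpos (by linarith [ht.2]), neg_sub])]
    rw [intervalIntegral.integral_comp_sub_left (fun t => t ^ n) c, integral_pow]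
    simp

/-- Since `e` need not be bounded, the inner integral only costs its `L¹` norm on the window. The
outer integral alone raises the power of `|x - c|`, and that suffices for the factorial. -/
theorem abs_volterraTerm_le (he : LocallyIntegrable e) {g : ℝ → ℝ} {G R : ℝ}
    (hG0 : 0 ≤ G) (hG : ∀ x, |x - c| ≤ R → |g x| ≤ G) (n : ℕ) {x : ℝ} (hx : |x - c| ≤ R) :
    |volterraTerm e m c g n x| ≤
      G * ((|m| * (∫ s in (c - R)..(c + R), |e s|) * |x - c|) ^ n / n.factorial) := by
  set K := ∫ s in (c - R)..(c + R), |e s| with hK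
  have hR : 0 ≤ R := (abs_nonneg _).trans hx
  have hK0 : 0 ≤ K := intervalIntegral.integral_nonneg (by linarith) fun s _ => abs_nonneg _
  have hmono : ∀ {c x t : ℝ}, t ∈ uIoc c x → |t - c| ≤ |x - c| := by
    intro c x t ht
    rcases le_total c x with h | h
    · rw [uIoc_of_le h] at ht
      rw [abs_of_nonneg (by linarith [ht.1]), abs_of_nonneg (by linarith)]
      linarith [ht.2]
    · rw [uIoc_of_ge h] at ht
      rw [abs_of_nonpos (by linarith [ht.2]), abs_of_nonpos (by linarith)]
      linarith [ht.1]
  induction n generalizing x with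
  | zero => simpa using! hG x hx
  | succ n ih =>
    have key : ∀ t ∈ uIoc c x, |∫ s in c..t, e s * volterraTerm e m c g n s| ≤
        (K * (G * (|m| * K) ^ n / n.factorial)) * |t - c| ^ n := by
      intro t ht
      have htx := hmono ht
      have := abs_integral_mul_le (e := e) c he (w := volterraTerm e m c g n) (R := R) (t := t)
        (B := G * ((|m| * K * |t - c|) ^ n / n.factorial)) (fun s hs => by
          refine (ih ((hmono hs).trans (htx.trans hx))).trans ?_
          have := hmono hs
          gcongr G * ((|m| * K * ?_) ^ n / _)) (htx.trans hx) (by positivity)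
      refine this.trans (le_of_eq ?_)
      rw [← hK, mul_pow (|m| * K)]
      ring
    have h2 := abs_integral_abs_pow_le c (K * (G * (|m| * K) ^ n / n.factorial)) x n key
    have : volterraTerm e m c g (n + 1) x =
      -m * ∫ t in c..x, ∫ s in c..t, e s * volterraTerm e m c g n s := rfl
    rw [this, abs_mul, abs_neg]
    refine (mul_le_mul_of_nonneg_left h2 (abs_nonneg m)).trans (le_of_eq ?_)
    rw [Nat.factorial_succ]
    push_cast
    field_simp
    ring

/-- Existence for the initial value problem, with a quantitative bound. -/
theorem exists_realSolution_bound (he : LocallyIntegrable e) (U V : ℝ) :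
    ∃ u v : ℝ → ℝ, RealSolution e m u v ∧ u c = U ∧ v c = V ∧
      ∀ R x, |x - c| ≤ R → |v x| ≤ (|V| + |m| * |U| * R) *
        Real.exp (|m| * (∫ s in (c - R)..(c + R), |e s|) * R) := by
  -- Inserting `u = U + ∫ e v` into the flux equation leaves a Volterra equation for `v` alone, with
  -- this inhomogeneity.
  set g : ℝ → ℝ := fun x => V - m * U * (x - c) with hg
  have gc : Continuous g := by fun_prop
  set w := volterraTerm e m c g with hw
  have wc : ∀ n, Continuous (w n) := fun n => continuous_volterraTerm m c he gc n
  set v : ℝ → ℝ := fun x => ∑' n, w n x with hv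
  set K : ℝ → ℝ := fun R => ∫ s in (c - R)..(c + R), |e s| with hK
  set b : ℝ → ℕ → ℝ := fun R n => (|V| + |m| * |U| * R) * ((|m| * K R * R) ^ n / n.factorial) with hb
  have hbs : ∀ R, HasSum (b R) ((|V| + |m| * |U| * R) * Real.exp (|m| * K R * R)) := by
    intro R
    rw [Real.exp_eq_exp_ℝ]
    exact (NormedSpace.expSeries_div_hasSum_exp (|m| * K R * R)).mul_left _
  have hwb : ∀ R x n, |x - c| ≤ R → ‖w n x‖ ≤ b R n := by
    intro R x n hx
    have hR : 0 ≤ R := (abs_nonneg _).trans hx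
    have hK0 : 0 ≤ K R := intervalIntegral.integral_nonneg (by linarith) fun s _ => abs_nonneg _
    refine (abs_volterraTerm_le m c he (G := |V| + |m| * |U| * R) (R := R) (by positivity)
      (fun y hy => ?_) n hx).trans ?_
    · simp only [hg]
      refine (abs_sub _ _).trans ?_
      rw [abs_mul, abs_mul]
      gcongr
    · simp only [hb]
      gcongr
  have hsum : ∀ x, HasSum (fun n => w n x) (v x) := fun x =>
    (Summable.of_norm_bounded (hbs |x - c|).summable fun n => hwb _ x n le_rfl).hasSum
  have hvb : ∀ R x, |x - c| ≤ R → |v x| ≤ (|V| + |m| * |U| * R) * Real.exp (|m| * K R * R) :=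
    fun R x hx => tsum_of_norm_bounded (hbs R) fun n => hwb R x n hx
  have vc : Continuous v := by
    rw [continuous_iff_continuousAt]
    intro x
    have : ContinuousOn v (Metric.closedBall c (|x - c| + 1)) :=
      continuousOn_tsum (fun n => (wc n).continuousOn) (hbs (|x - c| + 1)).summable
        fun n y hy => hwb _ y n (by simpa [Real.dist_eq] using hy)
    refine this.continuousAt (mem_of_superset (Metric.ball_mem_nhds x one_pos) fun y hy => ?_)
    rw [Metric.mem_ball, Real.dist_eq] at hy
    rw [Metric.mem_closedBall, Real.dist_eq]
    linarith [abs_sub_le y x c]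
  have hle : ∀ {x t : ℝ}, t ∈ uIoc c x → |t - c| ≤ |x - c| := by
    intro x t ht
    exact abs_sub_left_of_mem_uIcc (uIoc_subset_uIcc ht)
  have hI : ∀ x, HasSum (fun n => ∫ s in c..x, e s * w n s) (∫ s in c..x, e s * v s) := by
    intro x
    refine intervalIntegral.hasSum_integral_of_dominated_convergence
      (fun n s => |e s| * b |x - c| n) (fun n => ?_) (fun n => ?_) ?_ ?_ ?_
    · exact (he.mul_continuous (wc n)).aestronglyMeasurable.restrict
    · refine Eventually.of_forall fun s hs => ?_
      rw [norm_mul, Real.norm_eq_abs]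
      exact mul_le_mul_of_nonneg_left (hwb _ s n (hle hs)) (abs_nonneg _)
    · exact Eventually.of_forall fun s _ => ((hbs |x - c|).summable).mul_left _
    · simp_rw [tsum_mul_left]
      exact ((he.intervalIntegrable' c x).abs).mul_const _
    · exact Eventually.of_forall fun s _ => (hsum s).mul_left _
  have hII : ∀ x, HasSum (fun n => ∫ t in c..x, ∫ s in c..t, e s * w n s)
      (∫ t in c..x, ∫ s in c..t, e s * v s) := by
    intro x
    have hR : 0 ≤ |x - c| := abs_nonneg _
    refine intervalIntegral.hasSum_integral_of_dominated_convergence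
      (fun n _ => K |x - c| * b |x - c| n) (fun n => ?_) (fun n => ?_) ?_ ?_ ?_
    · exact (continuous_primitive_of_locallyIntegrable c
        (he.mul_continuous (wc n))).aestronglyMeasurable
    · refine Eventually.of_forall fun t ht => ?_
      refine abs_integral_mul_le c he (fun s hs => hwb _ s n ((hle hs).trans (hle ht))) (hle ht) ?_
      exact (norm_nonneg _).trans (hwb |x - c| x n le_rfl)
    · exact Eventually.of_forall fun s _ => ((hbs |x - c|).summable).mul_left _
    · simp
    · exact Eventually.of_forall fun s _ => hI s
  set u : ℝ → ℝ := fun x => U + ∫ s in c..x, e s * v s with hu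
  have ev := he.mul_continuous vc
  have uc : Continuous u :=
    continuous_const.add (continuous_primitive_of_locallyIntegrable c ev)
  have hvx : ∀ x, v x = V - m * ∫ t in c..x, u t := by
    intro x
    have h1 := (hsum x).tsum_eq
    rw [(hsum x).summable.tsum_eq_zero_add] at h1
    have h2 : ∑' n, w (n + 1) x = -m * ∫ t in c..x, ∫ s in c..t, e s * v s :=
      ((hII x).mul_left (-m)).tsum_eq
    have h3 : ∫ t in c..x, u t = U * (x - c) + ∫ t in c..x, ∫ s in c..t, e s * v s := by
      rw [hu, intervalIntegral.integral_add (by simp)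
        ((continuous_primitive_of_locallyIntegrable c ev).intervalIntegrable _ _)]
      simp [mul_comm]
    rw [← h1, h2, h3, show w 0 x = V - m * U * (x - c) from rfl]
    ring
  refine ⟨u, v, ⟨uc, vc, fun x y => ?_, fun x y => ?_⟩, by simp [hu], by simp [hvx c], hvb⟩
  · simp only [hu]
    rw [add_sub_add_left_eq_sub, intervalIntegral.integral_interval_sub_left
      (ev.intervalIntegrable' _ _) (ev.intervalIntegrable' _ _)]
  · rw [hvx x, hvx y, ← intervalIntegral.integral_interval_sub_left (a := c) (b := y) (c := x)
      (uc.intervalIntegrable _ _) (uc.intervalIntegrable _ _)]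
    ring

end Existence

/-! ### Uniqueness, continuous dependence and clockwise turning -/

/-- The maximum on the compact interval can only sit at `b`. This turns local comparison to the
right into global comparison without differentiability. -/
theorem lt_of_forall_exists_gt {f : ℝ → ℝ} {a b : ℝ} (hab : a < b) (hf : ContinuousOn f (Icc a b))
    (h : ∀ t ∈ Ico a b, ∃ s ∈ Ioc t b, f t < f s) : f a < f b := by
  obtain ⟨c, hc, hmax⟩ := isCompact_Icc.exists_isMaxOn (nonempty_Icc.mpr hab.le) hf
  have hcb : c = b := by
    by_contra hne
    obtain ⟨s, hs, hlt⟩ := h c ⟨hc.1, lt_of_le_of_ne hc.2 hne⟩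
    exact absurd (hmax (show s ∈ Icc a b from ⟨hc.1.trans hs.1.le, hs.2⟩)) (not_le.mpr hlt)
  obtain ⟨s, hs, hlt⟩ := h a ⟨le_rfl, hab⟩
  have : f s ≤ f c := hmax (show s ∈ Icc a b from ⟨hs.1.le, hs.2⟩)
  rw [hcb] at this
  linarith

namespace RealSolution

variable {e e₀ : ℝ → ℝ} {m m₀ c R : ℝ} {u v u₀ v₀ u₁ v₁ u₂ v₂ : ℝ → ℝ}

/-- Uniqueness follows from existence: the Wronskians with a fundamental pair are constant, hence
zero, and the pair has Wronskian one. -/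
theorem eq_zero_of_eq_zero (he : LocallyIntegrable e) (h : RealSolution e m u v)
    (hu : u c = 0) (hv : v c = 0) (x : ℝ) : u x = 0 ∧ v x = 0 := by
  obtain ⟨p, r, hpr, hp, hr, -⟩ := exists_realSolution_bound m c he 1 0
  obtain ⟨q, s, hqs, hq, hs, -⟩ := exists_realSolution_bound m c he 0 1
  have h1 := wronskian_eq he hpr hqs c x
  have h2 := wronskian_eq he hpr h c x
  have h3 := wronskian_eq he hqs h c x
  simp only [hp, hr, hq, hs, hu, hv] at h1 h2 h3
  constructor
  · linear_combination (-u x) * h1 - p x * h3 + q x * h2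
  · linear_combination (-v x) * h1 + s x * h2 - r x * h3

/-- Uniqueness for the initial value problem. -/
theorem eq_of_eq (he : LocallyIntegrable e) (h₁ : RealSolution e m u₁ v₁)
    (h₂ : RealSolution e m u₂ v₂) (hu : u₁ c = u₂ c) (hv : v₁ c = v₂ c) (x : ℝ) :
    u₁ x = u₂ x ∧ v₁ x = v₂ x := by
  have := eq_zero_of_eq_zero (c := c) he (linearCombination he h₁ h₂ 1 (-1)) (by simp [hu])
    (by simp [hv]) x
  constructor <;> linarith [this.1, this.2]

theorem abs_le_of_integral_le (he : LocallyIntegrable e) (h : RealSolution e m u v) {E M x : ℝ}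
    (hE : ∫ s in (c - R)..(c + R), |e s| ≤ E) (hM : |m| ≤ M) (hx : |x - c| ≤ R) :
    |u x| ≤ |u c| + (1 + E) * ((|v c| + M * |u c| * R) * Real.exp (M * E * R)) ∧
    |v x| ≤ |u c| + (1 + E) * ((|v c| + M * |u c| * R) * Real.exp (M * E * R)) := by
  obtain ⟨u', v', h', hu', hv', hb⟩ := exists_realSolution_bound m c he (u c) (v c)
  have hR : 0 ≤ R := (abs_nonneg _).trans hx
  have hK0 : 0 ≤ ∫ s in (c - R)..(c + R), |e s| :=
    intervalIntegral.integral_nonneg (by linarith) fun s _ => abs_nonneg _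
  have hM0 : 0 ≤ M := (abs_nonneg _).trans hM
  have hE0 : 0 ≤ E := hK0.trans hE
  set B := (|v c| + M * |u c| * R) * Real.exp (M * E * R) with hB
  have hB0 : 0 ≤ B := by positivity
  have hv : ∀ x, |x - c| ≤ R → |v x| ≤ B := by
    intro x hx
    rw [(eq_of_eq (c := c) he h h' hu'.symm hv'.symm x).2]
    refine (hb R x hx).trans ?_
    rw [hB]
    gcongr
  have hu : |u x - u c| ≤ E * B := by
    rw [h.field_sub]
    refine (abs_integral_mul_le c he (fun s hs => hv s
      ((abs_sub_left_of_mem_uIcc (uIoc_subset_uIcc hs)).trans hx)) hx hB0).trans ?_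
    gcongr
  constructor
  · have := abs_add_le (u x - u c) (u c)
    rw [sub_add_cancel] at this
    linarith
  · have := hv x hx
    have := abs_nonneg (u c)
    nlinarith

/-- With `u₀` running through a fundamental pair, this controls both components of a perturbed
solution, so no Gronwall argument is needed. -/
theorem abs_wronskian_sub_le (he₀ : LocallyIntegrable e₀) (he : LocallyIntegrable e)
    (h₀ : RealSolution e₀ m₀ u₀ v₀) (h : RealSolution e m u v) {B₀ B x : ℝ}
    (h₀u : ∀ s, |s - c| ≤ R → |u₀ s| ≤ B₀) (h₀v : ∀ s, |s - c| ≤ R → |v₀ s| ≤ B₀)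
    (hu : ∀ s, |s - c| ≤ R → |u s| ≤ B) (hv : ∀ s, |s - c| ≤ R → |v s| ≤ B) (hx : |x - c| ≤ R) :
    |(u₀ x * v x - v₀ x * u x) - (u₀ c * v c - v₀ c * u c)| ≤
      ((∫ s in (c - R)..(c + R), |e s - e₀ s|) + 2 * R * |m - m₀|) * (B₀ * B) := by
  have hB₀ : 0 ≤ B₀ := (abs_nonneg _).trans (h₀u x hx)
  have hB : 0 ≤ B := (abs_nonneg _).trans (hu x hx)
  have hd : LocallyIntegrable (fun t => e t - e₀ t) := he.sub he₀
  have c1 : Continuous fun t => v₀ t * v t := h₀.continuous_flux.mul h.continuous_flux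
  have c2 : Continuous fun t => u₀ t * u t := h₀.continuous_field.mul h.continuous_field
  have hs : ∀ s ∈ uIoc c x, |s - c| ≤ R := fun s hs =>
    (abs_sub_left_of_mem_uIcc (uIoc_subset_uIcc hs)).trans hx
  rw [wronskian_sub he₀ he h₀ h c x, abs_neg, intervalIntegral.integral_add
    ((hd.mul_continuous c1).intervalIntegrable' _ _) ((c2.intervalIntegrable _ _).const_mul _)]
  refine (abs_add_le _ _).trans ?_
  rw [add_mul]
  refine add_le_add ?_ ?_
  · refine abs_integral_mul_le c hd (fun s hs' => ?_) hx (by positivity)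
    rw [abs_mul]
    exact mul_le_mul (h₀v s (hs s hs')) (hv s (hs s hs')) (abs_nonneg _) hB₀
  · refine (abs_integral_mul_le c (e := fun _ => m - m₀) continuous_const.locallyIntegrable
      (B := B₀ * B) (fun s hs' => ?_) hx (by positivity)).trans (le_of_eq ?_)
    · rw [abs_mul]
      exact mul_le_mul (h₀u s (hs s hs')) (hu s (hs s hs')) (abs_nonneg _) hB₀
    · rw [intervalIntegral.integral_const, smul_eq_mul]
      ring

theorem integral_abs_le (he₀ : LocallyIntegrable e₀) (he : LocallyIntegrable e) (hR : 0 ≤ R) :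
    ∫ s in (c - R)..(c + R), |e s| ≤ (∫ s in (c - R)..(c + R), |e₀ s|) +
      ∫ s in (c - R)..(c + R), |e s - e₀ s| := by
  have hd : LocallyIntegrable (fun t => e t - e₀ t) := he.sub he₀
  rw [← intervalIntegral.integral_add (he₀.intervalIntegrable' _ _).abs
    (hd.intervalIntegrable' _ _).abs]
  refine intervalIntegral.integral_mono (by linarith) (he.intervalIntegrable' _ _).abs
    ((he₀.intervalIntegrable' _ _).abs.add (hd.intervalIntegrable' _ _).abs) fun s => ?_
  have := abs_add_le (e₀ s) (e s - e₀ s)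
  rwa [add_sub_cancel] at this

/-- Continuous dependence on the profile and the parameter. -/
theorem exists_forall_abs_sub_lt (he₀ : LocallyIntegrable e₀) (h₀ : RealSolution e₀ m₀ u₀ v₀)
    (c : ℝ) (hR : 0 ≤ R) {ε : ℝ} (hε : 0 < ε) :
    ∃ δ > 0, ∀ (e : ℝ → ℝ) (m : ℝ) (u v : ℝ → ℝ), LocallyIntegrable e → RealSolution e m u v →
      u c = u₀ c → v c = v₀ c → ∫ s in (c - R)..(c + R), |e s - e₀ s| < δ → |m - m₀| < δ →
      ∀ x, |x - c| ≤ R → |u x - u₀ x| < ε ∧ |v x - v₀ x| < ε := by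
  obtain ⟨p, r, hpr, hp, hr, -⟩ := exists_realSolution_bound m₀ c he₀ 1 0
  obtain ⟨q, s, hqs, hq, hs, -⟩ := exists_realSolution_bound m₀ c he₀ 0 1
  obtain ⟨B₀, hB₀, hb⟩ : ∃ B₀ > 0, ∀ x, |x - c| ≤ R → |p x| ≤ B₀ ∧ |r x| ≤ B₀ ∧ |q x| ≤ B₀ ∧
      |s x| ≤ B₀ := by
    obtain ⟨B₁, h1⟩ : ∃ B, ∀ x, |x - c| ≤ R → |p x| ≤ B ∧ |r x| ≤ B :=
      ⟨_, fun x hx => abs_le_of_integral_le (c := c) (R := R) (x := x) he₀ hpr le_rfl le_rfl hx⟩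
    obtain ⟨B₂, h2⟩ : ∃ B, ∀ x, |x - c| ≤ R → |q x| ≤ B ∧ |s x| ≤ B :=
      ⟨_, fun x hx => abs_le_of_integral_le (c := c) (R := R) (x := x) he₀ hqs le_rfl le_rfl hx⟩
    have l1 : B₁ ≤ max 1 (max B₁ B₂) := (le_max_left _ _).trans (le_max_right _ _)
    have l2 : B₂ ≤ max 1 (max B₁ B₂) := (le_max_right _ _).trans (le_max_right _ _)
    exact ⟨max 1 (max B₁ B₂), by positivity, fun x hx =>
      ⟨(h1 x hx).1.trans l1, (h1 x hx).2.trans l1, (h2 x hx).1.trans l2, (h2 x hx).2.trans l2⟩⟩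
  set E := (∫ s in (c - R)..(c + R), |e₀ s|) + 1 with hE
  set M := |m₀| + 1 with hM
  set B := |u₀ c| + (1 + E) * ((|v₀ c| + M * |u₀ c| * R) * Real.exp (M * E * R)) with hB
  have hE0 : 0 ≤ E := add_nonneg
    (intervalIntegral.integral_nonneg (by linarith) fun s _ => abs_nonneg _) zero_le_one
  have hB0 : 0 ≤ B := by positivity
  -- A Lipschitz constant: `2 * B₀` comes from Cramer's rule with the fundamental pair, the rest
  -- from the Wronskian estimate.
  set L := 2 * B₀ * ((1 + 2 * R) * (B₀ * B)) with hL
  have hL0 : 0 ≤ L := by positivity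
  refine ⟨min 1 (ε / (L + 1)), by positivity, fun e m u v he h hu hv he' hm' x hx => ?_⟩
  set δ := min 1 (ε / (L + 1)) with hδ
  have hδ0 : 0 < δ := by positivity
  have hδ1 : δ ≤ 1 := min_le_left _ _
  have hδL : L * δ < ε := by
    have h1 : (L + 1) * δ ≤ ε := by
      have := min_le_right 1 (ε / (L + 1))
      rwa [← hδ, le_div_iff₀ (by positivity), mul_comm] at this
    nlinarith
  have hEe : ∫ s in (c - R)..(c + R), |e s| ≤ E := by
    have := integral_abs_le (c := c) he₀ he hR
    linarith
  have hMm : |m| ≤ M := by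
    have := abs_add_le m₀ (m - m₀)
    rw [add_sub_cancel] at this
    linarith
  have hb' := fun x hx => abs_le_of_integral_le (c := c) (R := R) (x := x) he h hEe hMm hx
  rw [hu, hv, ← hB] at hb'
  have w1 := abs_wronskian_sub_le he₀ he hpr h (fun x hx => (hb x hx).1)
    (fun x hx => (hb x hx).2.1) (fun x hx => (hb' x hx).1) (fun x hx => (hb' x hx).2) hx
  have w2 := abs_wronskian_sub_le he₀ he hqs h (fun x hx => (hb x hx).2.2.1)
    (fun x hx => (hb x hx).2.2.2) (fun x hx => (hb' x hx).1) (fun x hx => (hb' x hx).2) hx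
  have g1 := wronskian_eq he₀ hpr h₀ c x
  have g2 := wronskian_eq he₀ hqs h₀ c x
  have g3 := wronskian_eq he₀ hpr hqs c x
  have hsm : ((∫ s in (c - R)..(c + R), |e s - e₀ s|) + 2 * R * |m - m₀|) * (B₀ * B) ≤
      (1 + 2 * R) * (B₀ * B) * δ := by
    have : (∫ s in (c - R)..(c + R), |e s - e₀ s|) + 2 * R * |m - m₀| ≤ (1 + 2 * R) * δ := by
      nlinarith
    calc _ ≤ (1 + 2 * R) * δ * (B₀ * B) := by gcongr
      _ = _ := by ring
  simp only [hp, hr, hq, hs, hu, hv] at w1 w2 g1 g2 g3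
  set s1 := p x * v x - r x * u x - (1 * v₀ c - 0 * u₀ c) with hs1
  set s2 := q x * v x - s x * u x - (0 * v₀ c - 1 * u₀ c) with hs2
  -- Cramer's rule: `s1` and `s2` are the drifts of the Wronskians with the fundamental pair, whose
  -- own Wronskian is one.
  have du : u x - u₀ x = q x * s1 - p x * s2 := by
    rw [hs1, hs2]
    linear_combination (-(u x - u₀ x)) * g3 - q x * g1 + p x * g2
  have dv : v x - v₀ x = s x * s1 - r x * s2 := by
    rw [hs1, hs2]
    linear_combination (-(v x - v₀ x)) * g3 - s x * g1 + r x * g2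
  have fin : ∀ {a b : ℝ}, |a| ≤ B₀ → |b| ≤ B₀ → |a * s1 - b * s2| < ε := by
    intro a b ha hb
    refine lt_of_le_of_lt ?_ hδL
    have := abs_sub (a * s1) (b * s2)
    rw [abs_mul, abs_mul] at this
    refine this.trans ?_
    have h1 := mul_le_mul ha (w1.trans hsm) (abs_nonneg _) hB₀.le
    have h2 := mul_le_mul hb (w2.trans hsm) (abs_nonneg _) hB₀.le
    rw [hL]
    linarith
  rw [du, dv]
  exact ⟨fin (hb x hx).2.2.1 (hb x hx).1, fin (hb x hx).2.2.2 (hb x hx).2.1⟩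

/-- By Lagrange's identity the Wronskian at the right end is `-s (J + error)`, where `J = ∫ (D v₀² +
k u₀²)` is positive because `u₀` is not identically zero. The error tends to zero with `s` by
continuous dependence. -/
theorem exists_forall_wronskian_neg_of_direction (he₀ : LocallyIntegrable e₀)
    (h₀ : RealSolution e₀ m₀ u₀ v₀) (hR : 0 < R) (hu₀ : ∃ x ∈ Icc c (c + R), u₀ x ≠ 0)
    {D : ℝ → ℝ} (hD : LocallyIntegrable D) (hD0 : ∀ x, 0 ≤ D x) {k : ℝ} (hk : 0 < k) :
    ∃ η > 0, ∀ s, 0 < s → s < η → ∀ u v : ℝ → ℝ,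
      RealSolution (fun x => e₀ x + s * D x) (m₀ + s * k) u v → u c = u₀ c → v c = v₀ c →
      u₀ (c + R) * v (c + R) - v₀ (c + R) * u (c + R) < 0 := by
  obtain ⟨x₀, hx₀, hux₀⟩ := hu₀
  set d := c + R with hd
  have hcd : c < d := by linarith
  have hdc : |d - c| ≤ R := by simp [hd, abs_of_pos hR]
  have cu := h₀.continuous_field
  have cv := h₀.continuous_flux
  obtain ⟨B, hB⟩ : ∃ B, ∀ x, |x - c| ≤ R → |u₀ x| ≤ B ∧ |v₀ x| ≤ B :=
    ⟨_, fun x hx => abs_le_of_integral_le (c := c) (R := R) (x := x) he₀ h₀ le_rfl le_rfl hx⟩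
  have hB0 : 0 ≤ B := (abs_nonneg _).trans (hB d hdc).1
  have i1 : IntervalIntegrable (fun x => D x * (v₀ x * v₀ x)) volume c d :=
    (hD.mul_continuous (cv.mul cv)).intervalIntegrable' _ _
  have i2 : IntervalIntegrable (fun x => k * (u₀ x * u₀ x)) volume c d :=
    ((cu.mul cu).intervalIntegrable _ _).const_mul _
  set J := ∫ x in c..d, (D x * (v₀ x * v₀ x) + k * (u₀ x * u₀ x)) with hJ
  have hJ0 : 0 < J := by
    rw [hJ, intervalIntegral.integral_add i1 i2]
    refine add_pos_of_nonneg_of_pos (intervalIntegral.integral_nonneg hcd.le fun x _ =>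
      mul_nonneg (hD0 x) (mul_self_nonneg _)) ?_
    rw [intervalIntegral.integral_const_mul]
    exact mul_pos hk (intervalIntegral.integral_pos hcd (cu.mul cu).continuousOn
      (fun x _ => mul_self_nonneg _) ⟨x₀, hx₀, mul_self_pos.mpr hux₀⟩)
  set I := ∫ x in (c - R)..(c + R), |D x| with hI
  have hI0 : 0 ≤ I := intervalIntegral.integral_nonneg (by linarith) fun s _ => abs_nonneg _
  -- The closeness of the perturbed solution at which the total error stays below `J`.
  set κ := J / ((I + 2 * R * k) * B + 1) with hκ
  have hκ0 : 0 < κ := by positivity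
  have hκJ : (I + 2 * R * k) * (B * κ) < J := by
    have : κ * ((I + 2 * R * k) * B + 1) = J := by
      rw [hκ]
      field_simp
    nlinarith
  obtain ⟨δ, hδ, H⟩ := exists_forall_abs_sub_lt he₀ h₀ c hR.le hκ0
  refine ⟨δ / (I + k + 1), by positivity, fun s hs0 hs u v h hu hv => ?_⟩
  rw [lt_div_iff₀ (by positivity)] at hs
  have hes : LocallyIntegrable (fun x => e₀ x + s * D x) := he₀.add (hD.smul s)
  have hc := H _ _ u v hes h hu hv
    (by
      simp only [add_sub_cancel_left, abs_mul, abs_of_pos hs0]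
      rw [intervalIntegral.integral_const_mul]
      nlinarith [mul_pos hs0 hk])
    (by
      rw [add_sub_cancel_left, abs_mul, abs_of_pos hs0, abs_of_pos hk]
      nlinarith [mul_nonneg hs0.le hI0])
  have cu' := h.continuous_field
  have cv' := h.continuous_flux
  have hW := wronskian_sub he₀ hes h₀ h c d
  have j1 : IntervalIntegrable (fun x => D x * (v₀ x * (v x - v₀ x))) volume c d :=
    (hD.mul_continuous (cv.mul (cv'.sub cv))).intervalIntegrable' _ _
  have j2 : IntervalIntegrable (fun x => k * (u₀ x * (u x - u₀ x))) volume c d :=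
    ((cu.mul (cu'.sub cu)).intervalIntegrable _ _).const_mul _
  have hsplit : ∫ x in c..d, ((e₀ x + s * D x - e₀ x) * (v₀ x * v x) +
      (m₀ + s * k - m₀) * (u₀ x * u x)) = s * (J + ((∫ x in c..d, D x * (v₀ x * (v x - v₀ x))) +
        ∫ x in c..d, k * (u₀ x * (u x - u₀ x)))) := by
    rw [hJ, ← intervalIntegral.integral_add j1 j2,
      ← intervalIntegral.integral_add (i1.add i2) (j1.add j2),
      ← intervalIntegral.integral_const_mul]
    congr 1
    funext x
    ring
  have hmem : ∀ x ∈ uIoc c d, |x - c| ≤ R := fun x hx =>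
    (abs_sub_left_of_mem_uIcc (uIoc_subset_uIcc hx)).trans hdc
  have b1 : |∫ x in c..d, D x * (v₀ x * (v x - v₀ x))| ≤ I * (B * κ) := by
    refine abs_integral_mul_le (B := B * κ) c hD (fun x hx => ?_) hdc (by positivity)
    rw [abs_mul]
    exact mul_le_mul (hB x (hmem x hx)).2 (hc x (hmem x hx)).2.le (abs_nonneg _) hB0
  have b2 : |∫ x in c..d, k * (u₀ x * (u x - u₀ x))| ≤ 2 * R * k * (B * κ) := by
    refine (abs_integral_mul_le (B := B * κ) c (e := fun _ => k)
      continuous_const.locallyIntegrable (fun x hx => ?_) hdc (by positivity)).trans (le_of_eq ?_)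
    · rw [abs_mul]
      exact mul_le_mul (hB x (hmem x hx)).1 (hc x (hmem x hx)).1.le (abs_nonneg _) hB0
    · rw [intervalIntegral.integral_const, smul_eq_mul, abs_of_pos hk]
      ring
  rw [hsplit, hu, hv] at hW
  have : u₀ d * v d - v₀ d * u d = -(s * (J + ((∫ x in c..d, D x * (v₀ x * (v x - v₀ x))) +
        ∫ x in c..d, k * (u₀ x * (u x - u₀ x))))) := by
    linear_combination hW
  rw [this, neg_lt_zero]
  refine mul_pos hs0 ?_
  nlinarith [(abs_le.mp b1).1, (abs_le.mp b2).1]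

/-- Local comparison: increasing the profile and the parameter turns the state clockwise. -/
theorem exists_forall_wronskian_neg (he₀ : LocallyIntegrable e₀) (h₀ : RealSolution e₀ m₀ u₀ v₀)
    (hR : 0 < R) (hu₀ : ∃ x ∈ Icc c (c + R), u₀ x ≠ 0) :
    ∃ δ > 0, ∀ (e : ℝ → ℝ) (m : ℝ) (u v : ℝ → ℝ), LocallyIntegrable e → RealSolution e m u v →
      u c = u₀ c → v c = v₀ c → ∫ s in (c - R)..(c + R), |e s - e₀ s| < δ → |m - m₀| < δ →
      (∀ x, e₀ x ≤ e x) → m₀ < m →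
      u₀ (c + R) * v (c + R) - v₀ (c + R) * u (c + R) < 0 := by
  obtain ⟨x₀, hx₀, hux₀⟩ := hu₀
  set d := c + R with hd
  have hdc : |d - c| ≤ R := by simp [hd, abs_of_pos hR]
  have hN : 0 < u₀ d ^ 2 + v₀ d ^ 2 := by
    by_contra hcon
    have a : u₀ d = 0 := by nlinarith [sq_nonneg (u₀ d), sq_nonneg (v₀ d)]
    have b : v₀ d = 0 := by nlinarith [sq_nonneg (u₀ d), sq_nonneg (v₀ d)]
    exact hux₀ (eq_zero_of_eq_zero he₀ h₀ a b x₀).1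
  set N := u₀ d ^ 2 + v₀ d ^ 2 with hNdef
  -- The first bound keeps every intermediate solution nonzero at `x₀`; the second keeps its state
  -- at `d` within a quarter turn of the original one.
  set ε := min |u₀ x₀| (N / (|u₀ d| + |v₀ d| + 1)) with hε
  have hε0 : 0 < ε := by have := abs_pos.mpr hux₀; positivity
  obtain ⟨δ, hδ, H⟩ := exists_forall_abs_sub_lt he₀ h₀ c hR.le hε0
  refine ⟨δ, hδ, fun e m u v he h hu hv hde hdm hle hlt => ?_⟩
  -- The one-sided estimate has a range depending on the direction, so it is propagated along the
  -- segment from `e₀` to `e` to become uniform.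
  set et : ℝ → ℝ → ℝ := fun t x => e₀ x + t * (e x - e₀ x) with het
  set mt : ℝ → ℝ := fun t => m₀ + t * (m - m₀) with hmt
  have hDe : LocallyIntegrable (fun x => e x - e₀ x) := he.sub he₀
  have hetI : ∀ t, LocallyIntegrable (et t) := fun t => he₀.add (hDe.smul t)
  have hex : ∀ t, ∃ y : (ℝ → ℝ) × (ℝ → ℝ), RealSolution (et t) (mt t) y.1 y.2 ∧
      y.1 c = u₀ c ∧ y.2 c = v₀ c := by
    intro t
    obtain ⟨a, b, h1, h2, h3, -⟩ := exists_realSolution_bound (mt t) c (hetI t) (u₀ c) (v₀ c)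
    exact ⟨(a, b), h1, h2, h3⟩
  choose y hy hyu hyv using hex
  have hdiff : ∀ s t, ∫ x in (c - R)..(c + R), |et s x - et t x| =
      |s - t| * ∫ x in (c - R)..(c + R), |e x - e₀ x| := by
    intro s t
    rw [← intervalIntegral.integral_const_mul]
    congr 1
    funext x
    rw [← abs_mul]
    congr 1
    simp only [het]
    ring
  have hmdiff : ∀ s t, |mt s - mt t| = |s - t| * |m - m₀| := by
    intro s t
    rw [← abs_mul]
    congr 1
    simp only [hmt]
    ring
  have et0 : et 0 = e₀ := by funext x; simp [het]
  have mt0 : mt 0 = m₀ := by simp [hmt]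
  have et1 : et 1 = e := by funext x; simp [het]
  have mt1 : mt 1 = m := by simp [hmt]
  set I := ∫ x in (c - R)..(c + R), |e x - e₀ x| with hI
  have hI0 : 0 ≤ I := intervalIntegral.integral_nonneg (by linarith) fun s _ => abs_nonneg _
  have near : ∀ t ∈ Icc (0 : ℝ) 1, ∀ x, |x - c| ≤ R →
      |(y t).1 x - u₀ x| < ε ∧ |(y t).2 x - v₀ x| < ε := by
    intro t ht
    have h1 := hdiff t 0
    have h2 := hmdiff t 0
    rw [et0, sub_zero, abs_of_nonneg ht.1] at h1
    rw [mt0, sub_zero, abs_of_nonneg ht.1] at h2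
    refine H _ _ _ _ (hetI t) (hy t) (hyu t) (hyv t) ?_ ?_
    · rw [h1]
      nlinarith [ht.2]
    · rw [h2]
      nlinarith [ht.2, abs_nonneg (m - m₀)]
  have cont : ∀ t, ∀ ε' > 0, ∃ η > 0, ∀ s, |s - t| < η → ∀ x, |x - c| ≤ R →
      |(y s).1 x - (y t).1 x| < ε' ∧ |(y s).2 x - (y t).2 x| < ε' := by
    intro t ε' hε'
    obtain ⟨η, hη, H'⟩ := exists_forall_abs_sub_lt (hetI t) (hy t) c hR.le hε'
    refine ⟨η / (I + |m - m₀| + 1), by positivity, fun s hs => ?_⟩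
    rw [lt_div_iff₀ (by positivity)] at hs
    refine H' _ _ _ _ (hetI s) (hy s) ((hyu s).trans (hyu t).symm) ((hyv s).trans (hyv t).symm)
      ?_ ?_
    · rw [hdiff]
      nlinarith [abs_nonneg (s - t), abs_nonneg (m - m₀),
        mul_nonneg (abs_nonneg (s - t)) (abs_nonneg (m - m₀))]
    · rw [hmdiff]
      nlinarith [abs_nonneg (s - t), abs_nonneg (m - m₀), mul_nonneg (abs_nonneg (s - t)) hI0]
  have contd : (Continuous fun t => (y t).1 d) ∧ Continuous fun t => (y t).2 d := by
    constructor <;>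
    · rw [Metric.continuous_iff]
      intro t ε' hε'
      obtain ⟨η, hη, H'⟩ := cont t ε' hε'
      refine ⟨η, hη, fun s hs => ?_⟩
      rw [Real.dist_eq] at hs ⊢
      first | exact (H' s hs d hdc).1 | exact (H' s hs d hdc).2
  -- Up to the common factor `N`, `den` and `num` are the coordinates of the state at `d` along and
  -- across the original state. Their quotient is the tangent of the angle turned, and it decreases
  -- in `t`.
  set den : ℝ → ℝ := fun t => u₀ d * (y t).1 d + v₀ d * (y t).2 d with hden
  set num : ℝ → ℝ := fun t => u₀ d * (y t).2 d - v₀ d * (y t).1 d with hnum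
  have hdenpos : ∀ t ∈ Icc (0 : ℝ) 1, 0 < den t := by
    intro t ht
    obtain ⟨h1, h2⟩ := near t ht d hdc
    have h3 : ε * (|u₀ d| + |v₀ d| + 1) ≤ N := by
      rw [← le_div_iff₀ (by positivity)]
      exact min_le_right _ _
    have h4 : |u₀ d * ((y t).1 d - u₀ d) + v₀ d * ((y t).2 d - v₀ d)| < N := by
      refine lt_of_le_of_lt (abs_add_le _ _) ?_
      rw [abs_mul, abs_mul]
      nlinarith [abs_nonneg (u₀ d), abs_nonneg (v₀ d)]
    have h5 := (abs_lt.mp h4).1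
    have h6 : den t = N + (u₀ d * ((y t).1 d - u₀ d) + v₀ d * ((y t).2 d - v₀ d)) := by
      simp only [hden, hNdef]
      ring
    linarith
  have hright : ∀ t ∈ Ico (0 : ℝ) 1, ∃ s ∈ Ioc t 1,
      (y t).1 d * (y s).2 d - (y t).2 d * (y s).1 d < 0 := by
    intro t ht
    obtain ⟨η, hη, H'⟩ := exists_forall_wronskian_neg_of_direction (c := c) (hetI t) (hy t) hR
      ⟨x₀, hx₀, fun h0 => by
        have := (near t ⟨ht.1, ht.2.le⟩ x₀
          (by rw [abs_le]; constructor <;> linarith [hx₀.1, hx₀.2])).1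
        rw [h0, zero_sub, abs_neg] at this
        exact absurd this (not_lt.mpr (min_le_left _ _))⟩ hDe (fun x => sub_nonneg.mpr (hle x))
      (sub_pos.mpr hlt)
    refine ⟨min 1 (t + η / 2), ⟨lt_min ht.2 (by linarith), min_le_left _ _⟩, ?_⟩
    set s := min 1 (t + η / 2) with hs
    have hst : t < s := lt_min ht.2 (by linarith)
    have hes : et s = fun x => et t x + (s - t) * (e x - e₀ x) := by
      funext x
      simp only [het]
      ring
    have hms : mt s = mt t + (s - t) * (m - m₀) := by
      simp only [hmt]
      ring
    have hys := hy s
    rw [hes, hms] at hys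
    exact H' (s - t) (by linarith) (by linarith [min_le_right 1 (t + η / 2)]) _ _
      hys ((hyu s).trans (hyu t).symm) ((hyv s).trans (hyv t).symm)
  have cden : Continuous den := (contd.1.const_mul (u₀ d)).add (contd.2.const_mul (v₀ d))
  have cnum : Continuous num := (contd.2.const_mul (u₀ d)).sub (contd.1.const_mul (v₀ d))
  have cquot : ContinuousOn (fun t => -(num t / den t)) (Icc 0 1) :=
    (cnum.continuousOn.div cden.continuousOn fun t ht => (hdenpos t ht).ne').neg
  clear_value den num
  have hfin := lt_of_forall_exists_gt (f := fun t => -(num t / den t)) zero_lt_one cquot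
    (fun t ht => by
      obtain ⟨s, hs, hlt⟩ := hright t ht
      refine ⟨s, hs, ?_⟩
      have d1 := hdenpos t ⟨ht.1, ht.2.le⟩
      have d2 := hdenpos s ⟨ht.1.trans hs.1.le, hs.2⟩
      rw [neg_lt_neg_iff, div_lt_div_iff₀ d2 d1, ← sub_neg]
      have : num s * den t - num t * den s =
          N * ((y t).1 d * (y s).2 d - (y t).2 d * (y s).1 d) := by
        rw [hnum, hden, hNdef]
        ring
      rw [this]
      exact mul_neg_of_pos_of_neg hN hlt)
  have hy0 := hy 0
  have hy1 := hy 1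
  rw [et0, mt0] at hy0
  rw [et1, mt1] at hy1
  have y0 := eq_of_eq (c := c) he₀ hy0 h₀ (hyu 0) (hyv 0) d
  have y1 := eq_of_eq (c := c) he hy1 h ((hyu 1).trans hu.symm)
    ((hyv 1).trans hv.symm) d
  have n0 : num 0 = 0 := by
    rw [hnum]
    simp only [y0.1, y0.2]
    ring
  have n1 : num 1 = u₀ d * v d - v₀ d * u d := by
    rw [hnum]
    simp only [y1.1, y1.2]
  simp only [n0, zero_div, neg_zero] at hfin
  rw [← n1]
  have d1 := hdenpos 1 ⟨zero_le_one, le_rfl⟩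
  by_contra hcon
  have := div_nonneg (not_lt.mp hcon) d1.le
  linarith

end RealSolution

/-! ### Symmetries, complex solutions and gluing -/

theorem RealSolution.reflect {e : ℝ → ℝ} {m : ℝ} {u v : ℝ → ℝ} (h : RealSolution e m u v) {a : ℝ}
    (he : ∀ x, e (a - x) = e x) :
    RealSolution e m (fun x => u (a - x)) (fun x => -v (a - x)) where
  continuous_field := h.continuous_field.comp (by fun_prop)
  continuous_flux := (h.continuous_flux.comp (by fun_prop)).neg
  field_sub x y := by
    rw [h.field_sub, intervalIntegral.integral_symm, ← intervalIntegral.integral_comp_sub_left,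
      ← intervalIntegral.integral_neg]
    simp [he]
  flux_sub x y := by
    rw [neg_sub_neg, h.flux_sub, intervalIntegral.integral_comp_sub_left]

theorem RealSolution.translate {e : ℝ → ℝ} {m : ℝ} {u v : ℝ → ℝ} (h : RealSolution e m u v) {a : ℝ}
    (he : ∀ x, e (x + a) = e x) :
    RealSolution e m (fun x => u (x + a)) (fun x => v (x + a)) where
  continuous_field := h.continuous_field.comp (by fun_prop)
  continuous_flux := h.continuous_flux.comp (by fun_prop)
  field_sub x y := by
    rw [h.field_sub, ← intervalIntegral.integral_comp_add_right]
    simp [he]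
  flux_sub x y := by
    rw [h.flux_sub, intervalIntegral.integral_comp_add_right]

namespace IsSolution

variable {e : ℝ → ℝ} {μ₀ lam c : ℝ} {u v u₁ v₁ u₂ v₂ : ℝ → ℂ}

theorem _root_.isSolution_iff (he : LocallyIntegrable e) :
    IsSolution e μ₀ lam u v ↔
      RealSolution e (μ₀ * lam) (fun x => (u x).re) (fun x => (v x).re) ∧
      RealSolution e (μ₀ * lam) (fun x => (u x).im) (fun x => (v x).im) := by
  have hint : ∀ {f : ℝ → ℂ} (x y : ℝ), LocallyIntegrable f →
      (∫ t in x..y, f t).re = ∫ t in x..y, (f t).re ∧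
      (∫ t in x..y, f t).im = ∫ t in x..y, (f t).im := by
    intro f x y hf
    have hi : IntervalIntegrable f volume x y := intervalIntegrable_iff.mpr <|
      (hf.integrableOn_isCompact isCompact_uIcc).mono_set uIoc_subset_uIcc
    exact ⟨(intervalIntegral.intervalIntegral_re hi).symm,
      (intervalIntegral.intervalIntegral_im hi).symm⟩
  have hev : ∀ {v : ℝ → ℂ}, Continuous v → LocallyIntegrable (fun t => (e t : ℂ) * v t) := by
    intro v hv
    have : LocallyIntegrable (fun t => (e t : ℂ)) := by
      intro x
      obtain ⟨s, hs, h⟩ := he x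
      exact ⟨s, hs, h.ofReal⟩
    exact this.mul_continuous hv
  constructor
  · intro h
    have hu := h.continuous_field
    have hv := h.continuous_flux
    have h1 : ∀ x y, u y - u x = ∫ t in x..y, (e t : ℂ) * v t := by
      intro x y
      have hi : ∀ a b, IntervalIntegrable (fun t => (e t : ℂ) * v t) volume a b := fun a b =>
        intervalIntegrable_iff.mpr <|
          ((hev hv).integrableOn_isCompact isCompact_uIcc).mono_set uIoc_subset_uIcc
      rw [h.field_eq y, h.field_eq x, add_sub_add_left_eq_sub,
        intervalIntegral.integral_interval_sub_left (hi _ _) (hi _ _)]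
    have h2 : ∀ x y, v y - v x = -((μ₀ * lam : ℝ) : ℂ) * ∫ t in x..y, u t := by
      intro x y
      rw [h.flux_eq y, h.flux_eq x, ← intervalIntegral.integral_interval_sub_left (a := 0) (b := y)
        (c := x) (hu.intervalIntegrable _ _) (hu.intervalIntegrable _ _)]
      ring
    refine ⟨⟨by fun_prop, by fun_prop, fun x y => ?_, fun x y => ?_⟩,
      ⟨by fun_prop, by fun_prop, fun x y => ?_, fun x y => ?_⟩⟩
    · rw [← Complex.sub_re, h1, (hint x y (hev hv)).1]
      simp
    · rw [← Complex.sub_re, h2, ← (hint x y hu.locallyIntegrable).1, ← Complex.ofReal_neg,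
        Complex.re_ofReal_mul]
    · rw [← Complex.sub_im, h1, (hint x y (hev hv)).2]
      simp
    · rw [← Complex.sub_im, h2, ← (hint x y hu.locallyIntegrable).2, ← Complex.ofReal_neg,
        Complex.im_ofReal_mul]
  · rintro ⟨h, k⟩
    have hu : Continuous u := by
      have := (Complex.continuous_ofReal.comp h.continuous_field).add
        ((Complex.continuous_ofReal.comp k.continuous_field).mul (continuous_const (y := Complex.I)))
      refine this.congr fun x => ?_
      simp [Complex.re_add_im]
    have hv : Continuous v := by
      have := (Complex.continuous_ofReal.comp h.continuous_flux).add
        ((Complex.continuous_ofReal.comp k.continuous_flux).mul (continuous_const (y := Complex.I)))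
      refine this.congr fun x => ?_
      simp [Complex.re_add_im]
    refine ⟨hu, hv, fun x => ?_, fun x => ?_⟩
    · have a := h.field_sub 0 x
      have b := k.field_sub 0 x
      apply Complex.ext
      · rw [Complex.add_re, (hint 0 x (hev hv)).1]
        simp only [Complex.re_ofReal_mul]
        linarith
      · rw [Complex.add_im, (hint 0 x (hev hv)).2]
        simp only [Complex.im_ofReal_mul]
        linarith
    · have a := h.flux_sub 0 x
      have b := k.flux_sub 0 x
      apply Complex.ext
      · rw [Complex.sub_re, Complex.re_ofReal_mul, (hint 0 x hu.locallyIntegrable).1]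
        linarith
      · rw [Complex.sub_im, Complex.im_ofReal_mul, (hint 0 x hu.locallyIntegrable).2]
        linarith

/-- Uniqueness for the initial value problem. -/
theorem eq_of_eq (he : LocallyIntegrable e) (h₁ : IsSolution e μ₀ lam u₁ v₁)
    (h₂ : IsSolution e μ₀ lam u₂ v₂) (hu : u₁ c = u₂ c) (hv : v₁ c = v₂ c) (x : ℝ) :
    u₁ x = u₂ x ∧ v₁ x = v₂ x := by
  obtain ⟨a₁, b₁⟩ := (isSolution_iff he).mp h₁
  obtain ⟨a₂, b₂⟩ := (isSolution_iff he).mp h₂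
  have a := RealSolution.eq_of_eq (c := c) he a₁ a₂ (by simp [hu]) (by simp [hv]) x
  have b := RealSolution.eq_of_eq (c := c) he b₁ b₂ (by simp [hu]) (by simp [hv]) x
  exact ⟨Complex.ext a.1 b.1, Complex.ext a.2 b.2⟩

theorem _root_.RealSolution.isSolution_combination (he : LocallyIntegrable e)
    {p r q s : ℝ → ℝ} (h₁ : RealSolution e (μ₀ * lam) p r) (h₂ : RealSolution e (μ₀ * lam) q s)
    (a b : ℂ) :
    IsSolution e μ₀ lam (fun x => a * p x + b * q x) (fun x => a * r x + b * s x) := by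
  rw [isSolution_iff he]
  simp only [Complex.add_re, Complex.re_mul_ofReal, Complex.add_im, Complex.im_mul_ofReal]
  exact ⟨RealSolution.linearCombination he h₁ h₂ _ _, RealSolution.linearCombination he h₁ h₂ _ _⟩

theorem reflect (he : LocallyIntegrable e) (h : IsSolution e μ₀ lam u v) {a : ℝ}
    (ha : ∀ x, e (a - x) = e x) :
    IsSolution e μ₀ lam (fun x => u (a - x)) (fun x => -v (a - x)) := by
  rw [isSolution_iff he] at h ⊢
  exact ⟨h.1.reflect ha, h.2.reflect ha⟩

theorem translate (he : LocallyIntegrable e) (h : IsSolution e μ₀ lam u v) {a : ℝ}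
    (ha : ∀ x, e (x + a) = e x) :
    IsSolution e μ₀ lam (fun x => u (x + a)) (fun x => v (x + a)) := by
  rw [isSolution_iff he] at h ⊢
  exact ⟨h.1.translate ha, h.2.translate ha⟩

theorem const_mul (he : LocallyIntegrable e) (h : IsSolution e μ₀ lam u v) (a : ℂ) :
    IsSolution e μ₀ lam (fun x => a * u x) (fun x => a * v x) := by
  obtain ⟨h₁, h₂⟩ := (isSolution_iff he).mp h
  have := RealSolution.isSolution_combination he h₁ h₂ a (a * Complex.I)
  convert this using 2 with x x
  · rw [mul_assoc, ← mul_add, mul_comm Complex.I, Complex.re_add_im]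
  · rw [mul_assoc, ← mul_add, mul_comm Complex.I, Complex.re_add_im]

theorem _root_.exists_isSolution (he : LocallyIntegrable e) (μ₀ lam c : ℝ) (U V : ℂ) :
    ∃ u v : ℝ → ℂ, IsSolution e μ₀ lam u v ∧ u c = U ∧ v c = V := by
  obtain ⟨p, r, hpr, hp, hr, -⟩ := exists_realSolution_bound (μ₀ * lam) c he 1 0
  obtain ⟨q, s, hqs, hq, hs, -⟩ := exists_realSolution_bound (μ₀ * lam) c he 0 1
  exact ⟨_, _, RealSolution.isSolution_combination he hpr hqs U V, by simp [hp, hq],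
    by simp [hr, hs]⟩

/-- Two solutions with the same state at `0` can be glued there. -/
theorem glue {e₁ e₂ : ℝ → ℝ} (h₁ : IsSolution e₁ μ₀ lam u₁ v₁) (h₂ : IsSolution e₂ μ₀ lam u₂ v₂)
    (hu : u₁ 0 = u₂ 0) (hv : v₁ 0 = v₂ 0) :
    IsSolution (fun x => if x < 0 then e₁ x else e₂ x) μ₀ lam
      (fun x => if x < 0 then u₁ x else u₂ x) (fun x => if x < 0 then v₁ x else v₂ x) := by
  have cont : ∀ {f g : ℝ → ℂ}, Continuous f → Continuous g → f 0 = g 0 →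
      Continuous fun x : ℝ => if x < 0 then f x else g x := by
    intro f g hf hg h0
    refine Continuous.if (fun a ha => ?_) hf hg
    have : a = 0 := by
      have := frontier_lt_subset_eq (continuous_id (X := ℝ)) (continuous_const (y := (0 : ℝ))) ha
      simpa using this
    rw [this, h0]
  have int : ∀ {f g : ℝ → ℂ} (x : ℝ), ∫ t in (0 : ℝ)..x, (if t < 0 then f t else g t) =
      if x < 0 then ∫ t in (0 : ℝ)..x, f t else ∫ t in (0 : ℝ)..x, g t := by
    intro f g x
    split_ifs with hx
    · apply intervalIntegral.integral_congr_ae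
      filter_upwards [compl_mem_ae_iff.mpr (measure_singleton (0 : ℝ))] with t ht hmem
      rw [uIoc_of_ge hx.le] at hmem
      have : t < 0 := lt_of_le_of_ne hmem.2 ht
      rw [if_pos this]
    · apply intervalIntegral.integral_congr
      intro t ht
      rw [uIcc_of_le (not_lt.mp hx)] at ht
      simp only
      rw [if_neg (not_lt.mpr ht.1)]
  refine ⟨cont h₁.continuous_field h₂.continuous_field hu,
    cont h₁.continuous_flux h₂.continuous_flux hv, fun x => ?_, fun x => ?_⟩
  · have : (fun t : ℝ => (((if t < 0 then e₁ t else e₂ t : ℝ)) : ℂ) * (if t < 0 then v₁ t else v₂ t)) =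
        fun t => if t < 0 then (e₁ t : ℂ) * v₁ t else (e₂ t : ℂ) * v₂ t := by
      funext t
      split_ifs <;> rfl
    rw [this, int, if_neg (lt_irrefl _)]
    split_ifs
    · rw [h₁.field_eq x, hu]
    · exact h₂.field_eq x
  · rw [int, if_neg (lt_irrefl _)]
    split_ifs
    · rw [h₁.flux_eq x, hv]
    · exact h₂.flux_eq x

end IsSolution

/-! ### The half-cell transfer matrix and the Bloch spectrum -/

/-- A locally integrable profile which is `1`-periodic and symmetric under `x ↦ 1 - x`. -/
structure IsMirrorProfile (e : ℝ → ℝ) : Prop where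
  locallyIntegrable : LocallyIntegrable e
  periodic : ∀ x, e (x + 1) = e x
  mirror : ∀ x, e (1 - x) = e x

/-- The profile is not almost everywhere zero, expressed through its primitive. -/
def NontrivialProfile (e : ℝ → ℝ) : Prop := ∃ x : ℝ, ∫ t in (0 : ℝ)..x, e t ≠ 0

open Classical in
/-- The solution of `u' = e v`, `v' = -m u` with state `(U, V)` at `1 / 2`. -/
noncomputable def cellSolution (e : ℝ → ℝ) (m U V : ℝ) : (ℝ → ℝ) × (ℝ → ℝ) :=
  if h : LocallyIntegrable e then
    ((exists_realSolution_bound m (1 / 2) h U V).choose,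
      (exists_realSolution_bound m (1 / 2) h U V).choose_spec.choose)
  else 0

theorem cellSolution_spec {e : ℝ → ℝ} (he : LocallyIntegrable e) (m U V : ℝ) :
    RealSolution e m (cellSolution e m U V).1 (cellSolution e m U V).2 ∧
      (cellSolution e m U V).1 (1 / 2) = U ∧ (cellSolution e m U V).2 (1 / 2) = V := by
  have h := (exists_realSolution_bound m (1 / 2) he U V).choose_spec.choose_spec
  rw [cellSolution, dif_pos he]
  exact ⟨h.1, h.2.1, h.2.2.1⟩

/-- Entries of the transfer matrix from `1 / 2` to `1`. -/
noncomputable def cellP (e : ℝ → ℝ) (m : ℝ) : ℝ := (cellSolution e m 1 0).1 1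
noncomputable def cellQ (e : ℝ → ℝ) (m : ℝ) : ℝ := (cellSolution e m 0 1).1 1
noncomputable def cellR (e : ℝ → ℝ) (m : ℝ) : ℝ := (cellSolution e m 1 0).2 1
noncomputable def cellS (e : ℝ → ℝ) (m : ℝ) : ℝ := (cellSolution e m 0 1).2 1

/-- Half of the trace of the monodromy matrix. -/
noncomputable def cellA (e : ℝ → ℝ) (m : ℝ) : ℝ := cellP e m * cellS e m + cellQ e m * cellR e m

theorem cell_det {e : ℝ → ℝ} (he : LocallyIntegrable e) (m : ℝ) :
    cellP e m * cellS e m - cellQ e m * cellR e m = 1 := by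
  obtain ⟨h₁, a₁, b₁⟩ := cellSolution_spec he m 1 0
  obtain ⟨h₂, a₂, b₂⟩ := cellSolution_spec he m 0 1
  have := RealSolution.wronskian_eq he h₁ h₂ (1 / 2) 1
  rw [a₁, b₁, a₂, b₂] at this
  rw [cellP, cellQ, cellR, cellS]
  linarith

/-- By the determinant identity `A + 1 = 2PS` and `A - 1 = 2QR`. -/
theorem cellA_sq_sub_one {e : ℝ → ℝ} (he : LocallyIntegrable e) (m : ℝ) :
    cellA e m ^ 2 - 1 = 4 * (cellP e m * cellQ e m * cellR e m * cellS e m) := by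
  have := cell_det he m
  rw [cellA]
  linear_combination (cellP e m * cellS e m - cellQ e m * cellR e m + 1) * this

namespace IsMirrorProfile

variable {e : ℝ → ℝ} {μ₀ lam m : ℝ} {u v : ℝ → ℂ}

theorem even (he : IsMirrorProfile e) (x : ℝ) : e (0 - x) = e x := by
  rw [← he.periodic, ← he.mirror x]
  congr 1
  ring

theorem cellSolution_one_zero (he : IsMirrorProfile e) (m x : ℝ) :
    (cellSolution e m 1 0).1 (1 - x) = (cellSolution e m 1 0).1 x ∧
      (cellSolution e m 1 0).2 (1 - x) = -(cellSolution e m 1 0).2 x := by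
  obtain ⟨h, a, b⟩ := cellSolution_spec he.locallyIntegrable m 1 0
  have := RealSolution.eq_of_eq (c := 1 / 2) he.locallyIntegrable (h.reflect he.mirror) h
    (by norm_num) (by norm_num at b ⊢; rw [b]; simp) x
  exact ⟨this.1, by rw [← this.2, neg_neg]⟩

theorem cellSolution_zero_one (he : IsMirrorProfile e) (m x : ℝ) :
    (cellSolution e m 0 1).1 (1 - x) = -(cellSolution e m 0 1).1 x ∧
      (cellSolution e m 0 1).2 (1 - x) = (cellSolution e m 0 1).2 x := by
  obtain ⟨h, a, b⟩ := cellSolution_spec he.locallyIntegrable m 0 1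
  have h' := RealSolution.linearCombination he.locallyIntegrable
    (h.reflect he.mirror) (h.reflect he.mirror) (-1) 0
  have := RealSolution.eq_of_eq (c := 1 / 2) he.locallyIntegrable h' h
    (by norm_num at a ⊢; rw [a]; simp) (by norm_num) x
  simp only [zero_mul, add_zero] at this
  exact ⟨by linarith [this.1], by linarith [this.2]⟩

/-- A solution in terms of its state at `1 / 2`. -/
theorem eq_cellSolution (he : IsMirrorProfile e) (h : IsSolution e μ₀ lam u v) (x : ℝ) :
    u x = u (1 / 2) * (cellSolution e (μ₀ * lam) 1 0).1 x +
        v (1 / 2) * (cellSolution e (μ₀ * lam) 0 1).1 x ∧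
      v x = u (1 / 2) * (cellSolution e (μ₀ * lam) 1 0).2 x +
        v (1 / 2) * (cellSolution e (μ₀ * lam) 0 1).2 x := by
  obtain ⟨h₁, a₁, b₁⟩ := cellSolution_spec he.locallyIntegrable (μ₀ * lam) 1 0
  obtain ⟨h₂, a₂, b₂⟩ := cellSolution_spec he.locallyIntegrable (μ₀ * lam) 0 1
  exact IsSolution.eq_of_eq (c := 1 / 2) he.locallyIntegrable h
    (RealSolution.isSolution_combination he.locallyIntegrable h₁ h₂ (u (1 / 2)) (v (1 / 2)))
    (by simp only [a₁, a₂]; simp) (by simp only [b₁, b₂]; simp) x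

theorem state_one (he : IsMirrorProfile e) (h : IsSolution e μ₀ lam u v) :
    u 1 = u (1 / 2) * cellP e (μ₀ * lam) + v (1 / 2) * cellQ e (μ₀ * lam) ∧
      v 1 = u (1 / 2) * cellR e (μ₀ * lam) + v (1 / 2) * cellS e (μ₀ * lam) :=
  he.eq_cellSolution h 1

theorem state_zero (he : IsMirrorProfile e) (h : IsSolution e μ₀ lam u v) :
    u 0 = u (1 / 2) * cellP e (μ₀ * lam) - v (1 / 2) * cellQ e (μ₀ * lam) ∧
      v 0 = -(u (1 / 2) * cellR e (μ₀ * lam)) + v (1 / 2) * cellS e (μ₀ * lam) := by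
  have h0 := he.eq_cellSolution h 0
  have a := he.cellSolution_one_zero (μ₀ * lam) 1
  have b := he.cellSolution_zero_one (μ₀ * lam) 1
  rw [sub_self] at a b
  rw [a.1, a.2, b.1, b.2] at h0
  rw [h0.1, h0.2, cellP, cellQ, cellR, cellS]
  push_cast
  constructor <;> ring

/-- The monodromy matrix. -/
theorem state_add_one (he : IsMirrorProfile e) (h : IsSolution e μ₀ lam u v) (n : ℕ) :
    u (n + 1) = cellA e (μ₀ * lam) * u n +
        2 * (cellP e (μ₀ * lam) * cellQ e (μ₀ * lam)) * v n ∧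
      v (n + 1) = 2 * (cellR e (μ₀ * lam) * cellS e (μ₀ * lam)) * u n +
        cellA e (μ₀ * lam) * v n := by
  have hn : ∀ (n : ℕ) x, e (x + n) = e x := by
    intro n x
    induction n with
    | zero => simp
    | succ n ih => rw [Nat.cast_succ, ← add_assoc, he.periodic, ih]
  have ht := h.translate he.locallyIntegrable (hn n)
  have h1 := he.state_one ht
  have h0 := he.state_zero ht
  have hd : (cellP e (μ₀ * lam) * cellS e (μ₀ * lam) -
    cellQ e (μ₀ * lam) * cellR e (μ₀ * lam) : ℂ) = 1 := by
    exact_mod_cast cell_det he.locallyIntegrable (μ₀ * lam)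
  rw [zero_add] at h0
  rw [add_comm 1 (n : ℝ)] at h1
  rw [h1.1, h1.2, h0.1, h0.2, cellA]
  set U := u (1 / 2 + n)
  set V := v (1 / 2 + n)
  push_cast
  constructor
  · linear_combination (-U * cellP e (μ₀ * lam) - V * cellQ e (μ₀ * lam)) * hd
  · linear_combination (-U * cellR e (μ₀ * lam) - V * cellS e (μ₀ * lam)) * hd

theorem quasiperiodic (he : IsMirrorProfile e) (h : IsSolution e μ₀ lam u v) {ρ : ℂ}
    (hu : u 1 = ρ * u 0) (hv : v 1 = ρ * v 0) (x : ℝ) :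
    u (x + 1) = ρ * u x ∧ v (x + 1) = ρ * v x :=
  IsSolution.eq_of_eq (c := 0) he.locallyIntegrable (h.translate he.locallyIntegrable he.periodic)
    (h.const_mul he.locallyIntegrable ρ) (by simpa using hu) (by simpa using hv) x

theorem eq_zero_of_state (he : IsMirrorProfile e) (h : IsSolution e μ₀ lam u v)
    (hu : u (1 / 2) = 0) (hv : v (1 / 2) = 0) : u = 0 := by
  funext x
  rw [(he.eq_cellSolution h x).1, hu, hv]
  simp

end IsMirrorProfile

namespace NontrivialProfile

variable {e : ℝ → ℝ} {μ₀ lam m : ℝ} {u v : ℝ → ℂ}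

/-- If the field vanishes the flux is constant, and then `v ∫ e = 0` over an interval with nonzero
integral. -/
theorem flux_eq_zero (he : NontrivialProfile e) (h : IsSolution e μ₀ lam u v)
    (hu : u = 0) (x : ℝ) : v x = 0 := by
  obtain ⟨y, hy⟩ := he
  have hc : ∀ x, v x = v 0 := by
    intro x
    rw [h.flux_eq x, hu]
    simp
  have h1 := h.field_eq y
  simp only [hc, hu, Pi.zero_apply, zero_add] at h1
  rw [intervalIntegral.integral_mul_const, intervalIntegral.integral_ofReal] at h1
  rw [hc x]
  exact ((mul_eq_zero.mp h1.symm).resolve_left (by exact_mod_cast hy))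

theorem ne_zero_of_state (hn : NontrivialProfile e)
    (h : IsSolution e μ₀ lam u v) {x : ℝ} (hx : u x ≠ 0 ∨ v x ≠ 0) : u ≠ 0 := by
  rintro h0
  rcases hx with hx | hx
  · exact hx (by rw [h0]; rfl)
  · exact hx (hn.flux_eq_zero h h0 x)

/-- Vanishing on half a cell would spread to the whole line by oddness about `1/2` and periodicity.
The odd solution starts with zero field, so strict comparison for it needs this fact. -/
theorem exists_cellSolution_ne_zero (hn : NontrivialProfile e) (he : IsMirrorProfile e) (m : ℝ) :
    ∃ x ∈ Icc (1 / 2 : ℝ) 1, (cellSolution e m 0 1).1 x ≠ 0 := by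
  by_contra! hcon
  obtain ⟨h, a, b⟩ := cellSolution_spec he.locallyIntegrable m 0 1
  have hunit : ∀ x ∈ Icc (0 : ℝ) 1, (cellSolution e m 0 1).1 x = 0 := by
    intro x hx
    rcases le_total (1 / 2) x with hx' | hx'
    · exact hcon x ⟨hx', hx.2⟩
    · have := (he.cellSolution_zero_one m x).1
      rw [hcon (1 - x) ⟨by linarith, by linarith [hx.1]⟩] at this
      linarith
  have h10 : (cellSolution e m 0 1).2 1 = (cellSolution e m 0 1).2 0 := by
    have := (he.cellSolution_zero_one m 0).2
    rwa [sub_zero] at this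
  have hper : ∀ x, (cellSolution e m 0 1).1 (x + 1) = (cellSolution e m 0 1).1 x := fun x =>
    (RealSolution.eq_of_eq (c := 0) he.locallyIntegrable (h.translate he.periodic) h
      (by simp [hunit 0 (by simp), hunit 1 (by simp)]) (by simpa using h10) x).1
  have hall : ∀ x, (cellSolution e m 0 1).1 x = 0 := by
    intro x
    have hp : Function.Periodic (cellSolution e m 0 1).1 1 := hper
    obtain ⟨y, hy, hxy⟩ := hp.exists_mem_Ico₀ one_pos x
    rw [hxy]
    exact hunit y ⟨hy.1, hy.2.le⟩
  have hs := RealSolution.isSolution_combination (μ₀ := 1) (lam := m) he.locallyIntegrable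
    (by rwa [one_mul]) (by rwa [one_mul]) 1 0 (q := (cellSolution e m 0 1).1)
    (p := (cellSolution e m 0 1).1) (r := (cellSolution e m 0 1).2) (s := (cellSolution e m 0 1).2)
  have := hn.flux_eq_zero hs (by funext x; simp [hall]) (1 / 2)
  rw [b] at this
  simp at this

end NontrivialProfile

theorem ae_eq_zero_of_not_nontrivialProfile {e : ℝ → ℝ} (he : LocallyIntegrable e)
    (hn : ¬ NontrivialProfile e) : ∀ᵐ x, e x = 0 := by
  simp only [NontrivialProfile, not_exists, not_not] at hn
  filter_upwards [LocallyIntegrable.ae_hasDerivAt_integral he] with x hx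
  have := hx 0
  simp only [hn] at this
  exact this.unique (hasDerivAt_const x 0)

namespace IsMirrorProfile

variable {e : ℝ → ℝ} {μ₀ lam m κ : ℝ} {u v : ℝ → ℂ}

/-- For a profile zero almost everywhere the field is a nonzero constant, so the multiplier is `1`;
but the flux then changes by `-μ₀ lam u` over a period and cannot be periodic. -/
theorem nontrivialProfile_of_isBlochMode (he : IsMirrorProfile e) (hm : μ₀ * lam ≠ 0)
    (h : IsBlochMode e μ₀ κ lam u v) : NontrivialProfile e := by
  by_contra hn
  have h0 := ae_eq_zero_of_not_nontrivialProfile he.locallyIntegrable hn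
  have hs := h.isSolution
  have hu : ∀ x, u x = u 0 := by
    intro x
    rw [hs.field_eq x, intervalIntegral.integral_congr_ae (g := fun _ => 0)]
    · simp
    · filter_upwards [h0] with t ht _
      simp [ht]
  have hu0 : u 0 ≠ 0 := by
    intro h1
    refine h.ne_zero (funext fun x => ?_)
    rw [hu x, h1]
    rfl
  have h1 := h.field_quasiperiodic 0
  have h2 := h.flux_quasiperiodic 0
  rw [hu (0 + 1)] at h1
  have h3 : Complex.exp (Complex.I * κ) = 1 := by
    apply mul_right_cancel₀ hu0
    rw [← h1, one_mul]
  rw [h3, zero_add, one_mul, hs.flux_eq 1] at h2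
  simp only [hu, intervalIntegral.integral_const, sub_zero, one_smul] at h2
  have h4 : ((μ₀ * lam : ℝ) : ℂ) * u 0 = 0 := by linear_combination -h2
  rcases mul_eq_zero.mp h4 with h5 | h5
  · exact hm (by exact_mod_cast h5)
  · exact hu0 h5

/-- By uniqueness, quasiperiodicity need only be tested on the states at `0` and `1`. In terms of
the state at `1/2` these differ only by signs, which splits off the factors `1 ± ρ`. -/
theorem isBlochMode_iff (he : IsMirrorProfile e) (h : IsSolution e μ₀ lam u v) (hu : u ≠ 0) :
    IsBlochMode e μ₀ κ lam u v ↔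
      (1 - Complex.exp (Complex.I * κ)) * (cellP e (μ₀ * lam) * u (1 / 2)) +
        (1 + Complex.exp (Complex.I * κ)) * (cellQ e (μ₀ * lam) * v (1 / 2)) = 0 ∧
      (1 + Complex.exp (Complex.I * κ)) * (cellR e (μ₀ * lam) * u (1 / 2)) +
        (1 - Complex.exp (Complex.I * κ)) * (cellS e (μ₀ * lam) * v (1 / 2)) = 0 := by
  set ρ := Complex.exp (Complex.I * κ) with hρ
  obtain ⟨a1, b1⟩ := he.state_one h
  obtain ⟨a0, b0⟩ := he.state_zero h
  constructor
  · intro hb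
    have h1 := hb.field_quasiperiodic 0
    have h2 := hb.flux_quasiperiodic 0
    rw [zero_add, a1, a0, ← hρ] at h1
    rw [zero_add, b1, b0, ← hρ] at h2
    constructor
    · linear_combination h1
    · linear_combination h2
  · rintro ⟨h1, h2⟩
    have hq := he.quasiperiodic h (ρ := ρ) (by rw [a1, a0]; linear_combination h1)
      (by rw [b1, b0]; linear_combination h2)
    exact ⟨h, hu, fun x => (hq x).1, fun x => (hq x).2⟩

theorem _root_.exp_sq_add_one (κ : ℝ) : Complex.exp (Complex.I * κ) ^ 2 + 1 =
    2 * (Real.cos κ : ℂ) * Complex.exp (Complex.I * κ) := by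
  rw [Complex.ofReal_cos, Complex.two_cos, mul_comm Complex.I, add_mul, ← Complex.exp_add,
    ← Complex.exp_add, sq, ← Complex.exp_add]
  simp

/-- The determinant of the linear system for the state at `1/2` is `2ρ (cos κ - A)`. -/
theorem isBlochEigenvalue_iff (he : IsMirrorProfile e) (hn : NontrivialProfile e) :
    IsBlochEigenvalue e μ₀ κ lam ↔ cellA e (μ₀ * lam) = Real.cos κ := by
  have hexp := exp_sq_add_one κ
  have hρ0 := Complex.exp_ne_zero (Complex.I * κ)
  have hdet : (cellP e (μ₀ * lam) * cellS e (μ₀ * lam) -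
      cellQ e (μ₀ * lam) * cellR e (μ₀ * lam) : ℂ) = 1 := by
    exact_mod_cast cell_det he.locallyIntegrable (μ₀ * lam)
  have hA : (cellA e (μ₀ * lam) : ℂ) = cellP e (μ₀ * lam) * cellS e (μ₀ * lam) +
      cellQ e (μ₀ * lam) * cellR e (μ₀ * lam) := by
    rw [cellA]
    push_cast
    ring
  set ρ := Complex.exp (Complex.I * κ) with hρ
  set P : ℂ := ((cellP e (μ₀ * lam) : ℝ) : ℂ)
  set Q : ℂ := ((cellQ e (μ₀ * lam) : ℝ) : ℂ)
  set R : ℂ := ((cellR e (μ₀ * lam) : ℝ) : ℂ)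
  set S : ℂ := ((cellS e (μ₀ * lam) : ℝ) : ℂ)
  have hiff : cellA e (μ₀ * lam) = Real.cos κ ↔
      (1 - ρ) * P * ((1 - ρ) * S) - (1 + ρ) * Q * ((1 + ρ) * R) = 0 := by
    have h1 : (1 - ρ) * P * ((1 - ρ) * S) - (1 + ρ) * Q * ((1 + ρ) * R) =
        2 * ρ * ((Real.cos κ : ℂ) - cellA e (μ₀ * lam)) := by
      rw [hA]
      linear_combination (1 + ρ ^ 2) * hdet + hexp
    rw [h1, mul_eq_zero, or_iff_right (mul_ne_zero two_ne_zero hρ0), sub_eq_zero, eq_comm]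
    exact_mod_cast Iff.rfl
  rw [hiff]
  constructor
  · rintro ⟨u, v, h⟩
    obtain ⟨h1, h2⟩ := (he.isBlochMode_iff h.isSolution h.ne_zero).mp h
    rw [← hρ] at h1 h2
    by_cases hU : u (1 / 2) = 0
    · have hV : v (1 / 2) ≠ 0 := fun hV => h.ne_zero (he.eq_zero_of_state h.isSolution hU hV)
      apply mul_right_cancel₀ hV
      linear_combination (1 - ρ) * P * h2 - (1 + ρ) * R * h1
    · apply mul_right_cancel₀ hU
      linear_combination (1 - ρ) * S * h1 - (1 + ρ) * Q * h2
  · intro hd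
    obtain ⟨U, V, hne, h1, h2⟩ : ∃ U V : ℂ, (U ≠ 0 ∨ V ≠ 0) ∧
        (1 - ρ) * (P * U) + (1 + ρ) * (Q * V) = 0 ∧
        (1 + ρ) * (R * U) + (1 - ρ) * (S * V) = 0 := by
      -- A kernel vector of a singular matrix: perpendicular to a nonzero row, or arbitrary if both
      -- rows vanish.
      by_cases c1 : (1 - ρ) * P = 0 ∧ (1 + ρ) * Q = 0
      · by_cases c2 : (1 + ρ) * R = 0 ∧ (1 - ρ) * S = 0
        · exact ⟨1, 0, Or.inl one_ne_zero, by linear_combination c1.1, by linear_combination c2.1⟩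
        · refine ⟨-((1 - ρ) * S), (1 + ρ) * R, ?_, ?_, by ring⟩
          · rw [neg_ne_zero]
            tauto
          · linear_combination -hd
      · refine ⟨-((1 + ρ) * Q), (1 - ρ) * P, ?_, by ring, ?_⟩
        · rw [neg_ne_zero]
          tauto
        · linear_combination hd
    obtain ⟨u, v, h, hu, hv⟩ := exists_isSolution he.locallyIntegrable μ₀ lam (1 / 2) U V
    refine ⟨u, v, (he.isBlochMode_iff h (hn.ne_zero_of_state h (x := 1 / 2) ?_)).mpr ?_⟩
    · rwa [hu, hv]
    · rw [hu, hv]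
      exact ⟨h1, h2⟩

/-- Symmetry removes the odd part, so the mode equations reduce to `(1 - ρ)P = 0` and `(1 + ρ)R =
0`. Conversely `P = 0` gives an antiperiodic mode and `R = 0` a periodic one. -/
theorem exists_symmetric_mode_iff (he : IsMirrorProfile e) (hn : NontrivialProfile e) :
    (∃ κ ∈ Icc (-Real.pi) Real.pi, ∃ u v : ℝ → ℂ,
      IsBlochMode e μ₀ κ lam u v ∧ ∀ x : ℝ, u (1 - x) = u x) ↔
      cellP e (μ₀ * lam) * cellR e (μ₀ * lam) = 0 := by
  constructor
  · rintro ⟨κ, -, u, v, h, hsym⟩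
    obtain ⟨h1, h2⟩ := (he.isBlochMode_iff h.isSolution h.ne_zero).mp h
    obtain ⟨x, -, hx⟩ := hn.exists_cellSolution_ne_zero he (μ₀ * lam)
    have hV : v (1 / 2) = 0 := by
      have h3 := hsym x
      rw [(he.eq_cellSolution h.isSolution x).1, (he.eq_cellSolution h.isSolution (1 - x)).1,
        (he.cellSolution_one_zero _ x).1, (he.cellSolution_zero_one _ x).1] at h3
      push_cast at h3
      have h4 : v (1 / 2) * ((cellSolution e (μ₀ * lam) 0 1).1 x : ℂ) = 0 := by
        linear_combination (-1 / 2) * h3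
      exact (mul_eq_zero.mp h4).resolve_right (by exact_mod_cast hx)
    have hU : u (1 / 2) ≠ 0 := fun hU => h.ne_zero (he.eq_zero_of_state h.isSolution hU hV)
    rw [hV] at h1 h2
    set ρ := Complex.exp (Complex.I * κ)
    have h5 : 2 * ((cellP e (μ₀ * lam) : ℂ) * cellR e (μ₀ * lam)) = 0 := by
      apply mul_right_cancel₀ hU
      linear_combination (cellR e (μ₀ * lam) : ℂ) * h1 + (cellP e (μ₀ * lam) : ℂ) * h2
    have h6 := (mul_eq_zero.mp h5).resolve_left two_ne_zero
    exact_mod_cast h6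
  · intro hPR
    obtain ⟨u, v, h, hu, hv⟩ := exists_isSolution he.locallyIntegrable μ₀ lam (1 / 2) 1 0
    have hne := hn.ne_zero_of_state h (x := 1 / 2) (Or.inl (by rw [hu]; exact one_ne_zero))
    have hsym : ∀ x, u (1 - x) = u x := by
      intro x
      rw [(he.eq_cellSolution h x).1, (he.eq_cellSolution h (1 - x)).1,
        (he.cellSolution_one_zero _ x).1, hv]
      simp
    rcases mul_eq_zero.mp hPR with h0 | h0
    · refine ⟨Real.pi, ⟨by linarith [Real.pi_pos], le_rfl⟩, u, v,
        (he.isBlochMode_iff h hne).mpr ?_, hsym⟩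
      rw [mul_comm Complex.I, Complex.exp_pi_mul_I, h0, hv]
      simp
    · refine ⟨0, ⟨by linarith [Real.pi_pos], Real.pi_pos.le⟩, u, v,
        (he.isBlochMode_iff h hne).mpr ?_, hsym⟩
      rw [h0, hv]
      simp

theorem exists_antisymmetric_mode (he : IsMirrorProfile e) (hn : NontrivialProfile e)
    (hQS : cellQ e (μ₀ * lam) * cellS e (μ₀ * lam) = 0) :
    ∃ κ ∈ Icc (-Real.pi) Real.pi, ∃ u v : ℝ → ℂ,
      IsBlochMode e μ₀ κ lam u v ∧ ∀ x : ℝ, u (1 - x) = -u x := by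
  obtain ⟨u, v, h, hu, hv⟩ := exists_isSolution he.locallyIntegrable μ₀ lam (1 / 2) 0 1
  have hne := hn.ne_zero_of_state h (x := 1 / 2) (Or.inr (by rw [hv]; exact one_ne_zero))
  have hsym : ∀ x, u (1 - x) = -u x := by
    intro x
    rw [(he.eq_cellSolution h x).1, (he.eq_cellSolution h (1 - x)).1,
      (he.cellSolution_zero_one _ x).1, hu]
    simp
  rcases mul_eq_zero.mp hQS with h0 | h0
  · refine ⟨0, ⟨by linarith [Real.pi_pos], Real.pi_pos.le⟩, u, v,
      (he.isBlochMode_iff h hne).mpr ?_, hsym⟩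
    rw [h0, hu]
    simp
  · refine ⟨Real.pi, ⟨by linarith [Real.pi_pos], le_rfl⟩, u, v,
      (he.isBlochMode_iff h hne).mpr ?_, hsym⟩
    rw [mul_comm Complex.I, Complex.exp_pi_mul_I, h0, hu]
    simp

end IsMirrorProfile

/-! ### Monotonicity of the transfer quotients along a family -/

/-- A nondecreasing, `L¹`-continuous family of profiles with an increasing parameter. -/
structure IsMonotoneFamily (e : ℝ → ℝ → ℝ) (m : ℝ → ℝ) (I : Set ℝ) : Prop where
  profile : ∀ y ∈ I, IsMirrorProfile (e y)
  nontrivial : ∀ y ∈ I, NontrivialProfile (e y)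
  tendsto : ∀ x ∈ I, Tendsto (fun y => ∫ t in (0 : ℝ)..1, |e y t - e x t|) (𝓝[I] x) (𝓝 0)
  continuousOn : ContinuousOn m I
  monotone : ∀ x ∈ I, ∀ y ∈ I, x ≤ y → ∀ t, e x t ≤ e y t
  strictMonoOn : StrictMonoOn m I

theorem div_lt_div_of_right_local {f g : ℝ → ℝ} {x y : ℝ} (hxy : x < y)
    (hf : ContinuousOn f (Icc x y)) (hg : ContinuousOn g (Icc x y)) (hf0 : ∀ t ∈ Icc x y, f t ≠ 0)
    (h : ∀ t ∈ Ico x y, ∀ᶠ s in 𝓝[Ioc t y] t, f t * g s - g t * f s < 0) :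
    g y / f y < g x / f x := by
  have key := lt_of_forall_exists_gt (f := fun t => -(g t / f t)) hxy (hg.div hf hf0).neg
    (fun t ht => by
      have htI : t ∈ Icc x y := ⟨ht.1, ht.2.le⟩
      have hsub : Ioc t y ⊆ Icc x y := fun s hs => ⟨ht.1.trans hs.1.le, hs.2⟩
      have hne : (𝓝[Ioc t y] t).NeBot := by
        rw [nhdsWithin_Ioc_eq_nhdsGT ht.2]
        infer_instance
      have hpos : ∀ᶠ s in 𝓝[Ioc t y] t, 0 < f s * f t := by
        have : Tendsto (fun s => f s * f t) (𝓝[Ioc t y] t) (𝓝 (f t * f t)) :=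
          (((hf t htI).mono hsub).tendsto).mul_const _
        exact this.eventually (lt_mem_nhds (mul_self_pos.mpr (hf0 t htI)))
      obtain ⟨s, ⟨h1, h2⟩, hs⟩ := (((h t ht).and hpos).and self_mem_nhdsWithin).exists
      refine ⟨s, hs, ?_⟩
      have hft := hf0 t htI
      have hfs := hf0 s (hsub hs)
      rw [neg_lt_neg_iff, ← sub_neg, div_sub_div _ _ hfs hft]
      exact div_neg_of_neg_of_pos (by linarith) h2)
  linarith

namespace IsMonotoneFamily

variable {e : ℝ → ℝ → ℝ} {m : ℝ → ℝ} {I J : Set ℝ}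

theorem eventually_abs_sub_lt (h : IsMonotoneFamily e m I) {x : ℝ} (hx : x ∈ I) (U V : ℝ) {ε : ℝ}
    (hε : 0 < ε) : ∀ᶠ y in 𝓝[I] x,
      |(cellSolution (e y) (m y) U V).1 1 - (cellSolution (e x) (m x) U V).1 1| < ε ∧
      |(cellSolution (e y) (m y) U V).2 1 - (cellSolution (e x) (m x) U V).2 1| < ε := by
  obtain ⟨h₀, a₀, b₀⟩ := cellSolution_spec (h.profile x hx).locallyIntegrable (m x) U V
  obtain ⟨δ, hδ, H⟩ := RealSolution.exists_forall_abs_sub_lt (h.profile x hx).locallyIntegrable h₀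
    (1 / 2) (R := 1 / 2) (by norm_num) hε
  filter_upwards [self_mem_nhdsWithin, (h.tendsto x hx).eventually (gt_mem_nhds hδ),
    ((h.continuousOn x hx).tendsto).eventually (Metric.ball_mem_nhds _ hδ)] with y hy h1 h2
  obtain ⟨h₁, a₁, b₁⟩ := cellSolution_spec (h.profile y hy).locallyIntegrable (m y) U V
  refine H _ _ _ _ (h.profile y hy).locallyIntegrable h₁ (a₁.trans a₀.symm) (b₁.trans b₀.symm)
    ?_ ?_ 1 (by rw [abs_of_nonneg] <;> norm_num)
  · rw [sub_self, add_halves]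
    exact h1
  · rwa [← Real.dist_eq]

theorem continuousOn_cellSolution (h : IsMonotoneFamily e m I) (U V : ℝ) :
    ContinuousOn (fun y => (cellSolution (e y) (m y) U V).1 1) I ∧
      ContinuousOn (fun y => (cellSolution (e y) (m y) U V).2 1) I := by
  constructor <;>
  · intro x hx
    rw [ContinuousWithinAt, Metric.tendsto_nhds]
    intro ε hε
    filter_upwards [h.eventually_abs_sub_lt hx U V hε] with y hy
    rw [Real.dist_eq]
    first | exact hy.1 | exact hy.2

theorem continuousOn_cellP (h : IsMonotoneFamily e m I) :
    ContinuousOn (fun y => cellP (e y) (m y)) I := (h.continuousOn_cellSolution 1 0).1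

theorem continuousOn_cellQ (h : IsMonotoneFamily e m I) :
    ContinuousOn (fun y => cellQ (e y) (m y)) I := (h.continuousOn_cellSolution 0 1).1

theorem continuousOn_cellR (h : IsMonotoneFamily e m I) :
    ContinuousOn (fun y => cellR (e y) (m y)) I := (h.continuousOn_cellSolution 1 0).2

theorem continuousOn_cellS (h : IsMonotoneFamily e m I) :
    ContinuousOn (fun y => cellS (e y) (m y)) I := (h.continuousOn_cellSolution 0 1).2

theorem eventually_wronskian_neg (h : IsMonotoneFamily e m I) {x : ℝ} (hx : x ∈ I) (U V : ℝ)
    (hne : ∃ t ∈ Icc (1 / 2 : ℝ) 1, (cellSolution (e x) (m x) U V).1 t ≠ 0) :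
    ∀ᶠ y in 𝓝[I ∩ Ioi x] x,
      (cellSolution (e x) (m x) U V).1 1 * (cellSolution (e y) (m y) U V).2 1 -
      (cellSolution (e x) (m x) U V).2 1 * (cellSolution (e y) (m y) U V).1 1 < 0 := by
  obtain ⟨h₀, a₀, b₀⟩ := cellSolution_spec (h.profile x hx).locallyIntegrable (m x) U V
  obtain ⟨δ, hδ, H⟩ := RealSolution.exists_forall_wronskian_neg (c := 1 / 2) (R := 1 / 2)
    (h.profile x hx).locallyIntegrable h₀ (by norm_num) (by rwa [add_halves])
  have hle : 𝓝[I ∩ Ioi x] x ≤ 𝓝[I] x := nhdsWithin_mono _ inter_subset_left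
  filter_upwards [self_mem_nhdsWithin, hle ((h.tendsto x hx).eventually (gt_mem_nhds hδ)),
    hle (((h.continuousOn x hx).tendsto).eventually (Metric.ball_mem_nhds _ hδ))] with y hy h1 h2
  obtain ⟨h₁, a₁, b₁⟩ := cellSolution_spec (h.profile y hy.1).locallyIntegrable (m y) U V
  have := H _ _ _ _ (h.profile y hy.1).locallyIntegrable h₁ (a₁.trans a₀.symm) (b₁.trans b₀.symm)
    (by rw [sub_self, add_halves]; exact h1) (by rwa [← Real.dist_eq])
    (h.monotone x hx y hy.1 (le_of_lt hy.2)) (h.strictMonoOn hx hy.1 hy.2)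
  rwa [add_halves] at this

/-- This is the slope of the state at `1` of the even solution, which turns clockwise as the
parameter grows. -/
theorem strictAntiOn_cellR_div_cellP (h : IsMonotoneFamily e m I) (hJ : J.OrdConnected)
    (hJI : J ⊆ I) (hP : ∀ y ∈ J, cellP (e y) (m y) ≠ 0) :
    StrictAntiOn (fun y => cellR (e y) (m y) / cellP (e y) (m y)) J := by
  intro x hx y hy hxy
  have hs : Icc x y ⊆ J := hJ.out hx hy
  refine div_lt_div_of_right_local (f := fun y => cellP (e y) (m y))
    (g := fun y => cellR (e y) (m y)) hxy (h.continuousOn_cellP.mono (hs.trans hJI))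
    (h.continuousOn_cellR.mono (hs.trans hJI)) (fun t ht => hP t (hs ht)) fun t ht => ?_
  have htI : t ∈ I := hJI (hs ⟨ht.1, ht.2.le⟩)
  have hspec := cellSolution_spec (h.profile t htI).locallyIntegrable (m t) 1 0
  refine nhdsWithin_mono t (fun s hs' => ?_) (h.eventually_wronskian_neg htI 1 0
    ⟨1 / 2, by norm_num, by rw [hspec.2.1]; exact one_ne_zero⟩)
  exact ⟨hJI (hs ⟨ht.1.trans hs'.1.le, hs'.2⟩), hs'.1⟩

/-- The odd solution also turns clockwise. Field over flux is the reciprocal of the slope, so its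
monotonicity is reversed. -/
theorem strictMonoOn_cellQ_div_cellS (h : IsMonotoneFamily e m I) (hJ : J.OrdConnected)
    (hJI : J ⊆ I) (hS : ∀ y ∈ J, cellS (e y) (m y) ≠ 0) :
    StrictMonoOn (fun y => cellQ (e y) (m y) / cellS (e y) (m y)) J := by
  intro x hx y hy hxy
  have hs : Icc x y ⊆ J := hJ.out hx hy
  have := div_lt_div_of_right_local (f := fun y => cellS (e y) (m y))
    (g := fun y => -cellQ (e y) (m y)) hxy (h.continuousOn_cellS.mono (hs.trans hJI))
    (h.continuousOn_cellQ.mono (hs.trans hJI)).neg (fun t ht => hS t (hs ht)) (fun t ht => by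
      have htI : t ∈ I := hJI (hs ⟨ht.1, ht.2.le⟩)
      have hle : 𝓝[Ioc t y] t ≤ 𝓝[I ∩ Ioi t] t :=
        nhdsWithin_mono t fun s hs' => ⟨hJI (hs ⟨ht.1.trans hs'.1.le, hs'.2⟩), hs'.1⟩
      filter_upwards [hle (h.eventually_wronskian_neg htI 0 1
        ((h.nontrivial t htI).exists_cellSolution_ne_zero (h.profile t htI) _))] with s hs'
      simp only [cellQ, cellS]
      linarith)
  rw [neg_div, neg_div] at this
  simp only
  linarith

end IsMonotoneFamily

/-! ### The sign of the half trace and the number of bands -/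

theorem mul_pos_of_no_zero {f : ℝ → ℝ} {a b : ℝ} (hab : a ≤ b) (hf : ContinuousOn f (Icc a b))
    (h0 : ∀ x ∈ Icc a b, f x ≠ 0) : 0 < f a * f b := by
  by_contra hcon
  have ha := h0 a ⟨le_rfl, hab⟩
  have hb := h0 b ⟨hab, le_rfl⟩
  have hmem : (0 : ℝ) ∈ uIcc (f a) (f b) := by
    rw [mem_uIcc]
    rcases lt_or_gt_of_ne ha with h | h
    · exact Or.inl ⟨h.le, by nlinarith⟩
    · exact Or.inr ⟨by nlinarith, h.le⟩
  rw [← uIcc_of_le hab] at hf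
  obtain ⟨x, hx, hx0⟩ := intermediate_value_uIcc hf hmem
  rw [uIcc_of_le hab] at hx
  exact h0 x hx hx0

/-- A continuous function that changes sign at each of its `n` zeros has end values whose signs
differ by `(-1) ^ n`. -/
theorem neg_one_pow_mul_pos_of_sign_changes {f : ℝ → ℝ} {a : ℝ} (n : ℕ) {b : ℝ} (hab : a ≤ b)
    (hf : ContinuousOn f (Icc a b)) (ha : f a ≠ 0) (hb : f b ≠ 0)
    (hn : {z | z ∈ Ioo a b ∧ f z = 0}.encard = n)
    (hc : ∀ z ∈ Ioo a b, f z = 0 →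
      ∃ δ > 0, ∀ x ∈ Ioo (z - δ) z, ∀ y ∈ Ioo z (z + δ), f x * f y < 0) :
    0 < (-1) ^ n * (f a * f b) := by
  induction n generalizing b with
  | zero =>
    rw [pow_zero, one_mul]
    refine mul_pos_of_no_zero hab hf fun x hx hx0 => ?_
    rw [Nat.cast_zero, Set.encard_eq_zero] at hn
    have : x ∈ {z | z ∈ Ioo a b ∧ f z = 0} :=
      ⟨⟨lt_of_le_of_ne hx.1 fun h => ha (h ▸ hx0), lt_of_le_of_ne hx.2 fun h => hb (h ▸ hx0)⟩, hx0⟩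
    rw [hn] at this
    exact this
  | succ n ih =>
    set Z := {z | z ∈ Ioo a b ∧ f z = 0} with hZ
    have hfin : Z.Finite := Set.finite_of_encard_eq_coe hn
    have hne : Z.Nonempty := by
      rw [← Set.encard_ne_zero, hn]
      exact_mod_cast Nat.succ_ne_zero n
    -- Split off the largest zero: a point just left of it becomes the new right end with `n` zeros,
    -- and the sign is constant between `z` and `b`.
    obtain ⟨z, hz, hmax⟩ := hfin.exists_maximalFor id Z hne
    have hmax' : ∀ t ∈ Z, t ≤ z := fun t ht => by
      by_contra hlt
      exact hlt (hmax ht (le_of_not_ge hlt))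
    obtain ⟨δ, hδ, hsign⟩ := hc z hz.1 hz.2
    have hev : ∀ᶠ x in 𝓝[<] z, (∀ t ∈ Z \ {z}, t < x) ∧ a < x ∧ z - δ < x ∧ x < z := by
      refine Filter.Eventually.and ?_ (Filter.Eventually.and ?_ (Filter.Eventually.and ?_ ?_))
      · rw [Filter.eventually_all_finite (hfin.subset sdiff_subset)]
        intro t ht
        have : t < z := lt_of_le_of_ne (hmax' t ht.1) ht.2
        exact mem_nhdsWithin_of_mem_nhds (lt_mem_nhds this)
      · exact mem_nhdsWithin_of_mem_nhds (lt_mem_nhds hz.1.1)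
      · exact mem_nhdsWithin_of_mem_nhds (lt_mem_nhds (by linarith))
      · exact self_mem_nhdsWithin
    obtain ⟨x, hx1, hax, hxδ, hxz⟩ := hev.exists
    have hzb := hz.1.2
    set y := min (z + δ / 2) ((z + b) / 2) with hy
    have hzy : z < y := lt_min (by linarith) (by linarith)
    have hyb : y < b := (min_le_right _ _).trans_lt (by linarith)
    have hyδ : y < z + δ := (min_le_left _ _).trans_lt (by linarith)
    have hxy := hsign x ⟨hxδ, hxz⟩ y ⟨hzy, hyδ⟩
    have hyb' : 0 < f y * f b := by
      refine mul_pos_of_no_zero hyb.le (hf.mono (Icc_subset_Icc_left (by linarith))) ?_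
      intro t ht ht0
      rcases eq_or_lt_of_le ht.2 with h | h
      · exact hb (h ▸ ht0)
      · have := hmax' t ⟨⟨by linarith [ht.1], h⟩, ht0⟩
        linarith [ht.1]
    have hx0 : f x ≠ 0 := fun h => by simp [h] at hxy
    have hset : {t | t ∈ Ioo a x ∧ f t = 0} = Z \ {z} := by
      ext t
      constructor
      · rintro ⟨h1, h2⟩
        exact ⟨⟨⟨h1.1, by linarith [h1.2]⟩, h2⟩, by
          rintro rfl
          linarith [h1.2]⟩
      · rintro ⟨h1, h2⟩
        exact ⟨⟨h1.1.1, hx1 t ⟨h1, h2⟩⟩, h1.2⟩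
    have hcard : {t | t ∈ Ioo a x ∧ f t = 0}.encard = n := by
      rw [hset]
      have := Set.encard_sdiff_singleton_add_one hz
      rw [hn, Nat.cast_add, Nat.cast_one] at this
      exact (ENat.add_left_injective_of_ne_top (by simp)) this
    have hih := ih hax.le (hf.mono (Icc_subset_Icc_right (by linarith))) hx0 hcard
      (fun t ht => hc t ⟨ht.1, by linarith [ht.2]⟩)
    have h1 : f x * f b < 0 := by
      have hy0 : 0 < f y * f y := mul_self_pos.mpr fun h => by simp [h] at hxy
      nlinarith [mul_neg_of_neg_of_pos hxy hyb']
    have h2 : 0 < f x * f x := mul_self_pos.mpr hx0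
    have h3 : (-1) ^ n * (f a * f x) * (f x * f b) < 0 := mul_neg_of_pos_of_neg hih h1
    rw [pow_succ]
    nlinarith

theorem cellA_zero {e : ℝ → ℝ} (he : LocallyIntegrable e) : cellA e 0 = 1 := by
  obtain ⟨h, a, b⟩ := cellSolution_spec he 0 1 0
  have hR : cellR e 0 = 0 := by
    have := h.flux_sub (1 / 2) 1
    rw [b] at this
    simpa [cellR] using this
  have := cell_det he 0
  rw [cellA]
  rw [hR] at this ⊢
  linarith

theorem isMonotoneFamily_const {e : ℝ → ℝ} {μ₀ : ℝ} (hμ₀ : 0 < μ₀) (he : IsMirrorProfile e)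
    (hn : NontrivialProfile e) : IsMonotoneFamily (fun _ => e) (fun y => μ₀ * y) univ where
  profile _ _ := he
  nontrivial _ _ := hn
  tendsto x _ := by simp
  continuousOn := by fun_prop
  monotone _ _ _ _ _ _ := le_rfl
  strictMonoOn x _ y _ hxy := by simpa using (mul_lt_mul_iff_right₀ hμ₀).mpr hxy

/-- At a zero, `PS = 1/2` and `QR = -1/2`. Write `A = PS (1 + fg)` with `f = R/P` decreasing and `g
= Q/S` increasing. Near `z` these have opposite signs, so `fg` is strictly monotone through `-1`
while `PS` stays positive. -/
theorem sign_change_cellA {e : ℝ → ℝ} {μ₀ z : ℝ} (hμ₀ : 0 < μ₀) (he : IsMirrorProfile e)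
    (hn : NontrivialProfile e) (hz : cellA e (μ₀ * z) = 0) :
    ∃ δ > 0, ∀ x ∈ Ioo (z - δ) z, ∀ y ∈ Ioo z (z + δ),
      cellA e (μ₀ * x) * cellA e (μ₀ * y) < 0 := by
  have hfam := isMonotoneFamily_const hμ₀ he hn
  set P := fun y => cellP e (μ₀ * y) with hP
  set Q := fun y => cellQ e (μ₀ * y) with hQ
  set R := fun y => cellR e (μ₀ * y) with hR
  set S := fun y => cellS e (μ₀ * y) with hS
  have cP : Continuous P := continuousOn_univ.mp hfam.continuousOn_cellP
  have cQ : Continuous Q := continuousOn_univ.mp hfam.continuousOn_cellQ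
  have cR : Continuous R := continuousOn_univ.mp hfam.continuousOn_cellR
  have cS : Continuous S := continuousOn_univ.mp hfam.continuousOn_cellS
  have hA : ∀ y, cellA e (μ₀ * y) = P y * S y + Q y * R y := fun y => rfl
  have hdet : ∀ y, P y * S y - Q y * R y = 1 := fun y => cell_det he.locallyIntegrable _
  have hPS : P z * S z = 1 / 2 := by
    have := hdet z
    rw [hA] at hz
    linarith
  have hQR : Q z * R z = -1 / 2 := by
    have := hdet z
    linarith
  have hev : ∀ᶠ y in 𝓝 z, 0 < P z * P y ∧ 0 < S z * S y ∧ 0 < Q z * Q y ∧ 0 < R z * R y := by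
    have aux : ∀ {f : ℝ → ℝ}, Continuous f → f z ≠ 0 → ∀ᶠ y in 𝓝 z, 0 < f z * f y :=
      fun {f} hf h0 => ((continuous_const.mul hf).tendsto z).eventually
        (lt_mem_nhds (mul_self_pos.mpr h0))
    refine (aux cP ?_).and ((aux cS ?_).and ((aux cQ ?_).and (aux cR ?_))) <;>
    · intro h0
      first
      | (rw [h0] at hPS; norm_num at hPS)
      | (rw [h0] at hQR; norm_num at hQR)
  obtain ⟨δ, hδ, hball⟩ := Metric.eventually_nhds_iff_ball.mp hev
  have hJ : (Metric.ball z δ).OrdConnected := by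
    rw [Real.ball_eq_Ioo]
    exact ordConnected_Ioo
  have hf := hfam.strictAntiOn_cellR_div_cellP hJ (subset_univ _)
    (fun y hy => right_ne_zero_of_mul (hball y hy).1.ne')
  have hg := hfam.strictMonoOn_cellQ_div_cellS hJ (subset_univ _)
    (fun y hy => right_ne_zero_of_mul (hball y hy).2.1.ne')
  change StrictAntiOn (fun y => R y / P y) _ at hf
  change StrictMonoOn (fun y => Q y / S y) _ at hg
  have hzb : z ∈ Metric.ball z δ := Metric.mem_ball_self hδ
  refine ⟨δ, hδ, fun x hx y hy => ?_⟩
  have hxb : x ∈ Metric.ball z δ := by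
    rw [Real.ball_eq_Ioo]
    exact ⟨hx.1, by linarith [hx.2]⟩
  have hyb : y ∈ Metric.ball z δ := by
    rw [Real.ball_eq_Ioo]
    exact ⟨by linarith [hy.1], hy.2⟩
  have fx := hf hxb hzb hx.2
  have fy := hf hzb hyb hy.1
  have gx := hg hxb hzb hx.2
  have gy := hg hzb hyb hy.1
  simp only at fx fy gx gy
  have hPS' : ∀ w ∈ Metric.ball z δ, 0 < P w * S w ∧
      P w * S w + Q w * R w = P w * S w * (1 + (R w / P w) * (Q w / S w)) ∧
      0 < (R z / P z) * (R w / P w) ∧ 0 < (Q z / S z) * (Q w / S w) := by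
    intro w hw
    obtain ⟨b1, b2, b3, b4⟩ := hball w hw
    have p1 := right_ne_zero_of_mul b1.ne'
    have p2 := right_ne_zero_of_mul b2.ne'
    refine ⟨?_, by field_simp, ?_, ?_⟩
    · have : 0 < (P z * S z) * (P w * S w) := by nlinarith [mul_pos b1 b2]
      rw [hPS] at this
      linarith
    · rw [div_mul_div_comm]
      exact div_pos b4 b1
    · rw [div_mul_div_comm]
      exact div_pos b3 b2
  obtain ⟨x1, x2, x3, x4⟩ := hPS' x hxb
  obtain ⟨y1, y2, y3, y4⟩ := hPS' y hyb
  have hz1 : (R z / P z) * (Q z / S z) = -1 := by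
    rw [div_mul_div_comm, hPS, mul_comm, hQR]
    norm_num
  rw [hA, hA, x2, y2]
  generalize R z / P z = fz at *
  generalize Q z / S z = gz at *
  generalize R x / P x = f1 at *
  generalize Q x / S x = g1 at *
  generalize R y / P y = f2 at *
  generalize Q y / S y = g2 at *
  have main : (1 + f1 * g1) * (1 + f2 * g2) < 0 := by
    rcases lt_trichotomy fz 0 with h | h | h
    · have gz0 : 0 < gz := by nlinarith
      have e1 : f1 < 0 := by nlinarith
      have e2 : 0 < g1 := by nlinarith
      have e3 : f2 < 0 := by nlinarith
      have e4 : 0 < g2 := by nlinarith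
      exact mul_neg_of_pos_of_neg (by nlinarith) (by nlinarith)
    · rw [h] at hz1
      norm_num at hz1
    · have gz0 : gz < 0 := by nlinarith
      have e1 : 0 < f1 := by nlinarith
      have e2 : g1 < 0 := by nlinarith
      have e3 : 0 < f2 := by nlinarith
      have e4 : g2 < 0 := by nlinarith
      exact mul_neg_of_neg_of_pos (by nlinarith) (by nlinarith)
  have := mul_neg_of_pos_of_neg (mul_pos x1 y1) main
  linarith

/-- In a gap the sign of the half trace is determined by the number of bands below it. -/
theorem neg_one_pow_mul_cellA_pos {e : ℝ → ℝ} {μ₀ lam : ℝ} (hμ₀ : 0 < μ₀) (hlam : 0 < lam)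
    (he : IsMirrorProfile e) (hn : NontrivialProfile e) {n : ℕ}
    (hcard : {l : ℝ | 0 < l ∧ l < lam ∧ IsBlochEigenvalue e μ₀ (Real.pi / 2) l}.encard = n)
    (hA : cellA e (μ₀ * lam) ≠ 0) : 0 < (-1) ^ n * cellA e (μ₀ * lam) := by
  have hfam := isMonotoneFamily_const hμ₀ he hn
  have hcont : Continuous fun l => cellA e (μ₀ * l) := by
    have cP := continuousOn_univ.mp hfam.continuousOn_cellP
    have cQ := continuousOn_univ.mp hfam.continuousOn_cellQ
    have cR := continuousOn_univ.mp hfam.continuousOn_cellR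
    have cS := continuousOn_univ.mp hfam.continuousOn_cellS
    exact (cP.mul cS).add (cQ.mul cR)
  have h0 : cellA e (μ₀ * 0) = 1 := by rw [mul_zero, cellA_zero he.locallyIntegrable]
  -- At `κ = π/2` the cosine vanishes, so the Bloch eigenvalues are the zeros of the half trace,
  -- counted from `λ = 0` where it equals `1`.
  have := neg_one_pow_mul_pos_of_sign_changes (f := fun l => cellA e (μ₀ * l)) n hlam.le
    hcont.continuousOn (by rw [h0]; exact one_ne_zero) hA (by
      rw [← hcard]
      congr 1
      ext l
      simp only [mem_ofPred_eq, mem_Ioo, he.isBlochEigenvalue_iff hn, Real.cos_pi_div_two, and_assoc])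
    (fun z _ hz => sign_change_cellA hμ₀ he hn hz)
  simpa only [h0, one_mul] using this

/-! ### The two types of gaps and the matching condition -/

/-- The behaviour of the half-cell transfer matrix across a band gap `[a, b]`; `τ` is the sign of the
half trace in the gap. -/
structure GapData (P Q R S : ℝ → ℝ) (τ a b : ℝ) : Prop where
  lt : a < b
  continuousOn_P : ContinuousOn P (Icc a b)
  continuousOn_Q : ContinuousOn Q (Icc a b)
  continuousOn_R : ContinuousOn R (Icc a b)
  continuousOn_S : ContinuousOn S (Icc a b)
  det : ∀ x ∈ Icc a b, P x * S x - Q x * R x = 1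
  sign_sq : τ ^ 2 = 1
  pos : ∀ x ∈ Ioo a b, 0 < P x * Q x * R x * S x
  sign_pos : ∀ x ∈ Ioo a b, 0 < τ * (P x * S x)
  left : P a * Q a * R a * S a = 0
  right : P b * Q b * R b * S b = 0
  anti : StrictAntiOn (fun x => R x / P x) (Ioo a b)
  mono : StrictMonoOn (fun x => Q x / S x) (Ioo a b)

/-- Clearing the denominator gives `k f² ≤ g f`, which survives the limit even where the quotient
does not. -/
theorem eq_zero_of_le_div {f g : ℝ → ℝ} {c k : ℝ} {l : Filter ℝ} [l.NeBot] (hk : 0 < k)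
    (hf : Tendsto f l (𝓝 (f c))) (hg : Tendsto g l (𝓝 (g c))) (h : ∀ᶠ x in l, k ≤ g x / f x)
    (h0 : g c = 0) : f c = 0 := by
  have h1 : ∀ᶠ x in l, k * f x ^ 2 ≤ g x * f x := by
    filter_upwards [h] with x hx
    have hfx : f x ≠ 0 := by
      rintro h
      rw [h, div_zero] at hx
      linarith
    calc k * f x ^ 2 ≤ g x / f x * f x ^ 2 := by gcongr
      _ = g x * f x := by field_simp
  have h2 : k * f c ^ 2 ≤ g c * f c := le_of_tendsto_of_tendsto ((hf.pow 2).const_mul k)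
    (hg.mul hf) h1
  rw [h0, zero_mul] at h2
  have : f c ^ 2 = 0 := le_antisymm (by nlinarith) (sq_nonneg _)
  exact pow_eq_zero_iff two_ne_zero |>.mp this

namespace GapData

variable {P Q R S : ℝ → ℝ} {τ a b : ℝ}

theorem ne_zero (h : GapData P Q R S τ a b) {x : ℝ} (hx : x ∈ Ioo a b) :
    P x ≠ 0 ∧ Q x ≠ 0 ∧ R x ≠ 0 ∧ S x ≠ 0 := by
  have := h.pos x hx
  refine ⟨?_, ?_, ?_, ?_⟩ <;>
  · intro h0
    simp [h0] at this

theorem sign_pos' (h : GapData P Q R S τ a b) {x : ℝ} (hx : x ∈ Ioo a b) :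
    0 < τ * (Q x * R x) := by
  have h1 := h.pos x hx
  have h2 := h.sign_pos x hx
  have h3 := h.sign_sq
  have : τ * (P x * S x) * (τ * (Q x * R x)) = P x * Q x * R x * S x := by
    linear_combination (P x * Q x * R x * S x) * h3
  exact pos_of_mul_pos_right (this ▸ h1) h2.le

theorem mul_pos_mul {f g : ℝ → ℝ} (hf : ContinuousOn f (Icc a b)) (hg : ContinuousOn g (Icc a b))
    (h : ∀ x ∈ Ioo a b, f x ≠ 0 ∧ g x ≠ 0) {x y : ℝ} (hx : x ∈ Ioo a b) (hy : y ∈ Ioo a b) :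
    0 < (f x * g x) * (f y * g y) := by
  wlog hxy : x ≤ y generalizing x y
  · rw [mul_comm]
    exact this hy hx (le_of_not_ge hxy)
  have hsub : Icc x y ⊆ Ioo a b := fun t ht => ⟨hx.1.trans_le ht.1, ht.2.trans_lt hy.2⟩
  have hsub' := hsub.trans Ioo_subset_Icc_self
  exact mul_pos_of_no_zero (f := fun t => f t * g t) hxy ((hf.mono hsub').mul (hg.mono hsub'))
    fun t ht => mul_ne_zero (h t (hsub ht)).1 (h t (hsub ht)).2

theorem inv_lt_inv_of_mul_pos {s t : ℝ} (h : 0 < s * t) (hst : s < t) : t⁻¹ < s⁻¹ := by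
  have hs := left_ne_zero_of_mul h.ne'
  have ht := right_ne_zero_of_mul h.ne'
  rw [← sub_pos, inv_sub_inv hs ht]
  exact div_pos (by linarith) h

/-- The quarter turn `(u, v) ↦ (v, -u)` keeps the determinant and replaces each quotient by its
negative reciprocal. Monotonicity survives, while `τ` and the sign of the quotients flip, so only
the positive type has to be analysed. -/
theorem rotate (h : GapData P Q R S τ a b) :
    GapData R S (fun x => -P x) (fun x => -Q x) (-τ) a b where
  lt := h.lt
  continuousOn_P := h.continuousOn_R
  continuousOn_Q := h.continuousOn_S
  continuousOn_R := h.continuousOn_P.neg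
  continuousOn_S := h.continuousOn_Q.neg
  det x hx := by linarith [h.det x hx]
  sign_sq := by rw [neg_sq, h.sign_sq]
  pos x hx := by linarith [h.pos x hx]
  sign_pos x hx := by linarith [h.sign_pos' hx]
  left := by linarith [h.left]
  right := by linarith [h.right]
  anti x hx y hy hxy := by
    have h1 : R y / P y < R x / P x := h.anti hx hy hxy
    have h2 := mul_pos_mul h.continuousOn_R h.continuousOn_P
      (fun x hx => ⟨(h.ne_zero hx).2.2.1, (h.ne_zero hx).1⟩) hy hx
    have h3 : 0 < R y / P y * (R x / P x) := by
      obtain ⟨p1, -, r1, -⟩ := h.ne_zero hx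
      obtain ⟨p2, -, r2, -⟩ := h.ne_zero hy
      have : R y / P y * (R x / P x) = R y * P y * (R x * P x) / (P y ^ 2 * P x ^ 2) := by
        field_simp
      rw [this]
      positivity
    have h4 := inv_lt_inv_of_mul_pos h3 h1
    rw [inv_div, inv_div] at h4
    simp only [neg_div]
    linarith
  mono x hx y hy hxy := by
    have h1 : Q x / S x < Q y / S y := h.mono hx hy hxy
    have h2 := mul_pos_mul h.continuousOn_Q h.continuousOn_S
      (fun x hx => ⟨(h.ne_zero hx).2.1, (h.ne_zero hx).2.2.2⟩) hx hy
    have h3 : 0 < Q x / S x * (Q y / S y) := by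
      obtain ⟨-, p1, -, r1⟩ := h.ne_zero hx
      obtain ⟨-, p2, -, r2⟩ := h.ne_zero hy
      have : Q x / S x * (Q y / S y) = Q x * S x * (Q y * S y) / (S x ^ 2 * S y ^ 2) := by
        field_simp
      rw [this]
      positivity
    have h4 := inv_lt_inv_of_mul_pos h3 h1
    rw [inv_div, inv_div] at h4
    simp only [div_neg]
    linarith

theorem tendsto_left {f : ℝ → ℝ} (hab : a < b) (hf : ContinuousOn f (Icc a b)) :
    Tendsto f (𝓝[>] a) (𝓝 (f a)) := by
  rw [← nhdsWithin_Ioo_eq_nhdsGT hab]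
  exact ((hf a (left_mem_Icc.mpr hab.le)).mono Ioo_subset_Icc_self).tendsto

theorem tendsto_right {f : ℝ → ℝ} (hab : a < b) (hf : ContinuousOn f (Icc a b)) :
    Tendsto f (𝓝[<] b) (𝓝 (f b)) := by
  rw [← nhdsWithin_Ioo_eq_nhdsLT hab]
  exact ((hf b (right_mem_Icc.mpr hab.le)).mono Ioo_subset_Icc_self).tendsto

/-- In the first of the two types of gaps, the quotients `R / P` and `Q / S` are positive. -/
def IsPositive (P Q R S : ℝ → ℝ) (a b : ℝ) : Prop :=
  ∀ x ∈ Ioo a b, 0 < R x / P x ∧ 0 < Q x / S x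

theorem isPositive_or_rotate (h : GapData P Q R S τ a b) :
    IsPositive P Q R S a b ∨ IsPositive R S (fun x => -P x) (fun x => -Q x) a b := by
  have hm : (a + b) / 2 ∈ Ioo a b := ⟨by linarith [h.lt], by linarith [h.lt]⟩
  have h1 : ∀ x ∈ Ioo a b, 0 < (R ((a + b) / 2) * P ((a + b) / 2)) * (R x * P x) := fun x hx =>
    mul_pos_mul h.continuousOn_R h.continuousOn_P
      (fun x hx => ⟨(h.ne_zero hx).2.2.1, (h.ne_zero hx).1⟩) hm hx
  have h2 : ∀ x ∈ Ioo a b, 0 < (R x * P x) * (Q x * S x) := fun x hx => by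
    linarith [h.pos x hx]
  rcases lt_or_gt_of_ne (left_ne_zero_of_mul (h1 _ hm).ne') with hs | hs
  · right
    intro x hx
    have a1 : R x * P x < 0 := neg_of_mul_pos_right (h1 x hx) hs.le
    have a2 : Q x * S x < 0 := neg_of_mul_pos_right (h2 x hx) a1.le
    rw [neg_div, div_neg]
    constructor
    · rw [neg_pos, div_neg_iff]
      exact (mul_neg_iff.mp a1).elim (fun h => Or.inr ⟨h.2, h.1⟩) (fun h => Or.inl ⟨h.2, h.1⟩)
    · rw [neg_pos, div_neg_iff]
      exact (mul_neg_iff.mp a2).elim (fun h => Or.inr ⟨h.2, h.1⟩) (fun h => Or.inl ⟨h.2, h.1⟩)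
  · left
    intro x hx
    have a1 : 0 < R x * P x := pos_of_mul_pos_right (h1 x hx) hs.le
    have a2 : 0 < Q x * S x := pos_of_mul_pos_right (h2 x hx) a1.le
    exact ⟨div_pos_iff.mpr (mul_pos_iff.mp a1), div_pos_iff.mpr (mul_pos_iff.mp a2)⟩

/-- Towards `a`, both `R/P` and `S/Q` stay above positive constants. If `R` or `S` vanished at `a`,
so would its whole column, against determinant one. Towards `b` the reciprocals are bounded below
instead. The vanishing of `PQRS` then falls on the other pair. -/
theorem edges_of_isPositive (h : GapData P Q R S τ a b) (hp : IsPositive P Q R S a b) :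
    (R a ≠ 0 ∧ S a ≠ 0 ∧ P a * Q a = 0) ∧ (P b ≠ 0 ∧ Q b ≠ 0 ∧ R b * S b = 0) := by
  have hm : (a + b) / 2 ∈ Ioo a b := ⟨by linarith [h.lt], by linarith [h.lt]⟩
  have da := h.det a (left_mem_Icc.mpr h.lt.le)
  have db := h.det b (right_mem_Icc.mpr h.lt.le)
  have hl : ∀ᶠ x in 𝓝[>] a, x ∈ Ioo a ((a + b) / 2) := Ioo_mem_nhdsGT hm.1
  have hr : ∀ᶠ x in 𝓝[<] b, x ∈ Ioo ((a + b) / 2) b := Ioo_mem_nhdsLT hm.2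
  have hR : R a ≠ 0 := by
    intro h0
    have := eq_zero_of_le_div (hp _ hm).1 (tendsto_left h.lt h.continuousOn_P)
      (tendsto_left h.lt h.continuousOn_R) (by
        filter_upwards [hl] with x hx
        exact (h.anti ⟨hx.1, hx.2.trans hm.2⟩ hm hx.2).le) h0
    rw [this, h0] at da
    norm_num at da
  have hS : S a ≠ 0 := by
    intro h0
    have := eq_zero_of_le_div (f := Q) (g := S) (inv_pos.mpr (hp _ hm).2)
      (tendsto_left h.lt h.continuousOn_Q) (tendsto_left h.lt h.continuousOn_S) (by
        filter_upwards [hl] with x hx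
        have hx' : x ∈ Ioo a b := ⟨hx.1, hx.2.trans hm.2⟩
        rw [← inv_div (Q x)]
        exact inv_anti₀ (hp x hx').2 (h.mono hx' hm hx.2).le) h0
    rw [this, h0] at da
    norm_num at da
  have hP : P b ≠ 0 := by
    intro h0
    have := eq_zero_of_le_div (f := R) (g := P) (inv_pos.mpr (hp _ hm).1)
      (tendsto_right h.lt h.continuousOn_R) (tendsto_right h.lt h.continuousOn_P) (by
        filter_upwards [hr] with x hx
        have hx' : x ∈ Ioo a b := ⟨hm.1.trans hx.1, hx.2⟩
        rw [← inv_div (R x)]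
        exact inv_anti₀ (hp x hx').1 (h.anti hm hx' hx.1).le) h0
    rw [this, h0] at db
    norm_num at db
  have hQ : Q b ≠ 0 := by
    intro h0
    have := eq_zero_of_le_div (hp _ hm).2 (tendsto_right h.lt h.continuousOn_S)
      (tendsto_right h.lt h.continuousOn_Q) (by
        filter_upwards [hr] with x hx
        exact (h.mono hm ⟨hm.1.trans hx.1, hx.2⟩ hx.1).le) h0
    rw [this, h0] at db
    norm_num at db
  refine ⟨⟨hR, hS, ?_⟩, ⟨hP, hQ, ?_⟩⟩
  · have : P a * Q a * (R a * S a) = 0 := by linarith [h.left]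
    exact (mul_eq_zero.mp this).resolve_right (mul_ne_zero hR hS)
  · have : R b * S b * (P b * Q b) = 0 := by linarith [h.right]
    exact (mul_eq_zero.mp this).resolve_right (mul_ne_zero hP hQ)

/-- At the lower edge `P = 0` leaves `-QR = 1` and `Q = 0` leaves `PS = 1`; either one fixes `τ` by
continuity from inside the gap. -/
theorem index_of_isPositive (h : GapData P Q R S τ a b) (hp : IsPositive P Q R S a b) :
    (P a * R a = 0 ∧ τ = -1) ∨ (P a * R a ≠ 0 ∧ τ = 1) := by
  obtain ⟨⟨hR, hS, hPQ⟩, -⟩ := h.edges_of_isPositive hp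
  have hτ : τ = 1 ∨ τ = -1 := by
    rcases mul_eq_zero.mp (show (τ - 1) * (τ + 1) = 0 by linear_combination h.sign_sq) with h | h
    · exact Or.inl (by linarith)
    · exact Or.inr (by linarith)
  have da := h.det a (left_mem_Icc.mpr h.lt.le)
  have hl : ∀ᶠ x in 𝓝[>] a, x ∈ Ioo a b := Ioo_mem_nhdsGT h.lt
  by_cases hP : P a = 0
  · left
    refine ⟨by rw [hP, zero_mul], ?_⟩
    have h1 : 0 ≤ τ * (Q a * R a) := ge_of_tendsto
      (((tendsto_left h.lt h.continuousOn_Q).mul (tendsto_left h.lt h.continuousOn_R)).const_mul τ)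
      (hl.mono fun x hx => (h.sign_pos' hx).le)
    rw [hP, zero_mul] at da
    rcases hτ with h2 | h2
    · rw [h2] at h1
      linarith
    · exact h2
  · right
    have hQ := (mul_eq_zero.mp hPQ).resolve_left hP
    refine ⟨mul_ne_zero hP hR, ?_⟩
    have h1 : 0 ≤ τ * (P a * S a) := ge_of_tendsto
      (((tendsto_left h.lt h.continuousOn_P).mul (tendsto_left h.lt h.continuousOn_S)).const_mul τ)
      (hl.mono fun x hx => (h.sign_pos x hx).le)
    rw [hQ, zero_mul] at da
    rcases hτ with h2 | h2
    · exact h2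
    · rw [h2] at h1
      linarith

theorem mul_pos_of_isPositive (h : GapData P Q R S τ a b) (hp : IsPositive P Q R S a b) {x : ℝ}
    (hx : x ∈ Ioo a b) : 0 < τ * (P x * Q x) ∧ 0 < τ * (R x * S x) := by
  obtain ⟨h1, h2⟩ := hp x hx
  obtain ⟨hP, hQ, hR, hS⟩ := h.ne_zero hx
  have h3 := h.sign_pos x hx
  have h4 := h.sign_pos' hx
  constructor
  · have : τ * (P x * Q x) = τ * (P x * S x) * (Q x / S x) := by field_simp
    rw [this]
    positivity
  · have : τ * (R x * S x) = τ * (P x * S x) * (R x / P x) := by field_simp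
    rw [this]
    positivity

/-- The function equals `(Q/S) / (R/P)`: positive increasing over positive decreasing. -/
theorem strictMonoOn_of_isPositive (h : GapData P Q R S τ a b) (hp : IsPositive P Q R S a b) :
    StrictMonoOn (fun x => P x * Q x / (R x * S x)) (Ioo a b) := by
  intro x hx y hy hxy
  have e : ∀ x ∈ Ioo a b, P x * Q x / (R x * S x) = Q x / S x / (R x / P x) := by
    intro x hx
    obtain ⟨hP, hQ, hR, hS⟩ := h.ne_zero hx
    field_simp
  simp only [e x hx, e y hy]
  exact div_lt_div₀ (h.mono hx hy hxy) (h.anti hx hy hxy).le (hp y hy).2.le (hp y hy).1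

variable {P' Q' R' S' : ℝ → ℝ} {τ' a' b' : ℝ}

/-- Gaps of opposite type: the matching condition has exactly one solution. -/
theorem existsUnique_matching (h : GapData P Q R S τ a b) (hp : IsPositive P Q R S a b)
    (h' : GapData P' Q' R' S' τ a' b')
    (hp' : IsPositive R' S' (fun x => -P' x) (fun x => -Q' x) a' b')
    (hne : (Ioo a b ∩ Ioo a' b').Nonempty) :
    ∃! x, x ∈ Ioo a b ∩ Ioo a' b' ∧ P x * Q x * (R' x * S' x) = P' x * Q' x * (R x * S x) := by
  have g := h'.rotate
  obtain ⟨⟨hRa, hSa, hPQa⟩, ⟨hPb, hQb, hRSb⟩⟩ := h.edges_of_isPositive hp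
  obtain ⟨⟨hPa', hQa', hRSa'⟩, ⟨hRb', hSb', hPQb'⟩⟩ := g.edges_of_isPositive hp'
  simp only [neg_ne_zero, neg_mul_neg] at hPa' hQa' hPQb'
  set α := max a a' with hα
  set β := min b b' with hβ
  have hαβ : α < β := by
    obtain ⟨x, hx, hx'⟩ := hne
    exact (max_lt hx.1 hx'.1).trans (lt_min hx.2 hx'.2)
  have hIoo : Ioo a b ∩ Ioo a' b' = Ioo α β := Ioo_inter_Ioo
  have hsub : Icc α β ⊆ Icc a b := Icc_subset_Icc (le_max_left _ _) (min_le_left _ _)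
  have hsub' : Icc α β ⊆ Icc a' b' := Icc_subset_Icc (le_max_right _ _) (min_le_right _ _)
  set F : ℝ → ℝ := fun x => P x * Q x * (R' x * S' x) - P' x * Q' x * (R x * S x) with hF
  have cP := h.continuousOn_P.mono hsub
  have cQ := h.continuousOn_Q.mono hsub
  have cR := h.continuousOn_R.mono hsub
  have cS := h.continuousOn_S.mono hsub
  have cP' := h'.continuousOn_P.mono hsub'
  have cQ' := h'.continuousOn_Q.mono hsub'
  have cR' := h'.continuousOn_R.mono hsub'
  have cS' := h'.continuousOn_S.mono hsub'
  have cF : ContinuousOn F (Icc α β) :=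
    ((cP.mul cQ).mul (cR'.mul cS')).sub ((cP'.mul cQ').mul (cR.mul cS))
  have hmemα : α ∈ Icc α β := left_mem_Icc.mpr hαβ.le
  have hmemβ : β ∈ Icc α β := right_mem_Icc.mpr hαβ.le
  have sgn : ∀ x ∈ Ioo α β, P' x * Q' x * (R x * S x) < 0 ∧ P x * Q x * (R' x * S' x) < 0 := by
    intro x hx
    rw [← hIoo] at hx
    obtain ⟨s1, s2⟩ := h.mul_pos_of_isPositive hp hx.1
    obtain ⟨s3, s4⟩ := g.mul_pos_of_isPositive hp' hx.2
    have hτ := h.sign_sq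
    constructor
    · have := mul_pos s4 s2
      nlinarith
    · have := mul_pos s3 s1
      nlinarith
  -- Whichever gap supplies the left end of the overlap, the first product vanishes there because
  -- `PQ` or `R'S'` does. The second one is a nonzero limit of negative values.
  have hFα : 0 < F α := by
    have h1 : P' α * Q' α * (R α * S α) ≤ 0 := le_of_tendsto
      (((tendsto_left hαβ cP').mul (tendsto_left hαβ cQ')).mul
        ((tendsto_left hαβ cR).mul (tendsto_left hαβ cS)))
      (by
        filter_upwards [Ioo_mem_nhdsGT hαβ] with x hx
        exact (sgn x hx).1.le)
    have h2 : P' α * Q' α * (R α * S α) ≠ 0 := by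
      have r : R α ≠ 0 ∧ S α ≠ 0 := by
        rcases eq_or_lt_of_le (hsub hmemα).1 with h0 | h0
        · rw [← h0]
          exact ⟨hRa, hSa⟩
        · exact (h.ne_zero ⟨h0, hαβ.trans_le (hsub hmemβ).2⟩).2.2
      have r' : P' α ≠ 0 ∧ Q' α ≠ 0 := by
        rcases eq_or_lt_of_le (hsub' hmemα).1 with h0 | h0
        · rw [← h0]
          exact ⟨hPa', hQa'⟩
        · have := h'.ne_zero ⟨h0, hαβ.trans_le (hsub' hmemβ).2⟩
          exact ⟨this.1, this.2.1⟩
      exact mul_ne_zero (mul_ne_zero r'.1 r'.2) (mul_ne_zero r.1 r.2)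
    have h3 : P α * Q α * (R' α * S' α) = 0 := by
      rcases max_choice a a' with h0 | h0
      · rw [← hα] at h0
        rw [h0, hPQa, zero_mul]
      · rw [← hα] at h0
        rw [h0, hRSa', mul_zero]
    have := lt_of_le_of_ne h1 h2
    simp only [hF, h3]
    linarith
  -- At the right end the roles are exchanged: `RS` or `P'Q'` vanishes.
  have hFβ : F β < 0 := by
    have h1 : P β * Q β * (R' β * S' β) ≤ 0 := le_of_tendsto
      (((tendsto_right hαβ cP).mul (tendsto_right hαβ cQ)).mul
        ((tendsto_right hαβ cR').mul (tendsto_right hαβ cS')))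
      (by
        filter_upwards [Ioo_mem_nhdsLT hαβ] with x hx
        exact (sgn x hx).2.le)
    have h2 : P β * Q β * (R' β * S' β) ≠ 0 := by
      have r : P β ≠ 0 ∧ Q β ≠ 0 := by
        rcases eq_or_lt_of_le (hsub hmemβ).2 with h0 | h0
        · rw [h0]
          exact ⟨hPb, hQb⟩
        · have := h.ne_zero ⟨(hsub hmemα).1.trans_lt hαβ, h0⟩
          exact ⟨this.1, this.2.1⟩
      have r' : R' β ≠ 0 ∧ S' β ≠ 0 := by
        rcases eq_or_lt_of_le (hsub' hmemβ).2 with h0 | h0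
        · rw [h0]
          exact ⟨hRb', hSb'⟩
        · exact (h'.ne_zero ⟨(hsub' hmemα).1.trans_lt hαβ, h0⟩).2.2
      exact mul_ne_zero (mul_ne_zero r.1 r.2) (mul_ne_zero r'.1 r'.2)
    have h3 : P' β * Q' β * (R β * S β) = 0 := by
      rcases min_choice b b' with h0 | h0
      · rw [← hβ] at h0
        rw [h0, hRSb, mul_zero]
      · rw [← hβ] at h0
        rw [h0, hPQb', zero_mul]
    have := lt_of_le_of_ne h1 h2
    simp only [hF, h3]
    linarith
  rw [hIoo]
  obtain ⟨x, hx, hx0⟩ := intermediate_value_Ioo' hαβ.le cF ⟨hFβ, hFα⟩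
  refine ⟨x, ⟨hx, by simp only [hF] at hx0; linarith⟩, ?_⟩
  rintro y ⟨hy, hy0⟩
  have hx0' : P x * Q x * (R' x * S' x) = P' x * Q' x * (R x * S x) := by
    simp only [hF] at hx0
    linarith
  have m1 := h.strictMonoOn_of_isPositive hp
  have m2 := g.strictMonoOn_of_isPositive hp'
  -- Uniqueness: a match makes the product of two positive strictly increasing functions equal to
  -- one.
  have key : ∀ z ∈ Ioo α β, P z * Q z * (R' z * S' z) = P' z * Q' z * (R z * S z) →
      P z * Q z / (R z * S z) * (R' z * S' z / (-P' z * -Q' z)) = 1 ∧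
        0 < P z * Q z / (R z * S z) ∧ 0 < R' z * S' z / (-P' z * -Q' z) := by
    intro z hz hz0
    rw [← hIoo] at hz
    obtain ⟨p1, p2, p3, p4⟩ := h.ne_zero hz.1
    obtain ⟨q1, q2, q3, q4⟩ := h'.ne_zero hz.2
    refine ⟨?_, ?_, ?_⟩
    · rw [neg_mul_neg, div_mul_div_comm, div_eq_one_iff_eq (by positivity), hz0]
      ring
    · have : 0 < (P z * Q z) * (R z * S z) := by linarith [h.pos z hz.1]
      exact div_pos_iff.mpr (mul_pos_iff.mp this)
    · have : 0 < (R' z * S' z) * (-P' z * -Q' z) := by linarith [h'.pos z hz.2]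
      exact div_pos_iff.mpr (mul_pos_iff.mp this)
  obtain ⟨kx, kx1, kx2⟩ := key x hx hx0'
  obtain ⟨ky, ky1, ky2⟩ := key y hy hy0
  have aux : ∀ {s t : ℝ}, s ∈ Ioo α β → t ∈ Ioo α β → s < t →
      P s * Q s / (R s * S s) < P t * Q t / (R t * S t) ∧
      R' s * S' s / (-P' s * -Q' s) < R' t * S' t / (-P' t * -Q' t) := by
    intro s t hs ht hst
    rw [← hIoo] at hs ht
    exact ⟨m1 hs.1 ht.1 hst, m2 hs.2 ht.2 hst⟩
  rcases lt_trichotomy y x with hlt | heq | hlt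
  · obtain ⟨l1, l2⟩ := aux hy hx hlt
    have := mul_lt_mul'' l1 l2 ky1.le ky2.le
    linarith
  · exact heq
  · obtain ⟨l1, l2⟩ := aux hx hy hlt
    have := mul_lt_mul'' l1 l2 kx1.le kx2.le
    linarith

end GapData

/-! ### From a material with a band gap to gap data -/

theorem IsMirrorMaterialOn.profile {ε : ℝ → ℝ → ℝ} {I : Set ℝ} (h : IsMirrorMaterialOn ε I) {ω : ℝ}
    (hω : ω ∈ I) : IsMirrorProfile (fun x => ε x ω) :=
  ⟨h.locallyIntegrable ω hω, h.periodic ω hω, h.mirror ω hω⟩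

/-- Here `(uv)' = e v² - m u² ≤ -m u²`. Applied to both columns of the transfer matrix it shows that
a nonpositive nontrivial profile has no positive spectrum. -/
theorem RealSolution.mul_neg_of_nonpos {e : ℝ → ℝ} {m : ℝ} {u v : ℝ → ℝ} (hm : 0 < m)
    (he : LocallyIntegrable e) (he0 : ∀ᵐ x, e x ≤ 0) (h : RealSolution e m u v) {c d : ℝ}
    (hcd : c < d) (h0 : u c * v c = 0) (hu : ∃ t ∈ Icc c d, u t ≠ 0) : u d * v d < 0 := by
  obtain ⟨t, ht, hut⟩ := hu
  have cu := h.continuous_field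
  have cv := h.continuous_flux
  have key := RealSolution.mul_flux_sub he h h c d
  rw [h0, sub_zero] at key
  have i1 : IntervalIntegrable (fun t => e t * (v t * v t) - m * (u t * u t)) volume c d :=
    ((he.mul_continuous (cv.mul cv)).intervalIntegrable' _ _).sub
      (((cu.mul cu).intervalIntegrable _ _).const_mul _)
  have i2 : IntervalIntegrable (fun t => -m * (u t * u t)) volume c d :=
    ((cu.mul cu).intervalIntegrable _ _).const_mul _
  have h1 : u d * v d ≤ ∫ t in c..d, -m * (u t * u t) := by
    rw [key]
    refine intervalIntegral.integral_mono_ae hcd.le i1 i2 ?_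
    filter_upwards [he0] with t ht
    nlinarith [mul_self_nonneg (v t)]
  have h2 : 0 < ∫ t in c..d, u t * u t := intervalIntegral.integral_pos hcd
    (cu.mul cu).continuousOn (fun x _ => mul_self_nonneg _) ⟨t, ht, mul_self_pos.mpr hut⟩
  rw [intervalIntegral.integral_const_mul] at h1
  nlinarith

namespace IsMirrorProfile

variable {e : ℝ → ℝ} {μ₀ lam m : ℝ}

theorem cell_pos_of_nonpos (he : IsMirrorProfile e) (hn : NontrivialProfile e) (hm : 0 < m)
    (he0 : ∀ᵐ x, e x ≤ 0) : 0 < cellP e m * cellQ e m * cellR e m * cellS e m := by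
  obtain ⟨h₁, a₁, b₁⟩ := cellSolution_spec he.locallyIntegrable m 1 0
  obtain ⟨h₂, a₂, b₂⟩ := cellSolution_spec he.locallyIntegrable m 0 1
  have k₁ : cellP e m * cellR e m < 0 := RealSolution.mul_neg_of_nonpos hm he.locallyIntegrable he0
    h₁ (c := 1 / 2) (by norm_num) (by rw [b₁, mul_zero])
    ⟨1 / 2, by norm_num, by rw [a₁]; exact one_ne_zero⟩
  have k₂ : cellQ e m * cellS e m < 0 := RealSolution.mul_neg_of_nonpos hm he.locallyIntegrable he0
    h₂ (c := 1 / 2) (by norm_num) (by rw [a₂, zero_mul]) (hn.exists_cellSolution_ne_zero he m)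
  linarith [mul_pos_of_neg_of_neg k₁ k₂]

theorem cell_nonpos_iff (he : IsMirrorProfile e) (hn : NontrivialProfile e) :
    (∃ κ ∈ Icc (-Real.pi) Real.pi, IsBlochEigenvalue e μ₀ κ lam) ↔
      cellP e (μ₀ * lam) * cellQ e (μ₀ * lam) * cellR e (μ₀ * lam) * cellS e (μ₀ * lam) ≤ 0 := by
  have hA := cellA_sq_sub_one he.locallyIntegrable (μ₀ * lam)
  constructor
  · rintro ⟨κ, -, h⟩
    rw [he.isBlochEigenvalue_iff hn] at h
    rw [h] at hA
    nlinarith [Real.cos_sq_le_one κ]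
  · intro h
    have h1 : cellA e (μ₀ * lam) ^ 2 ≤ 1 := by linarith
    have h2 := abs_le.mp ((sq_le_one_iff_abs_le_one _).mp h1)
    refine ⟨Real.arccos (cellA e (μ₀ * lam)),
      ⟨by linarith [Real.arccos_nonneg (cellA e (μ₀ * lam)), Real.pi_pos], Real.arccos_le_pi _⟩, ?_⟩
    rw [he.isBlochEigenvalue_iff hn, Real.cos_arccos h2.1 h2.2]

end IsMirrorProfile

section Material

variable {ε : ℝ → ℝ → ℝ} {μ₀ a b ω : ℝ} {n : ℕ}

theorem nontrivialProfile_of_inBlochSpectrum (hμ₀ : 0 < μ₀) (hω : 0 < ω)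
    (he : IsMirrorProfile fun x => ε x ω) (h : InBlochSpectrum ε μ₀ ω) :
    NontrivialProfile fun x => ε x ω := by
  obtain ⟨κ, -, u, v, h⟩ := h
  exact he.nontrivialProfile_of_isBlochMode (by positivity) h

/-- If the profile vanished at some `ω` in the gap, monotonicity would make it nonpositive at `a`.
Then `PQRS > 0` at `a`, although `a` lies in the spectrum. -/
theorem nontrivialProfile_of_isBandGap (hμ₀ : 0 < μ₀) (hM : IsMirrorMaterialOn ε (Icc a b))
    (hgap : IsBandGap ε μ₀ n a b) (hω : ω ∈ Icc a b) : NontrivialProfile fun x => ε x ω := by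
  have ha : a ∈ Icc a b := left_mem_Icc.mpr hgap.lt.le
  have hna := nontrivialProfile_of_inBlochSpectrum hμ₀ hgap.pos (hM.profile ha) hgap.left_edge
  by_contra hn
  have h0 := ae_eq_zero_of_not_nontrivialProfile (hM.locallyIntegrable ω hω) hn
  have h1 : ∀ᵐ x, ε x a ≤ 0 := by
    filter_upwards [h0] with x hx
    exact (hM.monotoneOn x ha hω hω.1).trans hx.le
  have h2 := (hM.profile ha).cell_pos_of_nonpos hna (m := μ₀ * a ^ 2)
    (by have := hgap.pos; positivity) h1
  have h3 := ((hM.profile ha).cell_nonpos_iff hna).mp hgap.left_edge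
  linarith

/-- Pointwise continuity in `ω` becomes `L¹` continuity by dominated convergence; monotonicity
supplies the dominating function `ε t b - ε t a`. -/
theorem isMonotoneFamily_of_isBandGap (hμ₀ : 0 < μ₀) (hM : IsMirrorMaterialOn ε (Icc a b))
    (hgap : IsBandGap ε μ₀ n a b) :
    IsMonotoneFamily (fun ω x => ε x ω) (fun ω => μ₀ * ω ^ 2) (Icc a b) where
  profile ω hω := hM.profile hω
  nontrivial ω hω := nontrivialProfile_of_isBandGap hμ₀ hM hgap hω
  tendsto ω hω := by
    have ha : a ∈ Icc a b := left_mem_Icc.mpr hgap.lt.le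
    have hb : b ∈ Icc a b := right_mem_Icc.mpr hgap.lt.le
    have hd : ∀ y ∈ Icc a b, LocallyIntegrable (fun t => ε t y - ε t ω) := fun y hy =>
      (hM.locallyIntegrable y hy).sub (hM.locallyIntegrable ω hω)
    have hb' : LocallyIntegrable (fun t => ε t b - ε t a) :=
      (hM.locallyIntegrable b hb).sub (hM.locallyIntegrable a ha)
    have := intervalIntegral.tendsto_integral_filter_of_dominated_convergence (μ := volume)
      (a := 0) (b := 1) (l := 𝓝[Icc a b] ω) (F := fun y t => |ε t y - ε t ω|) (f := fun _ => (0 : ℝ))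
      (fun t => ε t b - ε t a)
      (by
        filter_upwards [self_mem_nhdsWithin] with y hy
        exact (hd y hy).aestronglyMeasurable.norm.restrict)
      (by
        filter_upwards [self_mem_nhdsWithin] with y hy
        refine Eventually.of_forall fun t _ => ?_
        rw [Real.norm_eq_abs, abs_abs, abs_le]
        have := hM.monotoneOn t ha hy hy.1
        have := hM.monotoneOn t hy hb hy.2
        have := hM.monotoneOn t ha hω hω.1
        have := hM.monotoneOn t hω hb hω.2
        constructor <;> linarith)
      (hb'.intervalIntegrable' 0 1)
      (Eventually.of_forall fun t _ => by
        have h1 := ((hM.continuousOn t ω hω).tendsto.sub_const (ε t ω)).abs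
        rwa [sub_self, abs_zero] at h1)
    simpa using this
  continuousOn := by fun_prop
  monotone x hx y hy hxy t := hM.monotoneOn t hx hy hxy
  strictMonoOn x hx y hy hxy := by
    have h1 : 0 < x := hgap.pos.trans_le hx.1
    have : x ^ 2 < y ^ 2 := by gcongr
    exact (mul_lt_mul_iff_right₀ hμ₀).mpr this

/-- Since `A = 2PS - 1` and `|A| > 1`, the product `PS` has the sign of `A`. -/
theorem InGap.cell_pos (hμ₀ : 0 < μ₀) (hω : 0 < ω) (he : IsMirrorProfile fun x => ε x ω)
    (hn : NontrivialProfile fun x => ε x ω) (h : InGap ε μ₀ n ω) :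
    0 < cellP (fun x => ε x ω) (μ₀ * ω ^ 2) * cellQ (fun x => ε x ω) (μ₀ * ω ^ 2) *
        cellR (fun x => ε x ω) (μ₀ * ω ^ 2) * cellS (fun x => ε x ω) (μ₀ * ω ^ 2) ∧
      0 < (-1) ^ n * (cellP (fun x => ε x ω) (μ₀ * ω ^ 2) *
        cellS (fun x => ε x ω) (μ₀ * ω ^ 2)) := by
  have h1 : 0 < cellP (fun x => ε x ω) (μ₀ * ω ^ 2) * cellQ (fun x => ε x ω) (μ₀ * ω ^ 2) *
        cellR (fun x => ε x ω) (μ₀ * ω ^ 2) * cellS (fun x => ε x ω) (μ₀ * ω ^ 2) := by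
    by_contra hcon
    exact h.1 ((he.cell_nonpos_iff hn).mpr (not_lt.mp hcon))
  refine ⟨h1, ?_⟩
  have hA := cellA_sq_sub_one he.locallyIntegrable (μ₀ * ω ^ 2)
  have hdet := cell_det he.locallyIntegrable (μ₀ * ω ^ 2)
  have hA0 : cellA (fun x => ε x ω) (μ₀ * ω ^ 2) ≠ 0 := by
    intro h0
    rw [h0] at hA
    linarith
  have h2 := neg_one_pow_mul_cellA_pos hμ₀ (by positivity) he hn
    (h.2 (Real.pi / 2) ⟨by linarith [Real.pi_pos], by linarith [Real.pi_pos]⟩) hA0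
  have hA' : cellA (fun x => ε x ω) (μ₀ * ω ^ 2) = 2 * (cellP (fun x => ε x ω) (μ₀ * ω ^ 2) *
        cellS (fun x => ε x ω) (μ₀ * ω ^ 2)) - 1 := by
    rw [cellA]
    linarith
  rcases neg_one_pow_eq_or ℝ n with hs | hs
  · rw [hs] at h2 ⊢
    nlinarith
  · rw [hs] at h2 ⊢
    nlinarith

theorem gapData_of_isBandGap (hμ₀ : 0 < μ₀) (hM : IsMirrorMaterialOn ε (Icc a b))
    (hgap : IsBandGap ε μ₀ n a b) :
    GapData (fun ω => cellP (fun x => ε x ω) (μ₀ * ω ^ 2))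
      (fun ω => cellQ (fun x => ε x ω) (μ₀ * ω ^ 2))
      (fun ω => cellR (fun x => ε x ω) (μ₀ * ω ^ 2))
      (fun ω => cellS (fun x => ε x ω) (μ₀ * ω ^ 2)) ((-1) ^ n) a b := by
  have hfam := isMonotoneFamily_of_isBandGap hμ₀ hM hgap
  have hnt := fun ω hω => nontrivialProfile_of_isBandGap (ω := ω) hμ₀ hM hgap hω
  have ha : a ∈ Icc a b := left_mem_Icc.mpr hgap.lt.le
  have hb : b ∈ Icc a b := right_mem_Icc.mpr hgap.lt.le
  have hpos := fun ω (hω : ω ∈ Ioo a b) => (hgap.interior ω hω).cell_pos hμ₀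
    (hgap.pos.trans hω.1) (hM.profile (Ioo_subset_Icc_self hω)) (hnt ω (Ioo_subset_Icc_self hω))
  have cP := hfam.continuousOn_cellP
  have cQ := hfam.continuousOn_cellQ
  have cR := hfam.continuousOn_cellR
  have cS := hfam.continuousOn_cellS
  have cAll : ContinuousOn (fun ω => cellP (fun x => ε x ω) (μ₀ * ω ^ 2) *
      cellQ (fun x => ε x ω) (μ₀ * ω ^ 2) * cellR (fun x => ε x ω) (μ₀ * ω ^ 2) *
      cellS (fun x => ε x ω) (μ₀ * ω ^ 2)) (Icc a b) := ((cP.mul cQ).mul cR).mul cS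
  have tl := GapData.tendsto_left hgap.lt cAll
  have tr := GapData.tendsto_right hgap.lt cAll
  exact {
    lt := hgap.lt
    continuousOn_P := cP
    continuousOn_Q := cQ
    continuousOn_R := cR
    continuousOn_S := cS
    det := fun ω hω => cell_det (hM.locallyIntegrable ω hω) _
    sign_sq := by rw [← pow_mul, mul_comm, pow_mul, neg_one_sq, one_pow]
    pos := fun ω hω => (hpos ω hω).1
    sign_pos := fun ω hω => (hpos ω hω).2
    left := by
      refine le_antisymm (((hM.profile ha).cell_nonpos_iff (hnt a ha)).mp hgap.left_edge) ?_
      refine ge_of_tendsto tl ?_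
      filter_upwards [Ioo_mem_nhdsGT hgap.lt] with ω hω
      exact (hpos ω hω).1.le
    right := by
      refine le_antisymm (((hM.profile hb).cell_nonpos_iff (hnt b hb)).mp hgap.right_edge) ?_
      refine ge_of_tendsto tr ?_
      filter_upwards [Ioo_mem_nhdsLT hgap.lt] with ω hω
      exact (hpos ω hω).1.le
    anti := hfam.strictAntiOn_cellR_div_cellP ordConnected_Ioo Ioo_subset_Icc_self
      fun ω hω h0 => by
        have := (hpos ω hω).1
        simp [h0] at this
    mono := hfam.strictMonoOn_cellQ_div_cellS ordConnected_Ioo Ioo_subset_Icc_self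
      fun ω hω h0 => by
        have := (hpos ω hω).1
        simp [h0] at this }

/-- `PQRS = 0` at the lower edge, so `PR ≠ 0` forces `QS = 0` and an antisymmetric mode; the filler
value never occurs. -/
theorem bulkIndex_eq (hμ₀ : 0 < μ₀) (hM : IsMirrorMaterialOn ε (Icc a b))
    (hgap : IsBandGap ε μ₀ n a b) :
    bulkIndex ε μ₀ a = if cellP (fun x => ε x a) (μ₀ * a ^ 2) *
      cellR (fun x => ε x a) (μ₀ * a ^ 2) = 0 then 1 else -1 := by
  have ha : a ∈ Icc a b := left_mem_Icc.mpr hgap.lt.le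
  have hn := nontrivialProfile_of_isBandGap hμ₀ hM hgap ha
  have hs : HasSymmetricMode ε μ₀ a ↔ _ :=
    (hM.profile ha).exists_symmetric_mode_iff hn (μ₀ := μ₀) (lam := a ^ 2)
  by_cases h : cellP (fun x => ε x a) (μ₀ * a ^ 2) * cellR (fun x => ε x a) (μ₀ * a ^ 2) = 0
  · rw [bulkIndex, if_pos (hs.mpr h), if_pos h]
  · have h0 := (gapData_of_isBandGap hμ₀ hM hgap).left
    have hQS : cellQ (fun x => ε x a) (μ₀ * a ^ 2) * cellS (fun x => ε x a) (μ₀ * a ^ 2) = 0 := by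
      refine (mul_eq_zero.mp ?_).resolve_left h
      linarith
    have hanti : HasAntisymmetricMode ε μ₀ a :=
      (hM.profile ha).exists_antisymmetric_mode hn hQS
    rw [bulkIndex, if_neg (fun h' => h (hs.mp h')), if_pos hanti, if_neg h]

end Material

/-! ### Decay at infinity inside a gap and at its edges -/

theorem tendsto_atTop_of_quasiperiodic {u : ℝ → ℂ} (hu : Continuous u) {ρ : ℂ} (hρ : ‖ρ‖ < 1)
    (h : ∀ x, u (x + 1) = ρ * u x) : Tendsto u atTop (𝓝 0) := by
  obtain ⟨C, hC⟩ := isCompact_Icc.exists_bound_of_continuousOn (hu.continuousOn (s := Icc 0 1))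
  have hn : ∀ (n : ℕ) (x : ℝ), u (x + n) = ρ ^ n * u x := by
    intro n
    induction n with
    | zero => simp
    | succ n ih =>
      intro x
      rw [Nat.cast_succ, ← add_assoc, h, ih, pow_succ']
      ring
  have hlim : Tendsto (fun x : ℝ => ‖ρ‖ ^ ⌊x⌋₊ * C) atTop (𝓝 0) := by
    simpa using ((tendsto_pow_atTop_nhds_zero_of_lt_one (norm_nonneg ρ) hρ).comp
      (tendsto_nat_floor_atTop (α := ℝ))).mul_const C
  refine squeeze_zero_norm' ?_ hlim
  filter_upwards [eventually_ge_atTop 0] with x hx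
  have h1 := hn ⌊x⌋₊ (x - ⌊x⌋₊)
  rw [sub_add_cancel] at h1
  rw [h1, norm_mul, norm_pow]
  gcongr
  exact hC _ ⟨by linarith [Nat.floor_le hx], by linarith [Nat.lt_floor_add_one x]⟩

namespace IsMirrorProfile

variable {e : ℝ → ℝ} {μ₀ lam τ : ℝ} {u v : ℝ → ℂ}

theorem one_lt_sign_mul_cellA (he : IsMirrorProfile e) {m : ℝ}
    (hpos : 0 < cellP e m * cellQ e m * cellR e m * cellS e m) (hτ : τ ^ 2 = 1)
    (hs : 0 < τ * (cellP e m * cellS e m)) : 1 < τ * cellA e m := by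
  have hd := cell_det he.locallyIntegrable m
  have h1 : 0 < τ * (cellQ e m * cellR e m) := by
    refine pos_of_mul_pos_right (b := τ * (cellQ e m * cellR e m)) ?_ hs.le
    calc 0 < τ ^ 2 * (cellP e m * cellQ e m * cellR e m * cellS e m) := by rw [hτ, one_mul]; exact hpos
      _ = _ := by ring
  rw [cellA]
  rcases sq_eq_one_iff.mp hτ with rfl | rfl <;> linarith

/-- In a gap, a solution decays at `+∞` precisely if its state at `0` lies on the stable line of the
monodromy matrix. -/
theorem tendsto_atTop_iff (he : IsMirrorProfile e) (h : IsSolution e μ₀ lam u v)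
    (hpos : 0 < cellP e (μ₀ * lam) * cellQ e (μ₀ * lam) * cellR e (μ₀ * lam) * cellS e (μ₀ * lam))
    (hτ : τ ^ 2 = 1) (hs : 0 < τ * (cellP e (μ₀ * lam) * cellS e (μ₀ * lam))) :
    Tendsto u atTop (𝓝 0) ↔
      (τ * √(cellP e (μ₀ * lam) * cellQ e (μ₀ * lam) * cellR e (μ₀ * lam) * cellS e (μ₀ * lam)) : ℂ)
        * u 0 + (cellP e (μ₀ * lam) * cellQ e (μ₀ * lam) : ℂ) * v 0 = 0 := by
  have hA1 := he.one_lt_sign_mul_cellA hpos hτ hs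
  have hAsq := cellA_sq_sub_one he.locallyIntegrable (μ₀ * lam)
  have hstate := he.state_add_one h
  have hBC : cellP e (μ₀ * lam) * cellQ e (μ₀ * lam) * cellR e (μ₀ * lam) * cellS e (μ₀ * lam) =
    (cellP e (μ₀ * lam) * cellQ e (μ₀ * lam)) * (cellR e (μ₀ * lam) * cellS e (μ₀ * lam)) := by ring
  rw [hBC] at hpos hAsq ⊢
  simp only [← Complex.ofReal_mul] at hstate ⊢
  generalize cellP e (μ₀ * lam) * cellQ e (μ₀ * lam) = B at *
  generalize cellR e (μ₀ * lam) * cellS e (μ₀ * lam) = C at *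
  generalize cellA e (μ₀ * lam) = A at *
  have hD := Real.sqrt_pos.mpr hpos
  have hDsq := Real.sq_sqrt hpos.le
  generalize √(B * C) = D at *
  have hB : (B : ℂ) ≠ 0 := by exact_mod_cast left_ne_zero_of_mul hpos.ne'
  have hτ' : (τ : ℂ) ^ 2 = 1 := by exact_mod_cast hτ
  have hDsq' : (D : ℂ) ^ 2 = B * C := by exact_mod_cast hDsq
  have hAsq' : (A : ℂ) ^ 2 - 1 = 4 * (B * C) := by exact_mod_cast hAsq
  have hK : 1 < |A + 2 * (τ * D)| := by
    have h1 : |τ| = 1 := by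
      rcases sq_eq_one_iff.mp hτ with rfl | rfl <;> simp
    rw [← one_mul |A + 2 * (τ * D)|, ← h1, ← abs_mul]
    refine lt_of_lt_of_le ?_ (le_abs_self _)
    rw [h1]
    nlinarith
  constructor
  · intro hlim
    have hn : Tendsto (fun n : ℕ => u n) atTop (𝓝 0) := hlim.comp tendsto_natCast_atTop_atTop
    have hn1 : Tendsto (fun n : ℕ => u (n + 1)) atTop (𝓝 0) := by
      simpa using (tendsto_add_atTop_iff_nat 1).mpr hn
    -- Only the field is assumed to decay. As `B ≠ 0`, the flux at integers is a combination of two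
    -- consecutive field values.
    have hv : Tendsto (fun n : ℕ => v n) atTop (𝓝 0) := by
      have h1 := (hn1.sub (hn.const_mul (A : ℂ))).div_const (2 * (B : ℂ))
      simp only [mul_zero, sub_zero, zero_div] at h1
      refine h1.congr fun n => ?_
      rw [(hstate n).1]
      field_simp
      ring
    have hl : Tendsto (fun n : ℕ => ‖((τ * D : ℝ) : ℂ) * u n + B * v n‖) atTop (𝓝 0) := by
      simpa using ((hn.const_mul ((τ * D : ℝ) : ℂ)).add (hv.const_mul (B : ℂ))).norm
    -- `(τD, B)` is a left eigenvector of the monodromy matrix for the eigenvalue `A + 2τD` of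
    -- modulus above one, so this functional cannot decay unless it is zero.
    have hstep : ∀ n : ℕ, ‖((τ * D : ℝ) : ℂ) * u 0 + B * v 0‖ ≤
        ‖((τ * D : ℝ) : ℂ) * u n + B * v n‖ := by
      intro n
      induction n with
      | zero => simp
      | succ n ih =>
        refine ih.trans ?_
        have h1 : ((τ * D : ℝ) : ℂ) * u (n + 1) + B * v (n + 1) =
            ((A + 2 * (τ * D) : ℝ) : ℂ) * (((τ * D : ℝ) : ℂ) * u n + B * v n) := by
          rw [(hstate n).1, (hstate n).2]
          push_cast
          linear_combination (-2 * D ^ 2 * u n) * hτ' - 2 * u n * hDsq'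
        rw [Nat.cast_succ, h1, norm_mul, Complex.norm_real, Real.norm_eq_abs]
        exact le_mul_of_one_le_left (norm_nonneg _) hK.le
    exact norm_le_zero_iff.mp (ge_of_tendsto hl (Eventually.of_forall hstep))
  · intro h0
    have hs0 := hstate 0
    simp only [Nat.cast_zero, zero_add] at hs0
    push_cast at h0
    -- The two monodromy eigenvalues `A ± 2τD` have product one.
    have hρ : ‖((A - 2 * (τ * D) : ℝ) : ℂ)‖ < 1 := by
      rw [Complex.norm_real, Real.norm_eq_abs]
      have h1 : |A - 2 * (τ * D)| * |A + 2 * (τ * D)| = 1 := by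
        have h2 : (A - 2 * (τ * D)) * (A + 2 * (τ * D)) = 1 := by
          linear_combination hAsq - 4 * D ^ 2 * hτ - 4 * hDsq
        rw [← abs_mul, h2, abs_one]
      by_contra hcon
      nlinarith [not_lt.mp hcon]
    refine tendsto_atTop_of_quasiperiodic h.continuous_field hρ
      fun x => (he.quasiperiodic h ?_ ?_ x).1
    · rw [hs0.1]
      push_cast
      linear_combination 2 * h0
    · rw [hs0.2]
      apply mul_left_cancel₀ hB
      push_cast
      linear_combination 2 * (τ : ℂ) * D * h0 - 2 * D ^ 2 * u 0 * hτ' - 2 * u 0 * hDsq'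

/-- At an edge of a gap, no non-zero solution decays. -/
theorem state_eq_zero_of_tendsto_atTop (he : IsMirrorProfile e) (hn : NontrivialProfile e)
    (h : IsSolution e μ₀ lam u v)
    (h0 : cellP e (μ₀ * lam) * cellQ e (μ₀ * lam) * cellR e (μ₀ * lam) * cellS e (μ₀ * lam) = 0)
    (hlim : Tendsto u atTop (𝓝 0)) : u 0 = 0 ∧ v 0 = 0 := by
  have hAsq := cellA_sq_sub_one he.locallyIntegrable (μ₀ * lam)
  have hstate := he.state_add_one h
  have hBC : cellP e (μ₀ * lam) * cellQ e (μ₀ * lam) * cellR e (μ₀ * lam) * cellS e (μ₀ * lam) =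
    (cellP e (μ₀ * lam) * cellQ e (μ₀ * lam)) * (cellR e (μ₀ * lam) * cellS e (μ₀ * lam)) := by ring
  rw [h0, mul_zero] at hAsq
  rw [hBC] at h0
  simp only [← Complex.ofReal_mul] at hstate
  generalize cellP e (μ₀ * lam) * cellQ e (μ₀ * lam) = B at *
  generalize cellR e (μ₀ * lam) * cellS e (μ₀ * lam) = C at *
  generalize cellA e (μ₀ * lam) = A at *
  have hA : ‖(A : ℂ)‖ = 1 := by
    rw [Complex.norm_real, Real.norm_eq_abs]
    have h1 : A ^ 2 = 1 := by linarith
    rcases sq_eq_one_iff.mp h1 with rfl | rfl <;> simp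
  have hu : Tendsto (fun n : ℕ => u n) atTop (𝓝 0) := hlim.comp tendsto_natCast_atTop_atTop
  have hu1 : Tendsto (fun n : ℕ => u (n + 1)) atTop (𝓝 0) := by
    simpa using (tendsto_add_atTop_iff_nat 1).mpr hu
  have conclude : ∀ {f : ℝ → ℂ}, Tendsto (fun n : ℕ => f n) atTop (𝓝 0) →
      (∀ n : ℕ, f (n + 1) = A * f n) → f 0 = 0 := by
    intro f hf hrec
    have h1 : ∀ n : ℕ, ‖f 0‖ = ‖f n‖ := by
      intro n
      induction n with
      | zero => simp
      | succ n ih => rw [Nat.cast_succ, hrec, norm_mul, hA, one_mul, ih]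
    have h2 := hf.norm.congr fun n => (h1 n).symm
    rw [norm_zero] at h2
    exact norm_eq_zero.mp (tendsto_nhds_unique tendsto_const_nhds h2)
  -- The monodromy matrix is triangular with diagonal entries `±1`. If `B = 0` the field at integers
  -- has constant modulus, so `u 0 = 0`; but `u` is then quasiperiodic with a unimodular multiplier,
  -- hence zero everywhere. If `C = 0` the same reasoning first gives `v 0 = 0`, then `u 0 = 0`.
  by_cases hB : B = 0
  · have hu0 : u 0 = 0 := conclude hu fun n => by rw [(hstate n).1, hB]; simp
    refine ⟨hu0, ?_⟩
    have hs0 := hstate 0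
    simp only [Nat.cast_zero, zero_add, hu0] at hs0
    have hq := fun x => (he.quasiperiodic h (ρ := A) (by rw [hs0.1, hB, hu0]; simp)
      (by rw [hs0.2]; simp) x).1
    have hzero : u = 0 := by
      funext x
      have h1 : ∀ n : ℕ, ‖u x‖ = ‖u (x + n)‖ := by
        intro n
        induction n with
        | zero => simp
        | succ n ih => rw [Nat.cast_succ, ← add_assoc, hq, norm_mul, hA, one_mul, ih]
      have h2 := ((hlim.comp (tendsto_atTop_add_const_left _ x
        tendsto_natCast_atTop_atTop)).norm).congr fun n => (h1 n).symm
      rw [norm_zero] at h2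
      exact norm_eq_zero.mp (tendsto_nhds_unique tendsto_const_nhds h2)
    exact hn.flux_eq_zero h hzero 0
  · have hC : C = 0 := (mul_eq_zero.mp h0).resolve_left hB
    have hB' : (B : ℂ) ≠ 0 := by exact_mod_cast hB
    have hv : Tendsto (fun n : ℕ => v n) atTop (𝓝 0) := by
      have h1 := (hu1.sub (hu.const_mul (A : ℂ))).div_const (2 * (B : ℂ))
      simp only [mul_zero, sub_zero, zero_div] at h1
      refine h1.congr fun n => ?_
      rw [(hstate n).1]
      field_simp
      ring
    have hv0 : v 0 = 0 := conclude hv fun n => by rw [(hstate n).2, hC]; simp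
    refine ⟨?_, hv0⟩
    have hs0 := hstate 0
    simp only [Nat.cast_zero, zero_add, hv0] at hs0
    have hq := fun x => (he.quasiperiodic h (ρ := A) (by rw [hs0.1]; simp)
      (by rw [hs0.2, hC, hv0]; simp) x).1
    exact conclude hu fun n => hq n

end IsMirrorProfile

/-! ### Bulk indices and the intersection of the decaying lines -/

/-- Multiply by the conjugate expression, which is nonzero because `b` and `b'` have opposite signs.
-/
theorem sqrt_mul_add_sqrt_mul_eq_zero_iff {b c b' c' : ℝ} (h : 0 < b * c) (h' : 0 < b' * c')
    (hb : b * b' < 0) : √(b' * c') * b + √(b * c) * b' = 0 ↔ b * c' = b' * c := by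
  have hb0 : b ≠ 0 := left_ne_zero_of_mul hb.ne
  have hb0' : b' ≠ 0 := right_ne_zero_of_mul hb.ne
  have s := Real.sq_sqrt h.le
  have s' := Real.sq_sqrt h'.le
  have p := Real.sqrt_pos.mpr h
  have p' := Real.sqrt_pos.mpr h'
  generalize √(b * c) = d at *
  generalize √(b' * c') = d' at *
  have key : (d' * b + d * b') * (d' * b - d * b') = b * b' * (b * c' - b' * c) := by
    linear_combination b ^ 2 * s' - b' ^ 2 * s
  have hne : d' * b - d * b' ≠ 0 := by
    intro h0
    have h1 : d' * b ^ 2 = d * (b * b') := by linear_combination b * h0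
    have h2 : 0 < d' * b ^ 2 := by positivity
    nlinarith
  constructor
  · intro h0
    rw [h0, zero_mul] at key
    exact sub_eq_zero.mp ((mul_eq_zero.mp key.symm).resolve_left hb.ne)
  · intro h0
    rw [sub_eq_zero.mpr h0, mul_zero] at key
    exact (mul_eq_zero.mp key).resolve_right hne

theorem add_ne_zero_of_mul_pos {x y : ℝ} (h : 0 < x * y) : x + y ≠ 0 := by
  intro h0
  rw [eq_neg_of_add_eq_zero_left h0] at h
  nlinarith [sq_nonneg y]

namespace GapData

variable {P Q R S P' Q' R' S' : ℝ → ℝ} {τ a b a' b' : ℝ}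

/-- For a given `τ`, type and index determine each other. Since both materials share `n`, hence `τ`,
opposite indices mean opposite types. -/
theorem index_cases (h : GapData P Q R S τ a b) {J : ℤ}
    (hJ : J = if P a * R a = 0 then 1 else -1) :
    (IsPositive P Q R S a b ∧ (J : ℝ) = -τ) ∨
      (IsPositive R S (fun x => -P x) (fun x => -Q x) a b ∧ (J : ℝ) = τ) := by
  rcases h.isPositive_or_rotate with hp | hp
  · refine Or.inl ⟨hp, ?_⟩
    rcases h.index_of_isPositive hp with ⟨h1, h2⟩ | ⟨h1, h2⟩
    · rw [hJ, if_pos h1, h2]; simp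
    · rw [hJ, if_neg h1, h2]; simp
  · refine Or.inr ⟨hp, ?_⟩
    have hiff : R a * -P a = 0 ↔ P a * R a = 0 := by
      rw [mul_neg, neg_eq_zero, mul_comm]
    rcases h.rotate.index_of_isPositive hp with ⟨h1, h2⟩ | ⟨h1, h2⟩
    · rw [hJ, if_pos (hiff.mp h1)]; push_cast; linarith
    · rw [hJ, if_neg (fun h3 => h1 (hiff.mpr h3))]; push_cast; linarith

theorem mul_neg_of_isPositive_of_rotate (h : GapData P Q R S τ a b) (hp : IsPositive P Q R S a b)
    (h' : GapData P' Q' R' S' τ a' b')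
    (hp' : IsPositive R' S' (fun x => -P' x) (fun x => -Q' x) a' b') {x : ℝ} (hx : x ∈ Ioo a b)
    (hx' : x ∈ Ioo a' b') : P x * Q x * (P' x * Q' x) < 0 := by
  have h1 := (h.mul_pos_of_isPositive hp hx).1
  have h2 := (h'.rotate.mul_pos_of_isPositive hp' hx').2
  have h3 := mul_pos h1 h2
  have h4 : τ * (P x * Q x) * (-τ * (-P' x * -Q' x)) = -(P x * Q x * (P' x * Q' x)) := by
    linear_combination (-(P x * Q x * (P' x * Q' x))) * h.sign_sq
  rw [h4] at h3
  linarith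

/-- The stable line of one gap meets the unstable line of the other one only for opposite indices,
and then exactly once. -/
theorem existsUnique_intersection (h : GapData P Q R S τ a b) (h' : GapData P' Q' R' S' τ a' b')
    {J J' : ℤ} (hJ : J = if P a * R a = 0 then 1 else -1)
    (hJ' : J' = if P' a' * R' a' = 0 then 1 else -1) (hne : (Ioo a b ∩ Ioo a' b').Nonempty) :
    (J + J' ≠ 0 → ∀ x ∈ Ioo a b ∩ Ioo a' b',
      √(P' x * Q' x * R' x * S' x) * (P x * Q x) +
        √(P x * Q x * R x * S x) * (P' x * Q' x) ≠ 0) ∧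
    (J + J' = 0 → ∃! x, x ∈ Ioo a b ∩ Ioo a' b' ∧
      √(P' x * Q' x * R' x * S' x) * (P x * Q x) +
        √(P x * Q x * R x * S x) * (P' x * Q' x) = 0) := by
  have hτ : τ ≠ 0 := by
    rintro rfl
    have := h.sign_sq
    norm_num at this
  have hassoc : ∀ p q r s : ℝ, p * q * r * s = p * q * (r * s) := fun p q r s => by ring
  have same : (∀ x ∈ Ioo a b ∩ Ioo a' b', 0 < P x * Q x * (P' x * Q' x)) →
      ∀ x ∈ Ioo a b ∩ Ioo a' b', √(P' x * Q' x * R' x * S' x) * (P x * Q x) +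
        √(P x * Q x * R x * S x) * (P' x * Q' x) ≠ 0 := by
    intro hpos x hx
    refine add_ne_zero_of_mul_pos ?_
    have h1 := Real.sqrt_pos.mpr (h.pos x hx.1)
    have h2 := Real.sqrt_pos.mpr (h'.pos x hx.2)
    have := mul_pos (mul_pos h2 h1) (hpos x hx)
    linarith
  rcases h.index_cases hJ with ⟨hp, h1⟩ | ⟨hp, h1⟩ <;>
    rcases h'.index_cases hJ' with ⟨hp', h1'⟩ | ⟨hp', h1'⟩
  · refine ⟨fun _ => same fun x hx => ?_, fun h0 => ?_⟩
    · have h2 := mul_pos (h.mul_pos_of_isPositive hp hx.1).1 (h'.mul_pos_of_isPositive hp' hx.2).1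
      linear_combination h2 + (P x * Q x * (P' x * Q' x)) * h.sign_sq
    · have : (J : ℝ) + J' = 0 := by exact_mod_cast h0
      exact absurd (by linarith) hτ
  · refine ⟨fun h0 => absurd (by exact_mod_cast (by linarith : (J : ℝ) + J' = 0)) h0, fun _ => ?_⟩
    refine (existsUnique_congr fun x => and_congr_right fun hx => ?_).mp
      (h.existsUnique_matching hp h' hp' hne)
    rw [hassoc (P' x), hassoc (P x)]
    refine (sqrt_mul_add_sqrt_mul_eq_zero_iff ?_ ?_ ?_).symm
    · linarith [h.pos x hx.1]
    · linarith [h'.pos x hx.2]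
    · exact h.mul_neg_of_isPositive_of_rotate hp h' hp' hx.1 hx.2
  · refine ⟨fun h0 => absurd (by exact_mod_cast (by linarith : (J : ℝ) + J' = 0)) h0, fun _ => ?_⟩
    rw [inter_comm] at hne
    rw [inter_comm]
    refine (existsUnique_congr fun x => and_congr_right fun hx => ?_).mp
      (h'.existsUnique_matching hp' h hp hne)
    rw [hassoc (P' x), hassoc (P x), add_comm]
    refine (sqrt_mul_add_sqrt_mul_eq_zero_iff ?_ ?_ ?_).symm
    · linarith [h'.pos x hx.1]
    · linarith [h.pos x hx.2]
    · exact h'.mul_neg_of_isPositive_of_rotate hp' h hp hx.1 hx.2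
  · refine ⟨fun _ => same fun x hx => ?_, fun h0 => ?_⟩
    · have h2 := mul_pos (h.rotate.mul_pos_of_isPositive hp hx.1).2
        (h'.rotate.mul_pos_of_isPositive hp' hx.2).2
      simp only [neg_mul_neg] at h2
      linear_combination h2 + (P x * Q x * (P' x * Q' x)) * h.sign_sq
    · have : (J : ℝ) + J' = 0 := by exact_mod_cast h0
      exact absurd (by linarith) hτ

end GapData

/-! ### Interface modes of the glued structure -/

theorem locallyIntegrable_ite {e₁ e₂ : ℝ → ℝ} (h₁ : LocallyIntegrable e₁)
    (h₂ : LocallyIntegrable e₂) : LocallyIntegrable fun x => if x < 0 then e₁ x else e₂ x := by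
  have h := (h₁.indicator (measurableSet_Iio (a := (0 : ℝ)))).add
    (h₂.indicator (measurableSet_Ici (a := (0 : ℝ))))
  refine h.congr (Eventually.of_forall fun x => ?_)
  by_cases hx : x < 0
  · simp [hx]
  · simp [hx, not_lt.mp hx]

section Interface

variable {εA εB : ℝ → ℝ → ℝ} {μ₀ ω τ : ℝ}

/-- The nonzero field is traded for a nonzero state at `0`. The profile may vanish on intervals, so
a nonzero state giving a nonzero field needs the nontriviality of material `B`. -/
theorem hasInterfaceMode_iff (hA : LocallyIntegrable fun x => εA x ω)
    (hB : IsMirrorProfile fun x => εB x ω) (hn : NontrivialProfile fun x => εB x ω) :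
    HasInterfaceMode εA εB μ₀ ω ↔ ∃ u₁ v₁ u₂ v₂ : ℝ → ℂ,
      IsSolution (fun x => εA x ω) μ₀ (ω ^ 2) u₁ v₁ ∧
      IsSolution (fun x => εB x ω) μ₀ (ω ^ 2) u₂ v₂ ∧ u₁ 0 = u₂ 0 ∧ v₁ 0 = v₂ 0 ∧
      ¬(u₂ 0 = 0 ∧ v₂ 0 = 0) ∧ Tendsto u₁ atBot (𝓝 0) ∧ Tendsto u₂ atTop (𝓝 0) := by
  have hAB : LocallyIntegrable (gluedProfile εA εB ω) :=
    locallyIntegrable_ite hA hB.locallyIntegrable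
  constructor
  · rintro ⟨u, v, h, hu, hlim⟩
    obtain ⟨u₁, v₁, h₁, a₁, b₁⟩ := exists_isSolution hA μ₀ (ω ^ 2) 0 (u 0) (v 0)
    obtain ⟨u₂, v₂, h₂, a₂, b₂⟩ := exists_isSolution hB.locallyIntegrable μ₀ (ω ^ 2) 0 (u 0) (v 0)
    have heq := fun x => (IsSolution.eq_of_eq (c := 0) hAB h
      (h₁.glue h₂ (a₁.trans a₂.symm) (b₁.trans b₂.symm)) (by simp [a₂]) (by simp [b₂]) x).1
    rw [cocompact_eq_atBot_atTop, tendsto_sup] at hlim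
    refine ⟨u₁, v₁, u₂, v₂, h₁, h₂, a₁.trans a₂.symm, b₁.trans b₂.symm, ?_, ?_, ?_⟩
    · rw [a₂, b₂]
      rintro ⟨h0, h0'⟩
      refine hu (funext fun x => ?_)
      simpa using (IsSolution.eq_of_eq (c := 0) hAB h (h.const_mul hAB 0) (by simp [h0])
        (by simp [h0']) x).1
    · refine hlim.1.congr' ?_
      filter_upwards [eventually_lt_atBot 0] with x hx
      rw [heq, if_pos hx]
    · refine hlim.2.congr' ?_
      filter_upwards [eventually_ge_atTop 0] with x hx
      rw [heq, if_neg (not_lt.mpr hx)]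
  · rintro ⟨u₁, v₁, u₂, v₂, h₁, h₂, h0, h0', hne, l₁, l₂⟩
    refine ⟨_, _, h₁.glue h₂ h0 h0', fun hz => hne ?_, ?_⟩
    · have hpos : ∀ x, 0 ≤ x → u₂ x = 0 := fun x hx => by
        simpa [not_lt.mpr hx] using congrFun hz x
      have hu0 := hpos 0 le_rfl
      -- The profile is even about `0`, so a solution with zero field there is odd, and vanishing on
      -- the right spreads to the left.
      have hodd := fun x => (IsSolution.eq_of_eq (c := 0) hB.locallyIntegrable h₂
        ((h₂.reflect hB.locallyIntegrable hB.even).const_mul hB.locallyIntegrable (-1))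
        (by simp [hu0]) (by simp) x).1
      have hall : u₂ = 0 := by
        funext x
        rcases le_total 0 x with hx | hx
        · exact hpos x hx
        · rw [hodd, hpos (0 - x) (by linarith)]
          simp
      exact ⟨hu0, hn.flux_eq_zero h₂ hall 0⟩
    · rw [cocompact_eq_atBot_atTop, tendsto_sup]
      constructor
      · refine l₁.congr' ?_
        filter_upwards [eventually_lt_atBot 0] with x hx
        rw [if_pos hx]
      · refine l₂.congr' ?_
        filter_upwards [eventually_ge_atTop 0] with x hx
        rw [if_neg (not_lt.mpr hx)]

theorem tendsto_sub_atTop_iff {u : ℝ → ℂ} :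
    Tendsto (fun x => u (0 - x)) atTop (𝓝 0) ↔ Tendsto u atBot (𝓝 0) := by
  simp only [zero_sub]
  exact ⟨fun h => by simpa [Function.comp_def] using h.comp tendsto_neg_atBot_atTop,
    fun h => h.comp tendsto_neg_atTop_atBot⟩

theorem not_hasInterfaceMode_of_edge (hA : IsMirrorProfile fun x => εA x ω)
    (hnA : NontrivialProfile fun x => εA x ω) (hB : IsMirrorProfile fun x => εB x ω)
    (hnB : NontrivialProfile fun x => εB x ω)
    (h : cellP (fun x => εA x ω) (μ₀ * ω ^ 2) * cellQ (fun x => εA x ω) (μ₀ * ω ^ 2) *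
        cellR (fun x => εA x ω) (μ₀ * ω ^ 2) * cellS (fun x => εA x ω) (μ₀ * ω ^ 2) = 0 ∨
      cellP (fun x => εB x ω) (μ₀ * ω ^ 2) * cellQ (fun x => εB x ω) (μ₀ * ω ^ 2) *
        cellR (fun x => εB x ω) (μ₀ * ω ^ 2) * cellS (fun x => εB x ω) (μ₀ * ω ^ 2) = 0) :
    ¬ HasInterfaceMode εA εB μ₀ ω := by
  rw [hasInterfaceMode_iff hA.locallyIntegrable hB hnB]
  rintro ⟨u₁, v₁, u₂, v₂, h₁, h₂, h0, h0', hne, l₁, l₂⟩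
  rcases h with h | h
  · have := hA.state_eq_zero_of_tendsto_atTop hnA (h₁.reflect hA.locallyIntegrable hA.even) h
      (tendsto_sub_atTop_iff.mpr l₁)
    rw [sub_zero, neg_eq_zero, h0, h0'] at this
    exact hne this
  · exact hne (hB.state_eq_zero_of_tendsto_atTop hnB h₂ h l₂)

theorem hasInterfaceMode_iff_of_gap (hA : IsMirrorProfile fun x => εA x ω)
    (hB : IsMirrorProfile fun x => εB x ω) (hnB : NontrivialProfile fun x => εB x ω)
    (hτ : τ ^ 2 = 1)
    (posA : 0 < cellP (fun x => εA x ω) (μ₀ * ω ^ 2) * cellQ (fun x => εA x ω) (μ₀ * ω ^ 2) *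
      cellR (fun x => εA x ω) (μ₀ * ω ^ 2) * cellS (fun x => εA x ω) (μ₀ * ω ^ 2))
    (posB : 0 < cellP (fun x => εB x ω) (μ₀ * ω ^ 2) * cellQ (fun x => εB x ω) (μ₀ * ω ^ 2) *
      cellR (fun x => εB x ω) (μ₀ * ω ^ 2) * cellS (fun x => εB x ω) (μ₀ * ω ^ 2))
    (signA : 0 < τ * (cellP (fun x => εA x ω) (μ₀ * ω ^ 2) * cellS (fun x => εA x ω) (μ₀ * ω ^ 2)))
    (signB : 0 < τ * (cellP (fun x => εB x ω) (μ₀ * ω ^ 2) *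
      cellS (fun x => εB x ω) (μ₀ * ω ^ 2))) :
    HasInterfaceMode εA εB μ₀ ω ↔
      √(cellP (fun x => εB x ω) (μ₀ * ω ^ 2) * cellQ (fun x => εB x ω) (μ₀ * ω ^ 2) *
        cellR (fun x => εB x ω) (μ₀ * ω ^ 2) * cellS (fun x => εB x ω) (μ₀ * ω ^ 2)) *
          (cellP (fun x => εA x ω) (μ₀ * ω ^ 2) * cellQ (fun x => εA x ω) (μ₀ * ω ^ 2)) +
      √(cellP (fun x => εA x ω) (μ₀ * ω ^ 2) * cellQ (fun x => εA x ω) (μ₀ * ω ^ 2) *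
        cellR (fun x => εA x ω) (μ₀ * ω ^ 2) * cellS (fun x => εA x ω) (μ₀ * ω ^ 2)) *
          (cellP (fun x => εB x ω) (μ₀ * ω ^ 2) * cellQ (fun x => εB x ω) (μ₀ * ω ^ 2)) = 0 := by
  have decA : ∀ {u v : ℝ → ℂ}, IsSolution (fun x => εA x ω) μ₀ (ω ^ 2) u v →
      (Tendsto u atBot (𝓝 0) ↔ _) := fun h => tendsto_sub_atTop_iff.symm.trans
    (hA.tendsto_atTop_iff (h.reflect hA.locallyIntegrable hA.even) posA hτ signA)
  have decB : ∀ {u v : ℝ → ℂ}, IsSolution (fun x => εB x ω) μ₀ (ω ^ 2) u v →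
      (Tendsto u atTop (𝓝 0) ↔ _) := fun h => hB.tendsto_atTop_iff h posB hτ signB
  have bA : cellP (fun x => εA x ω) (μ₀ * ω ^ 2) * cellQ (fun x => εA x ω) (μ₀ * ω ^ 2) ≠ 0 :=
    left_ne_zero_of_mul (left_ne_zero_of_mul posA.ne')
  rw [hasInterfaceMode_iff hA.locallyIntegrable hB hnB]
  simp only [← Complex.ofReal_mul, sub_zero] at decA decB
  generalize √(cellP (fun x => εA x ω) (μ₀ * ω ^ 2) * cellQ (fun x => εA x ω) (μ₀ * ω ^ 2) *
        cellR (fun x => εA x ω) (μ₀ * ω ^ 2) * cellS (fun x => εA x ω) (μ₀ * ω ^ 2)) = d at *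
  generalize √(cellP (fun x => εB x ω) (μ₀ * ω ^ 2) * cellQ (fun x => εB x ω) (μ₀ * ω ^ 2) *
        cellR (fun x => εB x ω) (μ₀ * ω ^ 2) * cellS (fun x => εB x ω) (μ₀ * ω ^ 2)) = d' at *
  generalize cellP (fun x => εA x ω) (μ₀ * ω ^ 2) * cellQ (fun x => εA x ω) (μ₀ * ω ^ 2) = b at *
  generalize cellP (fun x => εB x ω) (μ₀ * ω ^ 2) * cellQ (fun x => εB x ω) (μ₀ * ω ^ 2) = b' at *
  have hτ' : (τ : ℂ) ^ 2 = 1 := by exact_mod_cast hτ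
  constructor
  · rintro ⟨u₁, v₁, u₂, v₂, h₁, h₂, h0, h0', hne, l₁, l₂⟩
    have k₁ := (decA h₁).mp l₁
    have k₂ := (decB h₂).mp l₂
    rw [h0, h0'] at k₁
    push_cast at k₁ k₂
    -- The two decay conditions are linear in the common state; up to a sign, their determinant is
    -- `τ` times the matching expression.
    by_contra hcon
    have hcon' : (d' : ℂ) * b + d * b' ≠ 0 := by exact_mod_cast hcon
    refine hne ⟨?_, ?_⟩
    · refine (mul_eq_zero.mp ?_).resolve_left hcon'
      linear_combination τ * b' * k₁ + τ * b * k₂ - (d' * b + d * b') * u₂ 0 * hτ'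
    · refine (mul_eq_zero.mp ?_).resolve_left hcon'
      linear_combination d * k₂ - d' * k₁
  · intro h0
    have h0' : (d' : ℂ) * b + d * b' = 0 := by exact_mod_cast h0
    -- The state `(b, τ * d)` spans the line decaying to the left in `A`; the matching equation puts
    -- it on the decaying line of `B`.
    obtain ⟨u₁, v₁, h₁, a₁, b₁⟩ := exists_isSolution hA.locallyIntegrable μ₀ (ω ^ 2) 0 b (τ * d)
    obtain ⟨u₂, v₂, h₂, a₂, b₂⟩ := exists_isSolution hB.locallyIntegrable μ₀ (ω ^ 2) 0 b (τ * d)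
    refine ⟨u₁, v₁, u₂, v₂, h₁, h₂, a₁.trans a₂.symm, b₁.trans b₂.symm, fun hz => ?_,
      (decA h₁).mpr ?_, (decB h₂).mpr ?_⟩
    · rw [a₂] at hz
      exact bA (by exact_mod_cast hz.1)
    · rw [a₁, b₁]
      push_cast
      ring
    · rw [a₂, b₂]
      push_cast
      linear_combination τ * h0'

end Interface

theorem mainTheorem1 (μ₀ : ℝ) (hμ₀ : 0 < μ₀) (εA εB : ℝ → ℝ → ℝ) (n : ℕ) (aA bA aB bB : ℝ)
    (hA : IsMirrorMaterialOn εA (Icc aA bA)) (hB : IsMirrorMaterialOn εB (Icc aB bB))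
    (hgapA : IsBandGap εA μ₀ n aA bA) (hgapB : IsBandGap εB μ₀ n aB bB)
    (hoverlap : (Ioo aA bA ∩ Ioo aB bB).Nonempty) :
    (bulkIndex εA μ₀ aA + bulkIndex εB μ₀ aB ≠ 0 →
      ∀ ω ∈ Icc aA bA ∩ Icc aB bB, ¬ HasInterfaceMode εA εB μ₀ ω) ∧
    (bulkIndex εA μ₀ aA + bulkIndex εB μ₀ aB = 0 →
      ∃! ω : ℝ, ω ∈ Icc aA bA ∩ Icc aB bB ∧ HasInterfaceMode εA εB μ₀ ω) := by
  have dA := gapData_of_isBandGap hμ₀ hA hgapA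
  have dB := gapData_of_isBandGap hμ₀ hB hgapB
  have key := dA.existsUnique_intersection dB (bulkIndex_eq hμ₀ hA hgapA)
    (bulkIndex_eq hμ₀ hB hgapB) hoverlap
  have nA := fun ω hω => nontrivialProfile_of_isBandGap (ω := ω) hμ₀ hA hgapA hω
  have nB := fun ω hω => nontrivialProfile_of_isBandGap (ω := ω) hμ₀ hB hgapB hω
  have inner : ∀ ω ∈ Ioo aA bA ∩ Ioo aB bB, (HasInterfaceMode εA εB μ₀ ω ↔ _) := fun ω hω =>
    hasInterfaceMode_iff_of_gap (hA.profile (Ioo_subset_Icc_self hω.1))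
      (hB.profile (Ioo_subset_Icc_self hω.2)) (nB ω (Ioo_subset_Icc_self hω.2)) dA.sign_sq
      (dA.pos ω hω.1) (dB.pos ω hω.2) (dA.sign_pos ω hω.1) (dB.sign_pos ω hω.2)
  -- An edge of either gap rules out a mode, because decay on that material's side forces the zero
  -- state at `0`.
  have outer : ∀ ω ∈ Icc aA bA ∩ Icc aB bB, HasInterfaceMode εA εB μ₀ ω →
      ω ∈ Ioo aA bA ∩ Ioo aB bB := by
    intro ω hω hmode
    have hno := fun hedge => not_hasInterfaceMode_of_edge (hA.profile hω.1) (nA ω hω.1)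
      (hB.profile hω.2) (nB ω hω.2) hedge hmode
    refine ⟨⟨lt_of_le_of_ne hω.1.1 ?_, lt_of_le_of_ne hω.1.2 ?_⟩,
      ⟨lt_of_le_of_ne hω.2.1 ?_, lt_of_le_of_ne hω.2.2 ?_⟩⟩ <;> rintro rfl
    · exact hno (Or.inl dA.left)
    · exact hno (Or.inl dA.right)
    · exact hno (Or.inr dB.left)
    · exact hno (Or.inr dB.right)
  refine ⟨fun h ω hω hmode => ?_, fun h => ?_⟩
  · have hω' := outer ω hω hmode
    exact key.1 h ω hω' ((inner ω hω').mp hmode)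
  · refine (existsUnique_congr fun ω => ?_).mp (key.2 h)
    constructor
    · rintro ⟨hω, h0⟩
      exact ⟨⟨Ioo_subset_Icc_self hω.1, Ioo_subset_Icc_self hω.2⟩, (inner ω hω).mpr h0⟩
    · rintro ⟨hω, hmode⟩
      have hω' := outer ω hω hmode
      exact ⟨hω', (inner ω hω').mp hmode⟩
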